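/- Let $n\ge 3$ and let the nodes $0,1,\dots,n-1$ of the simple cycle $0,1,\dots,n-1,0$ be labeled: each node $v$ carries a real number $x_v$ (repetitions are allowed) and one of the three requests insert, delete, successor query. The random walk $v^0,v^1,v^2,\dots$ starts at $v^0=0$ and in each step hops to one of the two neighbors of the current node, each with probability $1/2$. The active sets are $X^0=\emptyset$ and, for $t\ge1$, $X^t=X^{t-1}\cup\{x_{v^t}\}$, $X^t=X^{t-1}\setminus\{x_{v^t}\}$ or $X^t=X^{t-1}$ according to whether $v^t$ carries an insertion, a deletion or a query; if $v^t$ carries a query, then at time $t$ one has to report $\min\{x\in X^t : x\ge x_{v^t}\}$ (as a node that carries this number), or $\infty$ if there is no such $x$. The model of computation is a deterministic unit-cost random access machine whose memory cells store integers of $O(\log n)$ bits (nonnegative integers less than $n^{C}$ for a constant $C$), with direct and indirect addressing, integer arithmetic ($+$, truncated $-$, $\times$, integer division and remainder) and comparisons; the labels of the cycle are a read-only input, from which the machine can read the request at a given node and compare the numbers at two given nodes. Theorem. There are an algorithm (a setup program and a program for serving a request, both independent of $n$ and of the labels) and a constant $C$ such that the following holds for every $n\ge3$ and every labeling of the $n$-cycle.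 The algorithm is first set up, knowing $n$ and the labels but not the walk, in time at most $n^{C}$. After that, at each time $t\ge1$, it is told $v^t$ (and knows nothing about the future of the walk), halts, and answers correctly if $v^t$ carries a query, whatever the walk has been so far. For every $t\ge1$, the expected number of elementary operations that it executes at time $t$ is at most $C$. Setup and service together never use more than $Cn$ memory cells. -/

import Mathlib

open scoped ENNReal

/-- The three kinds of requests attached to the nodes of an event graph. -/
inductive Request
  | insert
  | delete
  | query

/-- The number by which a machine sees a request. -/
def Request.code : Request → ℕ
  | .insert => 0
  | .delete => 1
  | .query => 2

/-- An event graph that is the simple cycle `0, 1, …, n - 1, 0`: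
node `v` carries the request `req v` on the real number `item v`.
Items may coincide. -/
structure EventCycle (n : ℕ) where
  req : Fin n → Request
  item : Fin n → ℝ

/-! ### The random walk

A history is the list of the nodes visited so far, the most recent one first. -/

/-- One hop of the random walk: each of the two neighbors `v + 1`, `v - 1` (taken cyclically)
has probability `1 / 2`. -/
noncomputable def hopLaw {n : ℕ} [NeZero n] (v : Fin n) : PMF (Fin n) :=
  (PMF.uniformOfFintype Bool).map fun b => if b then v + 1 else v - 1

/-- The law of the history `[v^t, …, v^1, v^0]` at time `t` of the random walk
that starts at node `0`. -/
noncomputable def walkLaw (n : ℕ) [NeZero n] : ℕ → PMF (List (Fin n))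
  | 0 => PMF.pure [0]
  | t + 1 => (walkLaw n t).bind fun h => (hopLaw (h.headD 0)).map fun v => v :: h

namespace EventCycle

/-- The active set `X^t` after the history `[v^t, …, v^0]`. It is empty at time `0`,
and the request at `v^t` is carried out for every `t > 0`. -/
def active {n : ℕ} (G : EventCycle n) : List (Fin n) → Set ℝ
  | [] => ∅
  | [_] => ∅
  | v :: u :: h =>
    match G.req v with
    | .insert => G.active (u :: h) ∪ {G.item v}
    | .delete => G.active (u :: h) \ {G.item v}
    | .query => G.active (u :: h)

/-- The number `a` represents the successor `min {y ∈ X | x ≤ y}`: either `a` is a node whose item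
is this minimum, or `a = n`, which stands for `∞`, and there is no such `y`. -/
def IsSucc {n : ℕ} (G : EventCycle n) (X : Set ℝ) (x : ℝ) (a : ℕ) : Prop :=
  (∃ h : a < n, IsLeast {y ∈ X | x ≤ y} (G.item ⟨a, h⟩)) ∨ (a = n ∧ {y ∈ X | x ≤ y} = ∅)

end EventCycle

/-! ### The machine model

Structured programs for a unit-cost random access machine. The memory is an array of cells that
hold natural numbers. Only cells with address below `S` can be written, and only numbers below `W`
can be stored (the machine gets stuck otherwise); all other cells hold `0` forever.
The labels of the cycle are a read-only input: the machine can read the kind of request at a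
given node and compare the items of two given nodes. -/

abbrev Mem := ℕ → ℕ

inductive ArithOp
  | add
  | sub
  | mul
  | div
  | mod

def ArithOp.eval : ArithOp → ℕ → ℕ → ℕ
  | .add, x, y => x + y
  | .sub, x, y => x - y
  | .mul, x, y => x * y
  | .div, x, y => x / y
  | .mod, x, y => x % y

/-- Elementary instructions; each writes one cell. -/
inductive Instr
  /-- `M[a] := k` -/
  | const (a k : ℕ)
  /-- `M[a] := M[b]` -/
  | copy (a b : ℕ)
  /-- `M[a] := M[b] ∘ M[c]` -/
  | arith (o : ArithOp) (a b c : ℕ)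
  /-- `M[a] := M[M[b]]` -/
  | load (a b : ℕ)
  /-- `M[M[a]] := M[b]` -/
  | store (a b : ℕ)
  /-- `M[a] :=` code of the request at node `M[b]` -/
  | readReq (a b : ℕ)

/-- The address of the cell that an instruction writes. -/
def Instr.target (m : Mem) : Instr → ℕ
  | .const a _ => a
  | .copy a _ => a
  | .arith _ a _ _ => a
  | .load a _ => a
  | .store a _ => m a
  | .readReq a _ => a

/-- The number that an instruction writes. -/
def Instr.value {n : ℕ} (G : EventCycle n) (m : Mem) : Instr → ℕ
  | .const _ k => k
  | .copy _ b => m b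
  | .arith o _ b c => o.eval (m b) (m c)
  | .load _ b => m (m b)
  | .store _ b => m b
  | .readReq _ b => if h : m b < n then (G.req ⟨m b, h⟩).code else 0

/-- Tests on which a program can branch. -/
inductive Test
  /-- `M[a] = M[b]` -/
  | eq (a b : ℕ)
  /-- `M[a] ≠ M[b]` -/
  | ne (a b : ℕ)
  /-- `M[a] ≤ M[b]` -/
  | le (a b : ℕ)
  /-- `M[a] < M[b]` -/
  | lt (a b : ℕ)
  /-- `M[a]` and `M[b]` are nodes, and the item of the first is at most that of the second -/
  | itemLE (a b : ℕ)

def Test.Holds {n : ℕ} (G : EventCycle n) (m : Mem) : Test → Prop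
  | .eq a b => m a = m b
  | .ne a b => m a ≠ m b
  | .le a b => m a ≤ m b
  | .lt a b => m a < m b
  | .itemLE a b => ∃ (ha : m a < n) (hb : m b < n), G.item ⟨m a, ha⟩ ≤ G.item ⟨m b, hb⟩

inductive Prog
  | skip
  | instr (i : Instr)
  | seq (p q : Prog)
  | ite (c : Test) (p q : Prog)
  | loop (c : Test) (p : Prog)

/-- `Exec G S W p m τ m'`: on the input `G`, with cells `0, …, S - 1` and numbers below `W`, the
program `p` started on the memory `m` halts with the memory `m'`, after `τ` elementary steps.
Every instruction and every evaluation of a test is one step. `loop c p` repeats `p` while `c`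
holds. -/
inductive Exec {n : ℕ} (G : EventCycle n) (S W : ℕ) : Prog → Mem → ℕ → Mem → Prop
  | skip (m : Mem) : Exec G S W .skip m 0 m
  | instr (i : Instr) (m : Mem) (ht : i.target m < S) (hv : i.value G m < W) :
      Exec G S W (.instr i) m 1 (Function.update m (i.target m) (i.value G m))
  | seq {p q : Prog} {m m₁ m₂ : Mem} {τ₁ τ₂ : ℕ}
      (h₁ : Exec G S W p m τ₁ m₁) (h₂ : Exec G S W q m₁ τ₂ m₂) :
      Exec G S W (.seq p q) m (τ₁ + τ₂) m₂
  | ite_true {c : Test} {p q : Prog} {m m₁ : Mem} {τ : ℕ}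
      (hc : c.Holds G m) (h : Exec G S W p m τ m₁) :
      Exec G S W (.ite c p q) m (1 + τ) m₁
  | ite_false {c : Test} {p q : Prog} {m m₁ : Mem} {τ : ℕ}
      (hc : ¬ c.Holds G m) (h : Exec G S W q m τ m₁) :
      Exec G S W (.ite c p q) m (1 + τ) m₁
  | loop_true {c : Test} {p : Prog} {m m₁ m₂ : Mem} {τ₁ τ₂ : ℕ}
      (hc : c.Holds G m) (h₁ : Exec G S W p m τ₁ m₁) (h₂ : Exec G S W (.loop c p) m₁ τ₂ m₂) :
      Exec G S W (.loop c p) m (1 + τ₁ + τ₂) m₂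
  | loop_false {c : Test} {p : Prog} {m : Mem} (hc : ¬ c.Holds G m) :
      Exec G S W (.loop c p) m 1 m

/-- The machine is deterministic: a program has at most one halting computation. -/
theorem Exec.unique {n : ℕ} {G : EventCycle n} {S W : ℕ} {p : Prog} {m m₁ m₂ : Mem} {τ₁ τ₂ : ℕ}
    (h₁ : Exec G S W p m τ₁ m₁) (h₂ : Exec G S W p m τ₂ m₂) : τ₁ = τ₂ ∧ m₁ = m₂ := by
  induction h₁ generalizing τ₂ m₂ with
  | skip m => cases h₂; exact ⟨rfl, rfl⟩
  | instr i m ht hv => cases h₂; exact ⟨rfl, rfl⟩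
  | seq _ _ ih ih' =>
    cases h₂ with
    | seq k k' =>
      obtain ⟨rfl, rfl⟩ := ih k
      obtain ⟨rfl, rfl⟩ := ih' k'
      exact ⟨rfl, rfl⟩
  | ite_true hc _ ih =>
    cases h₂ with
    | ite_true _ k => obtain ⟨rfl, rfl⟩ := ih k; exact ⟨rfl, rfl⟩
    | ite_false hc' _ => exact absurd hc hc'
  | ite_false hc _ ih =>
    cases h₂ with
    | ite_true hc' _ => exact absurd hc' hc
    | ite_false _ k => obtain ⟨rfl, rfl⟩ := ih k; exact ⟨rfl, rfl⟩
  | loop_true hc _ _ ih ih' =>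
    cases h₂ with
    | loop_true _ k k' =>
      obtain ⟨rfl, rfl⟩ := ih k
      obtain ⟨rfl, rfl⟩ := ih' k'
      exact ⟨rfl, rfl⟩
    | loop_false hc' => exact absurd hc hc'
  | loop_false hc =>
    cases h₂ with
    | loop_true hc' _ _ => exact absurd hc' hc
    | loop_false _ => exact ⟨rfl, rfl⟩

/-- A data structure: a program that sets it up, and a program that serves a request. -/
structure Algorithm where
  setup : Prog
  serve : Prog

/-- `Run A G S W h τ m`: along the history `h = [v^t, …, v^0]` the algorithm halts on all requests;
`τ` is the number of steps spent at time `t` and `m` is the memory afterwards.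
At time `0` the algorithm is set up: it finds the number `n` in cell `0`, and `0` in all other
cells. At each later time `t` the memory is that left at time `t - 1`, except that cell `0` receives
the current node `v^t`; in particular, the algorithm does not know the future of the walk. -/
inductive Run {n : ℕ} (A : Algorithm) (G : EventCycle n) (S W : ℕ) :
    List (Fin n) → ℕ → Mem → Prop
  | setup {v : Fin n} {τ : ℕ} {m : Mem}
      (h : Exec G S W A.setup (Function.update (fun _ => 0) 0 n) τ m) :
      Run A G S W [v] τ m
  | serve {u v : Fin n} {h : List (Fin n)} {τ τ' : ℕ} {m m' : Mem}
      (hr : Run A G S W (u :: h) τ m)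
      (he : Exec G S W A.serve (Function.update m 0 v) τ' m') :
      Run A G S W (v :: u :: h) τ' m'

/-! ### Structured states and a program logic

A memory is viewed as 32 registers and a family of arrays: cell `i` of array `j` has
the address `64 * i + (64 + j)`. The cells `32, …, 63` are scratch space for expressions. -/

/-! The cycle is unrolled to the line and the walk is watched at the scales R = 64^j. Level R has a
center, the last multiple of R visited by the lifted walk, and a window, the nodes at distance at
most 2R - 2 from the center. For each node of the window it stores the successor of its rank among
those active ranks that no node of the window carries. While the walk stays in the window, requests
only affect ranks carried there, so the stored data stays valid without any work
(`Level.congr_act`). For R = 1 the window is the current node alone, and the stored number answers a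
query unless the queried item is itself active. The top window is the whole cycle and is never
rebuilt.

When the walk reaches distance R from the center of a level, this level is rebuilt around the
current node from the next larger one, whose window contains the new one (`InW.mono`). The larger
list is sorted by decreasing rank, so a single scan knows the least active rank passed so far that
the new window does not carry; its minimum with the old entry is the new entry
(`nxt_not_represented`, `wp_scan`). This takes O(R) steps. The levels to be rebuilt form an initial
segment (`Moved.of_dvd`), the costs are geometric, and a request costs O(`work`) (`wp_serve_inv`).

At each fixed time, level R = r^6 moves with probability O(r^-7) (`prob_moved_le`), so the expected
work is at most a constant times the sum of 64^j / 128^j (`avg_work_le`). After at least r^6 + r^8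
hops, a move forces the last r^6 hops not to return to the final position, which has probability
O(r^-3) by a last-return decomposition (`prob_noReturn_le`). It also forces the position to be a
multiple of R; given the last hops, this has probability O(r^-4), because of the r^8 or more hops
before (`prob_dvd_le`). At earlier times the walk would have had to travel a distance r^6 within 2
r^8 hops, which a Chernoff bound makes unlikely (`prob_moved_le_of_lt`).

The programs are verified with a weakest-precondition calculus that counts steps (`WP`), and
expectations over `walkLaw` become averages over lists of bits (`tsum_walkLaw`). -/

structure St where
  reg : ℕ → ℕ
  arr : ℕ → ℕ → ℕ

namespace St

def setReg (s : St) (x v : ℕ) : St := ⟨Function.update s.reg x v, s.arr⟩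

def setArr (s : St) (j i v : ℕ) : St :=
  ⟨s.reg, Function.update s.arr j (Function.update (s.arr j) i v)⟩

@[simp] theorem setReg_reg (s : St) (x v y : ℕ) :
    (s.setReg x v).reg y = if y = x then v else s.reg y := by
  simp [setReg, Function.update_apply]

@[simp] theorem setReg_arr (s : St) (x v : ℕ) : (s.setReg x v).arr = s.arr := rfl

@[simp] theorem setArr_reg (s : St) (j i v : ℕ) : (s.setArr j i v).reg = s.reg := rfl

@[simp] theorem setArr_arr (s : St) (j i v j' i' : ℕ) :
    (s.setArr j i v).arr j' i' = if j' = j ∧ i' = i then v else s.arr j' i' := by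
  simp only [setArr, Function.update_apply]
  by_cases h : j' = j
  · subst h; simp [Function.update_apply]
  · simp [h]

theorem setArr_arr_of_ne (s : St) {j i v j' : ℕ} (h : j' ≠ j) :
    (s.setArr j i v).arr j' = s.arr j' := by
  simp [setArr, Function.update_of_ne h]

end St

/-- The memory `m` holds the state `s`. -/
structure Represents (m : Mem) (s : St) : Prop where
  reg : ∀ x, x < 32 → m x = s.reg x
  arr : ∀ j i, j < 64 → m (64 * i + (64 + j)) = s.arr j i

/-- Arithmetic expressions over registers, arrays and the input. -/
inductive Ex
  | lit (k : ℕ)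
  | var (x : ℕ)
  | op (o : ArithOp) (a b : Ex)
  | get (j : ℕ) (a : Ex)
  | req (a : Ex)

namespace Ex

variable {n : ℕ}

def eval (G : EventCycle n) (s : St) : Ex → ℕ
  | lit k => k
  | var x => s.reg x
  | op o a b => o.eval (a.eval G s) (b.eval G s)
  | get j a => s.arr j (a.eval G s)
  | req a => if h : a.eval G s < n then (G.req ⟨a.eval G s, h⟩).code else 0

/-- All numbers that occur in the evaluation of an expression at depth `d` are below `W`. -/
def Ok (G : EventCycle n) (W : ℕ) (s : St) : Ex → ℕ → Prop
  | lit k, d => d < 31 ∧ k < W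
  | var x, d => d < 31 ∧ x < 32 ∧ s.reg x < W
  | op o a b, d => a.Ok G W s d ∧ b.Ok G W s (d + 1) ∧ d < 30 ∧
      o.eval (a.eval G s) (b.eval G s) < W
  | get j a, d => a.Ok G W s d ∧ d < 31 ∧ j < 64 ∧ 128 < W ∧ 64 * a.eval G s + (64 + j) < W ∧
      s.arr j (a.eval G s) < W
  | req a, d => a.Ok G W s d ∧ d < 31 ∧ 3 < W

def cost : Ex → ℕ
  | lit _ => 1
  | var _ => 1
  | op _ a b => a.cost + (b.cost + 1)
  | get _ a => a.cost + 5
  | req a => a.cost + 1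

/-- Turns the number in scratch cell `d` into the address of the corresponding cell of array `j`. -/
def addr (j d : ℕ) : Prog :=
  .seq (.instr (.const (33 + d) 64)) (.seq (.instr (.arith .mul (32 + d) (32 + d) (33 + d)))
    (.seq (.instr (.const (33 + d) (64 + j))) (.instr (.arith .add (32 + d) (32 + d) (33 + d)))))

/-- Code that leaves the value of an expression in scratch cell `d`. -/
def code : Ex → ℕ → Prog
  | lit k, d => .instr (.const (32 + d) k)
  | var x, d => .instr (.copy (32 + d) x)
  | op o a b, d => .seq (a.code d) (.seq (b.code (d + 1))
      (.instr (.arith o (32 + d) (32 + d) (33 + d))))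
  | get j a, d => .seq (a.code d) (.seq (addr j d) (.instr (.load (32 + d) (32 + d))))
  | req a, d => .seq (a.code d) (.instr (.readReq (32 + d) (32 + d)))

end Ex

/-- `m'` differs from `m` in scratch cells from `d` on only. -/
def AgreeBelow (d : ℕ) (m m' : Mem) : Prop := ∀ a, a < 32 + d ∨ 64 ≤ a → m' a = m a

/-- Expression code touches only scratch cells, which belong to no register and no array. -/
theorem AgreeBelow.rep {d : ℕ} {m m' : Mem} {s : St} (h : AgreeBelow d m m') (hr : Represents m s) :
    Represents m' s :=
  ⟨fun x hx => by rw [h x (by omega), hr.reg x hx],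
    fun j i hj => by rw [h _ (by omega), hr.arr j i hj]⟩

theorem AgreeBelow.trans {d e : ℕ} {m m' m'' : Mem} (h : AgreeBelow d m m')
    (h' : AgreeBelow e m' m'') (hde : d ≤ e) : AgreeBelow d m m'' :=
  fun a ha => by rw [h' a (by omega), h a ha]

theorem agreeBelow_update {d e v : ℕ} {m : Mem} (hd : d ≤ e) (he : e < 32) :
    AgreeBelow d m (Function.update m (32 + e) v) :=
  fun a ha => Function.update_of_ne (by omega) _ _

theorem request_code_lt (r : Request) : r.code < 3 := by cases r <;> simp [Request.code]

/-! ### Compiled expressions, and proof rules that count steps -/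

section
variable {n : ℕ} {G : EventCycle n} {S W : ℕ}

theorem exec_instr {i : Instr} {m : Mem} {t v : ℕ} (ht : i.target m = t) (hv : i.value G m = v)
    (htS : t < S) (hvW : v < W) : Exec G S W (.instr i) m 1 (Function.update m t v) := by
  subst ht hv; exact .instr i m htS hvW

/-- The constants 64 and 64 + j pass through cell `33 + d`, whence the bounds `d < 31` and `128 <
W`. -/
theorem Ex.exec_addr (hS : 64 ≤ S) {j d : ℕ} {m : Mem} (hd : d < 31) (hj : j < 64) (hW : 128 < W)
    (h : 64 * m (32 + d) + (64 + j) < W) :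
    ∃ m', Exec G S W (addr j d) m 4 m' ∧ m' (32 + d) = 64 * m (32 + d) + (64 + j) ∧
      AgreeBelow d m m' := by
  have h1 := exec_instr (G := G) (S := S) (W := W) (i := .const (33 + d) 64) (m := m) rfl rfl
    (by simp only [Instr.target]; omega) (by simp only [Instr.value]; omega)
  set m1 := Function.update m (33 + d) 64 with hm1
  have e1 : m1 (32 + d) = m (32 + d) := Function.update_of_ne (by omega) _ _
  have e1' : m1 (33 + d) = 64 := Function.update_self ..
  have h2 := exec_instr (G := G) (S := S) (W := W)
    (i := .arith .mul (32 + d) (32 + d) (33 + d)) (m := m1) (t := 32 + d) (v := 64 * m (32 + d)) rfl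
    (by simp only [Instr.value, ArithOp.eval, e1, e1']; ring) (by omega) (by omega)
  set m2 := Function.update m1 (32 + d) (64 * m (32 + d)) with hm2
  have h3 := exec_instr (G := G) (S := S) (W := W) (i := .const (33 + d) (64 + j)) (m := m2) rfl rfl
    (by simp only [Instr.target]; omega) (by simp only [Instr.value]; omega)
  set m3 := Function.update m2 (33 + d) (64 + j) with hm3
  have e3 : m3 (32 + d) = 64 * m (32 + d) := by
    rw [hm3, Function.update_of_ne (by omega), hm2, Function.update_self]
  have e3' : m3 (33 + d) = 64 + j := Function.update_self ..
  have h4 := exec_instr (G := G) (S := S) (W := W)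
    (i := .arith .add (32 + d) (32 + d) (33 + d)) (m := m3) (t := 32 + d)
    (v := 64 * m (32 + d) + (64 + j)) rfl
    (by simp only [Instr.value, ArithOp.eval, e3, e3']) (by omega) (by omega)
  refine ⟨_, .seq h1 (.seq h2 (.seq h3 h4)), Function.update_self .., ?_⟩
  intro a ha
  rw [Function.update_of_ne (by omega), hm3, Function.update_of_ne (by omega), hm2,
    Function.update_of_ne (by omega), hm1, Function.update_of_ne (by omega)]

/-- The scratch cells form an evaluation stack: the first operand in cell `32 + d` survives because
the second one is evaluated in cells from `33 + d` on. -/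
theorem Ex.exec_code (hS : 64 ≤ S) {s : St} (e : Ex) : ∀ {d : ℕ} {m : Mem}, Represents m s →
    e.Ok G W s d → ∃ m', Exec G S W (e.code d) m e.cost m' ∧ m' (32 + d) = e.eval G s ∧
      AgreeBelow d m m' := by
  induction e with
  | lit k =>
    intro d m _ ⟨h1, h2⟩
    exact ⟨_, exec_instr rfl rfl (by simp only [Instr.target]; omega) h2, Function.update_self .., agreeBelow_update le_rfl
      (by omega)⟩
  | var x =>
    intro d m hr ⟨h1, h2, h3⟩
    exact ⟨_, exec_instr rfl (hr.reg x h2) (by simp only [Instr.target]; omega) h3, Function.update_self ..,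
      agreeBelow_update le_rfl (by omega)⟩
  | op o a b iha ihb =>
    intro d m hr ⟨ha, hb, hd, h⟩
    obtain ⟨m1, x1, v1, g1⟩ := iha hr ha
    obtain ⟨m2, x2, v2, g2⟩ := ihb (g1.rep hr) hb
    refine ⟨_, .seq x1 (.seq x2 (exec_instr (t := 32 + d)
      (v := o.eval (a.eval G s) (b.eval G s)) rfl ?_ (by omega) h)),
      Function.update_self .., ?_⟩
    · simp only [Instr.value]
      rw [g2 (32 + d) (by omega), v1]
      congr 1
      rw [← v2]; congr 1; omega
    · exact (g1.trans g2 (by omega)).trans (agreeBelow_update le_rfl (by omega)) le_rfl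
  | get j a iha =>
    intro d m hr ⟨ha, hd, hj, hW, h1, h2⟩
    obtain ⟨m1, x1, v1, g1⟩ := iha hr ha
    obtain ⟨m2, x2, v2, g2⟩ := exec_addr (G := G) (m := m1) hS hd hj hW (by rw [v1]; exact h1)
    refine ⟨_, .seq x1 (.seq x2 (exec_instr (t := 32 + d)
      (v := s.arr j (a.eval G s)) rfl ?_ (by omega) h2)),
      Function.update_self .., ?_⟩
    · simp only [Instr.value]
      rw [v2, v1, ((g1.trans g2 le_rfl).rep hr).arr j _ hj]
    · exact (g1.trans g2 (by omega)).trans (agreeBelow_update le_rfl (by omega)) le_rfl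
  | req a iha =>
    intro d m hr ⟨ha, hd, hW⟩
    obtain ⟨m1, x1, v1, g1⟩ := iha hr ha
    refine ⟨_, .seq x1 (exec_instr (t := 32 + d) (v := (Ex.req a).eval G s) rfl ?_ (by omega) ?_),
      Function.update_self .., g1.trans (agreeBelow_update le_rfl (by omega)) le_rfl⟩
    · simp only [Instr.value, v1, eval]
    · simp only [eval]
      split
      · exact (request_code_lt _).trans hW
      · omega

/-- Started in state `s` at time `k`, the program `p` halts in a state and at a time
that satisfy `Q`. -/
def WP (G : EventCycle n) (S W : ℕ) (p : Prog) (Q : ℕ → St → Prop) (k : ℕ) (s : St) : Prop :=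
  ∀ m, Represents m s → ∃ τ m' s', Exec G S W p m τ m' ∧ Represents m' s' ∧ Q (k + τ) s'

/-- Register assignment. -/
def asg (x : ℕ) (e : Ex) : Prog := .seq (e.code 0) (.instr (.copy x 32))

/-- Array assignment. -/
def put (j : ℕ) (a b : Ex) : Prog :=
  .seq (a.code 0) (.seq (Ex.addr j 0) (.seq (b.code 1) (.instr (.store 32 33))))

def block : List Prog → Prog
  | [] => .skip
  | p :: ps => .seq p (block ps)

variable {Q : ℕ → St → Prop} {k : ℕ} {s : St}

theorem WP.mono {p : Prog} {Q' : ℕ → St → Prop} (h : WP G S W p Q' k s)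
    (hQ : ∀ k' s', Q' k' s' → Q k' s') : WP G S W p Q k s := by
  intro m hm
  obtain ⟨τ, m', s', h1, h2, h3⟩ := h m hm
  exact ⟨τ, m', s', h1, h2, hQ _ _ h3⟩

theorem wp_skip (h : Q k s) : WP G S W .skip Q k s :=
  fun m hm => ⟨0, m, s, .skip m, hm, h⟩

theorem wp_seq {p q : Prog} (h : WP G S W p (WP G S W q Q) k s) : WP G S W (.seq p q) Q k s := by
  intro m hm
  obtain ⟨τ, m', s', h1, h2, h3⟩ := h m hm
  obtain ⟨τ', m'', s'', h4, h5, h6⟩ := h3 m' h2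
  exact ⟨_, m'', s'', .seq h1 h4, h5, by rwa [← add_assoc]⟩

theorem wp_block_nil (h : Q k s) : WP G S W (block []) Q k s := wp_skip h

theorem wp_block_cons {p : Prog} {ps : List Prog} (h : WP G S W p (WP G S W (block ps) Q) k s) :
    WP G S W (block (p :: ps)) Q k s := wp_seq h

theorem wp_asg (hS : 64 ≤ S) {x : ℕ} {e : Ex} (hx : x < 32) (v : ℕ) (hv : e.eval G s = v)
    (he : e.Ok G W s 0) (hev : v < W) (h : Q (k + (e.cost + 1)) (s.setReg x v)) :
    WP G S W (asg x e) Q k s := by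
  subst hv
  intro m hm
  obtain ⟨m1, x1, v1, g1⟩ := e.exec_code (S := S) hS hm he
  refine ⟨_, _, s.setReg x (e.eval G s), .seq x1 (exec_instr (t := x) rfl v1 (by omega) hev),
    ⟨?_, ?_⟩, h⟩
  · intro y hy
    have := (g1.rep hm).reg y hy
    simp only [St.setReg_reg, Function.update_apply]
    split <;> simp_all
  · intro j i hj
    rw [Function.update_of_ne (by omega), (g1.rep hm).arr j i hj]; rfl

theorem wp_put (hS : 64 ≤ S) {j : ℕ} {a b : Ex} (hj : j < 64) (i v : ℕ) (hi : a.eval G s = i)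
    (hv : b.eval G s = v) (ha : a.Ok G W s 0) (hb : b.Ok G W s 1) (hW : 128 < W)
    (haS : 64 * i + (64 + j) < S) (haW : 64 * i + (64 + j) < W) (hbW : v < W)
    (h : Q (k + (a.cost + b.cost + 5)) (s.setArr j i v)) :
    WP G S W (put j a b) Q k s := by
  subst hi hv
  intro m hm
  obtain ⟨m1, x1, v1, g1⟩ := a.exec_code (S := S) hS hm ha
  simp only [add_zero] at v1
  obtain ⟨m2, x2, v2, g2⟩ := Ex.exec_addr (G := G) (W := W) (S := S) (m := m1) (d := 0) (j := j) hS
    (by omega) hj hW (by simpa [v1] using haW)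
  have r2 := (g1.trans g2 le_rfl).rep hm
  obtain ⟨m3, x3, v3, g3⟩ := b.exec_code (S := S) hS r2 hb
  have e3 : m3 32 = 64 * a.eval G s + (64 + j) := by
    rw [g3 32 (by omega)]; simpa [v1] using v2
  refine ⟨_, _, s.setArr j (a.eval G s) (b.eval G s), .seq x1 (.seq x2 (.seq x3
    (exec_instr (t := 64 * a.eval G s + (64 + j)) e3 v3 haS hbW))), ⟨?_, ?_⟩, ?_⟩
  rotate_left 2
  · convert h using 2
    omega
  · intro y hy
    rw [Function.update_of_ne (by omega), (g3.rep r2).reg y hy]; rfl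
  · intro j' i' hj'
    have := (g3.rep r2).arr j' i' hj'
    simp only [St.setArr_arr, Function.update_apply]
    -- For j < 64 the address `64 * i + (64 + j)` determines i and j, so one store changes one array
    -- entry.
    by_cases h' : j' = j ∧ i' = a.eval G s
    · rw [if_pos (by rw [h'.1, h'.2]), if_pos h']
    · rw [if_neg (by omega), if_neg h', this]

/-- The cells that a test reads are registers. -/
def Test.OnRegs : Test → Prop
  | .eq a b => a < 32 ∧ b < 32
  | .ne a b => a < 32 ∧ b < 32
  | .le a b => a < 32 ∧ b < 32
  | .lt a b => a < 32 ∧ b < 32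
  | .itemLE a b => a < 32 ∧ b < 32

theorem Test.holds_iff {c : Test} (hc : c.OnRegs) {m : Mem} (hm : Represents m s) :
    c.Holds G m ↔ c.Holds G s.reg := by
  cases c <;> simp only [Test.Holds, hm.reg _ hc.1, hm.reg _ hc.2]

theorem wp_ite {c : Test} {p q : Prog} (hc : c.OnRegs)
    (hp : c.Holds G s.reg → WP G S W p Q (k + 1) s)
    (hq : ¬ c.Holds G s.reg → WP G S W q Q (k + 1) s) : WP G S W (.ite c p q) Q k s := by
  intro m hm
  by_cases h : c.Holds G s.reg
  · obtain ⟨τ, m', s', h1, h2, h3⟩ := hp h m hm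
    exact ⟨_, m', s', .ite_true ((Test.holds_iff hc hm).2 h) h1, h2, by rwa [← add_assoc]⟩
  · obtain ⟨τ, m', s', h1, h2, h3⟩ := hq h m hm
    exact ⟨_, m', s', .ite_false (mt (Test.holds_iff hc hm).1 h) h1, h2, by rwa [← add_assoc]⟩

theorem wp_loop_done {c : Test} {p : Prog} (hc : c.OnRegs) (h : ¬ c.Holds G s.reg)
    (hQ : Q (k + 1) s) : WP G S W (.loop c p) Q k s :=
  fun m hm => ⟨1, m, s, .loop_false (mt (Test.holds_iff hc hm).1 h), hm, hQ⟩

theorem wp_loop_step {c : Test} {p : Prog} (hc : c.OnRegs) (h : c.Holds G s.reg)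
    (hQ : WP G S W p (WP G S W (.loop c p) Q) (k + 1) s) : WP G S W (.loop c p) Q k s := by
  intro m hm
  obtain ⟨τ, m', s', h1, h2, h3⟩ := hQ m hm
  obtain ⟨τ', m'', s'', h4, h5, h6⟩ := h3 m' h2
  refine ⟨_, m'', s'', .loop_true ((Test.holds_iff hc hm).2 h) h1 h4, h5, ?_⟩
  convert h6 using 1
  omega

/-- A loop whose body is executed `N` times, at a cost of at most `B` each time. -/
theorem wp_loop_count {c : Test} {p : Prog} (hc : c.OnRegs) (I : ℕ → St → Prop) (B N : ℕ)
    (hbody : ∀ i < N, ∀ s k, I i s → c.Holds G s.reg ∧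
      WP G S W p (fun k' s' => k' ≤ k + B ∧ I (i + 1) s') k s)
    (hend : ∀ s, I N s → ¬ c.Holds G s.reg)
    (h0 : I 0 s) (hQ : ∀ k' s', k' ≤ k + N * (B + 1) + 1 → I N s' → Q k' s') :
    WP G S W (.loop c p) Q k s := by
  -- Induction on the number r of remaining rounds. The `+ 1` in `B + 1` pays for the test of a
  -- round, the final `+ 1` for the test that fails.
  suffices H : ∀ r i, i + r = N → ∀ s k₁, I i s → k₁ ≤ k + i * (B + 1) →
      WP G S W (.loop c p) Q k₁ s from H N 0 (by omega) s k h0 (by omega)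
  intro r
  induction r with
  | zero =>
    intro i hi s k₁ hs hk
    obtain rfl : i = N := by omega
    exact wp_loop_done hc (hend s hs) (hQ _ _ (by omega) hs)
  | succ r ih =>
    intro i hi s k₁ hs hk
    obtain ⟨h1, h2⟩ := hbody i (by omega) s (k₁ + 1) hs
    refine wp_loop_step hc h1 (h2.mono ?_)
    rintro k' s' ⟨h3, h4⟩
    refine ih (i + 1) (by omega) s' k' h4 ?_
    rw [add_mul]; omega

end

/-! ### Successors in sets of ranks -/

/-- The least number `r ≥ q` with `P r`, or `n` if there is none below `n`. -/
noncomputable def nxt (P : ℕ → Prop) (n q : ℕ) : ℕ := sInf {r | q ≤ r ∧ (P r ∨ n ≤ r)}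

section nxt
variable {P Q D : ℕ → Prop} {n q r : ℕ}

theorem nxt_mem (P : ℕ → Prop) (n q : ℕ) :
    q ≤ nxt P n q ∧ (P (nxt P n q) ∨ n ≤ nxt P n q) :=
  Nat.sInf_mem (s := {r | q ≤ r ∧ (P r ∨ n ≤ r)}) ⟨max q n, le_max_left .., .inr (le_max_right ..)⟩

theorem nxt_le (h : q ≤ r) (h' : P r ∨ n ≤ r) : nxt P n q ≤ r :=
  Nat.sInf_le (s := {r | q ≤ r ∧ (P r ∨ n ≤ r)}) ⟨h, h'⟩

theorem nxt_le_self (h : q ≤ n) : nxt P n q ≤ n := nxt_le h (.inr le_rfl)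

theorem nxt_eq (hq : q ≤ r) (hr : P r ∨ n ≤ r) (h : ∀ r', q ≤ r' → P r' ∨ n ≤ r' → r ≤ r') :
    nxt P n q = r :=
  le_antisymm (nxt_le hq hr) (h _ (nxt_mem P n q).1 (nxt_mem P n q).2)

theorem nxt_congr (h : ∀ r, q ≤ r → (P r ↔ Q r)) : nxt P n q = nxt Q n q :=
  nxt_eq (nxt_mem Q n q).1 ((nxt_mem Q n q).2.imp_left (h _ (nxt_mem Q n q).1).2)
    fun r' h1 h2 => nxt_le h1 (h2.imp_left (h r' h1).1)

theorem nxt_false (h : ∀ r, ¬ P r) (hq : q ≤ n) : nxt P n q = n :=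
  nxt_eq hq (.inr le_rfl) fun r' _ h2 => h2.resolve_left (h r')

/-- If beyond `q` the set `P` is the union of `Q` and of a set `D` that contains numbers `≥ q`
only, then the successor of `q` in `P` is the smaller one of the two successors. -/
theorem nxt_eq_min (hq : q ≤ n) (h : ∀ r, q ≤ r → (P r ↔ Q r ∨ D r)) (hD : ∀ r, D r → q ≤ r) :
    nxt P n q = min (nxt Q n q) (nxt D n 0) := by
  have hQ := nxt_mem Q n q
  have hD' := nxt_mem D n 0
  have hqD : q ≤ nxt D n 0 := hD'.2.elim (hD _) (hq.trans ·)
  refine nxt_eq (le_min hQ.1 hqD) ?_ fun r' h1 h2 => ?_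
  · rcases min_choice (nxt Q n q) (nxt D n 0) with e | e <;> rw [e]
    · exact hQ.2.imp_left fun h' => (h _ hQ.1).2 (.inl h')
    · exact hD'.2.imp_left fun h' => (h _ hqD).2 (.inr h')
  · rcases h2 with h2 | h2
    · rcases (h _ h1).1 h2 with h3 | h3
      · exact (min_le_left _ _).trans (nxt_le h1 (.inl h3))
      · exact (min_le_right _ _).trans (nxt_le (Nat.zero_le _) (.inl h3))
    · exact (min_le_left _ _).trans (nxt_le h1 (.inr h2))

end nxt

/-! ### Windows on the cycle -/

/-- Node `w` is at cyclic distance at most `2 R - 2` from node `c`. -/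
def InW (n R c w : ℕ) : Prop := (w + n - c + (2 * R - 2)) % n ≤ 2 * (2 * R - 2)

instance (n R c w : ℕ) : Decidable (InW n R c w) := inferInstanceAs (Decidable (_ ≤ _))

section window
variable {n R c w : ℕ}

/-- The machine adds 2R - 2 before reducing so as to avoid negative numbers. Undoing this shift
gives a signed displacement, for which the triangle inequality is available. -/
theorem inW_iff (hR : 1 ≤ R) (hc : c < n) :
    InW n R c w ↔ ∃ d : ℤ, |d| ≤ 2 * R - 2 ∧ (n : ℤ) ∣ w - (c + d) := by
  obtain ⟨X, hX, hX'⟩ : ∃ X : ℕ, w + n - c + (2 * R - 2) = X ∧ (X : ℤ) = w + n - c + (2 * R - 2) :=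
    ⟨_, rfl, by omega⟩
  rw [InW, hX]
  constructor
  · intro h
    refine ⟨(X % n : ℕ) - (2 * R - 2), by rw [abs_le]; omega, ((X / n : ℕ) : ℤ) - 1, ?_⟩
    have h1 := Nat.div_add_mod X n
    zify at h1
    push_cast
    linarith
  · rintro ⟨d, hd, e, he⟩
    rw [abs_le] at hd
    obtain ⟨f, hf⟩ : ∃ f : ℕ, (f : ℤ) = d + (2 * R - 2) := ⟨(d + (2 * R - 2)).toNat, by omega⟩
    have h3 : (X : ℤ) = f + n * (e + 1) := by rw [hX', hf]; linarith
    have h4 : X % n = f % n := by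
      zify
      rw [h3, Int.add_mul_emod_self_left]
    rw [h4]
    exact (Nat.mod_le _ _).trans (by omega)

/-- A remainder modulo n is at most n - 1 ≤ 2R - 2. This makes the window of the top level the whole
cycle, whatever its center is. -/
theorem inW_of_lt (hn : 0 < n) (h : n < 2 * R) : InW n R c w := by
  have := Nat.mod_lt (w + n - c + (2 * R - 2)) hn
  unfold InW; omega

/-- The window of radius `2 R - 2` around a node at distance less than `b R` from `c` is contained
in the window of radius `2 b R - 2` around `c`. -/
theorem InW.mono {b v : ℕ} (hb : 2 ≤ b) (hR : 1 ≤ R) (hc : c < n) (hv : v < n)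
    (h : ∃ d : ℤ, |d| < b * R ∧ (n : ℤ) ∣ v - (c + d)) (h' : InW n R v w) :
    InW n (b * R) c w := by
  rw [inW_iff hR hv] at h'
  rw [inW_iff (by nlinarith) hc]
  obtain ⟨d, hd, hdv⟩ := h
  obtain ⟨e, he, hew⟩ := h'
  refine ⟨d + e, ?_, by
    have := dvd_add hdv hew
    rwa [show (v : ℤ) - (c + d) + (w - (v + e)) = w - (c + (d + e)) by ring] at this⟩
  -- (bR - 1) + (2R - 2) ≤ 2bR - 2 because 2R ≤ bR.
  have := abs_add_le d e
  have h2 : (2 : ℤ) * R ≤ b * R := by exact_mod_cast Nat.mul_le_mul_right R hb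
  push_cast
  linarith [Int.add_one_le_iff.2 hd]

/-- R - 1 ≤ 2R - 2: as long as a level does not move, the walk stays in its window. -/
theorem inW_of_dist (hR : 1 ≤ R) (hc : c < n)
    (h : ∃ d : ℤ, |d| < R ∧ (n : ℤ) ∣ w - (c + d)) : InW n R c w := by
  rw [inW_iff hR hc]
  obtain ⟨d, hd, h⟩ := h
  exact ⟨d, by have : (1 : ℤ) ≤ R := by exact_mod_cast hR
               omega, h⟩

/-- The reason for the radius 2R - 2 instead of 2R: the bottom level is about the current node
alone. -/
theorem inW_one (hc : c < n) (hw : w < n) : InW n 1 c w ↔ w = c := by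
  rw [inW_iff le_rfl hc]
  constructor
  · rintro ⟨d, hd, h⟩
    obtain rfl : d = 0 := by simpa using hd
    have := Int.eq_zero_of_abs_lt_dvd h (by rw [abs_lt]; constructor <;> omega)
    omega
  · rintro rfl; exact ⟨0, by simp, by simp⟩

/-- The shifted residues of the members are distinct and take at most 4R - 3 values. So the list of
level R fits into the positions 4R, …, 8R - 1 and does not overlap with those of other levels. -/
theorem length_le_of_inW (hc : c < n) (hR : 1 ≤ R) {l : List ℕ} (hl : l.Nodup)
    (h : ∀ w ∈ l, w < n ∧ InW n R c w) : l.length < 4 * R := by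
  have h1 : l.length = l.toFinset.card := (List.toFinset_card_of_nodup hl).symm
  have h2 : l.toFinset.card ≤ (Finset.range (2 * (2 * R - 2) + 1)).card := by
    refine Finset.card_le_card_of_injOn (fun w => (w + n - c + (2 * R - 2)) % n) ?_ ?_
    · intro w hw
      have := (h w (by simpa using hw)).2
      simp only [InW] at this
      simp only [Finset.coe_range, Set.mem_Iio]
      omega
    · intro a ha b hb hab
      have ha := (h a (by simpa using ha)).1
      have hb := (h b (by simpa using hb)).1
      have h3 : (a + n - c + (2 * R - 2)) ≡ (b + n - c + (2 * R - 2)) [MOD n] := hab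
      have h4 : (a + n - c) ≡ (b + n - c) [MOD n] := Nat.ModEq.add_right_cancel' _ h3
      have h5 : a + n ≡ b + n [MOD n] := by
        have := h4.add_right c
        rwa [Nat.sub_add_cancel (by omega), Nat.sub_add_cancel (by omega)] at this
      exact Nat.ModEq.eq_of_lt_of_lt (Nat.ModEq.add_right_cancel' _ h5) ha hb
  rw [Finset.card_range] at h2
  omega

end window

/-! ### Rebuilding a level

Registers: `0` current node, `1` answer, `2` number `n`, `3` radius `R` of the current level,
`4`, `5` loop counters, `6` successor so far, `7` length of a list, `8` radius of the level to be
built, `9` the number `1`, `10` a node, `11` its rank, `12`–`15` temporary values.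

Arrays: `0` rank of a node, `1` node of a rank, `2` active ranks, `3` marks, `4` the lists of nodes
of the levels (that of the level with radius `R` from position `4 R` on), `5` the successors that
belong to them, `6` lengths of the lists, `7` centers of the levels. -/

/-- The node at the current position in the list of the current level. -/
def exNode : Ex := .get 4 (.op .add (.op .mul (.lit 4) (.var 3)) (.var 4))

/-- `x := x + 1` -/
def incr (x : ℕ) : Prog := asg x (.op .add (.var x) (.lit 1))

/-- Puts into register 13 the number which is at most `2 * (2 * R' - 2)` iff the node in
register 10 belongs to the window to be built. -/
def windowTest : Prog :=
  asg 13 (.op .mod (.op .add (.op .sub (.op .add (.var 10) (.var 2)) (.var 0))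
    (.op .sub (.op .mul (.lit 2) (.var 8)) (.lit 2))) (.var 2))

/-- Earlier rebuilds leave marks behind. Only marks at ranks of the current list will be read, so
only these are cleared, at a cost proportional to the list. -/
def unmarkAll : Prog :=
  .loop (.lt 4 7) (block [put 3 (.get 0 exNode) (.lit 0), incr 4])

/-- Marks are indexed by ranks, not by nodes: a node outside the new window counts as represented if
its item also occurs inside. -/
def markWindow : Prog :=
  .loop (.lt 4 7) (block [asg 10 exNode, windowTest,
    .ite (.le 13 14) (put 3 (.get 0 (.var 10)) (.lit 1)) .skip, incr 4])

def exOut : Ex := .op .add (.op .mul (.lit 4) (.var 8)) (.var 5)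

def emit : Prog :=
  block [put 4 exOut (.var 10),
    asg 15 (.get 5 (.op .add (.op .mul (.lit 4) (.var 3)) (.var 4))),
    .ite (.lt 6 15) (asg 15 (.var 6)) .skip,
    put 5 exOut (.var 15), incr 5]

/-- Register 12 is a truncated difference that equals 1 exactly for ranks that are active and
unmarked. Register 6, initially n, holds the last such rank, which is the smallest so far because
the list is decreasing. -/
def scan : Prog :=
  .loop (.lt 4 7) (block [asg 10 exNode, asg 11 (.get 0 (.var 10)),
    asg 12 (.op .sub (.get 2 (.var 11)) (.get 3 (.var 11))),
    .ite (.eq 12 9) (asg 6 (.var 11)) .skip,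
    windowTest, .ite (.le 13 14) emit .skip, incr 4])

def build : Prog :=
  block [asg 8 (.op .div (.var 3) (.lit 64)), asg 7 (.get 6 (.var 3)),
    asg 14 (.op .mul (.lit 2) (.op .sub (.op .mul (.lit 2) (.var 8)) (.lit 2))),
    asg 4 (.lit 0), unmarkAll, asg 4 (.lit 0), markWindow,
    asg 4 (.lit 0), asg 5 (.lit 0), asg 6 (.var 2), scan,
    put 6 (.var 8) (.var 5), put 7 (.var 8) (.var 0), asg 3 (.var 8)]

/-- The list `l` and the values of `F` on it are stored for the level with radius `R`. -/
def Stored (s : St) (R : ℕ) (l : List ℕ) (F : ℕ → ℕ) : Prop :=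
  ∀ i (h : i < l.length), s.arr 4 (4 * R + i) = l[i] ∧ s.arr 5 (4 * R + i) = F l[i]

/-- The rank `r` belongs to a node in the window around `c`. -/
def Represented (n : ℕ) (rk : ℕ → ℕ) (R c r : ℕ) : Prop := ∃ u < n, InW n R c u ∧ rk u = r

/-- The data of a level: the nodes of its window, sorted by decreasing rank, and for each of them
the successor of its rank among the active ranks that are not represented in the window. -/
def Level (s : St) (n : ℕ) (rk : ℕ → ℕ) (act : ℕ → Prop) (R c : ℕ) : Prop :=
  ∃ l : List ℕ, l.Pairwise (fun a b => rk b ≤ rk a) ∧ l.Nodup ∧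
    (∀ w, w ∈ l ↔ w < n ∧ InW n R c w) ∧ s.arr 6 R = l.length ∧
    Stored s R l fun w => nxt (fun r => act r ∧ ¬ Represented n rk R c r) n (rk w)

open Classical in
/-- The part of the memory that does not belong to a level: the ranks, nodes that represent them,
and the active ranks. -/
structure Base (s : St) (n : ℕ) (rk : ℕ → ℕ) (act : ℕ → Prop) : Prop where
  size : s.reg 2 = n
  one : s.reg 9 = 1
  rk_lt : ∀ w < n, rk w < n
  rank : ∀ w < n, s.arr 0 w = rk w
  node : ∀ w < n, s.arr 1 (rk w) < n ∧ rk (s.arr 1 (rk w)) = rk w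
  node_last : s.arr 1 n = n
  active : ∀ w < n, s.arr 2 (rk w) = if act (rk w) then 1 else 0

/-- The input of a scan through the list of the level with radius `R` in order to build that with
radius `R'`. -/
structure Source (s : St) (n : ℕ) (rk : ℕ → ℕ) (v R R' : ℕ) (l : List ℕ) : Prop where
  center : s.reg 0 = v
  size : s.reg 2 = n
  radius : s.reg 3 = R
  len : s.reg 7 = l.length
  radius' : s.reg 8 = R'
  bound : s.reg 14 = 2 * (2 * R' - 2)
  rk_lt : ∀ w < n, rk w < n
  rank : ∀ w < n, s.arr 0 w = rk w
  list : ∀ i (h : i < l.length), s.arr 4 (4 * R + i) = l[i]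
  lt : ∀ w ∈ l, w < n

/-- There is enough space for an instance of size `n`. -/
structure Room (n S W : ℕ) : Prop where
  pos : 0 < n
  space : 10000 * n ≤ S
  word : S ≤ W

/-! ### Correctness of clearing and setting the marks -/

section
variable {n : ℕ} {G : EventCycle n} {S W : ℕ} {Q : ℕ → St → Prop} {k : ℕ} {s : St}
  {rk : ℕ → ℕ} {v R R' : ℕ} {l : List ℕ}

theorem wp_incr (hS : 64 ≤ S) (hSW : S ≤ W) {x : ℕ} (hx : x < 32) (h : s.reg x + 1 < W)
    (hQ : Q (k + 4) (s.setReg x (s.reg x + 1))) : WP G S W (incr x) Q k s := by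
  refine wp_asg hS hx _ rfl ?_ h hQ
  simp only [Ex.Ok, Ex.eval, ArithOp.eval]
  omega

theorem Source.eval_node (h : Source s n rk v R R' l) {i : ℕ} (hi : i < l.length)
    (hs : s.reg 4 = i) : exNode.eval G s = l[i] := by
  simp only [exNode, Ex.eval, ArithOp.eval, h.radius, hs, h.list i hi]

theorem Source.length_le (h : Source s n rk v R R' l) (hl : l.Nodup) : l.length ≤ n := by
  rw [← List.toFinset_card_of_nodup hl]
  refine (Finset.card_le_card (t := Finset.range n) fun w hw => ?_).trans_eq (Finset.card_range n)
  simpa using h.lt w (by simpa using hw)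

/-- With R ≤ 32n and i < n the position 4R + i is below 129n, hence its address is below the 10000n
provided by `Room`. -/
theorem Source.ok_node (h : Source s n rk v R R' l) (hr : Room n S W) (hR : R ≤ 32 * n)
    (hl : l.Nodup) {i : ℕ} (hi : i < l.length) (hs : s.reg 4 = i) {d : ℕ} (hd : d < 20) :
    exNode.Ok G W s d := by
  have h1 := h.length_le hl
  have h2 := h.lt _ (List.getElem_mem hi)
  obtain ⟨r1, r2, r3⟩ := hr
  simp only [exNode, Ex.Ok, Ex.eval, ArithOp.eval, h.radius, hs, h.list i hi]
  omega

/-- Array 4 has to be unchanged from position 4R on only, since a scan writes the list of the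
smaller level while it reads the larger one. -/
theorem Source.congr (h : Source s n rk v R R' l) {s' : St}
    (hreg : ∀ x, x = 0 ∨ x = 2 ∨ x = 3 ∨ x = 7 ∨ x = 8 ∨ x = 14 → s'.reg x = s.reg x)
    (h0 : s'.arr 0 = s.arr 0)
    (h4 : ∀ i, 4 * R ≤ i → s'.arr 4 i = s.arr 4 i) : Source s' n rk v R R' l where
  center := by rw [hreg _ (by simp), h.center]
  size := by rw [hreg _ (by simp), h.size]
  radius := by rw [hreg _ (by simp), h.radius]
  len := by rw [hreg _ (by simp), h.len]
  radius' := by rw [hreg _ (by simp), h.radius']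
  bound := by rw [hreg _ (by simp), h.bound]
  rk_lt := h.rk_lt
  rank := by rw [h0]; exact h.rank
  list := fun i hi => by rw [h4 _ (by omega), h.list i hi]
  lt := h.lt

theorem wp_windowTest (hr : Room n S W) (h : Source s n rk v R R' l) (hv : v < n)
    (hR' : R' ≤ n) {w : ℕ} (hw : w < n) (hs : s.reg 10 = w)
    (hQ : Q (k + 14) (s.setReg 13 ((w + n - v + (2 * R' - 2)) % n))) :
    WP G S W windowTest Q k s := by
  obtain ⟨r1, r2, r3⟩ := hr
  have h1 := Nat.mod_lt (w + n - v + (2 * R' - 2)) r1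
  refine wp_asg (by omega) (by omega) _ ?_ ?_ ?_ hQ
  · simp only [Ex.eval, ArithOp.eval, h.center, h.size, h.radius', hs]
  · simp only [Ex.Ok, Ex.eval, ArithOp.eval, h.center, h.size, h.radius', hs]
    omega
  · omega

theorem wp_unmarkAll (hr : Room n S W) (h : Source s n rk v R R' l) (hl : l.Nodup)
    (hR : R ≤ 32 * n) (h4 : s.reg 4 = 0)
    (hQ : ∀ k' s', k' ≤ k + l.length * 30 + 1 → (∀ x, x ≠ 4 → s'.reg x = s.reg x) →
      (∀ j, j ≠ 3 → s'.arr j = s.arr j) → (∀ w ∈ l, s'.arr 3 (rk w) = 0) → Q k' s') :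
    WP G S W unmarkAll Q k s := by
  have hr' := hr
  obtain ⟨r1, r2, r3⟩ := hr'
  have hln := h.length_le hl
  refine wp_loop_count (c := .lt 4 7) (by simp [Test.OnRegs])
    (fun i s' => s'.reg 4 = i ∧ (∀ x, x ≠ 4 → s'.reg x = s.reg x) ∧
      (∀ j, j ≠ 3 → s'.arr j = s.arr j) ∧ ∀ i' (_ : i' < i) (h' : i' < l.length),
        s'.arr 3 (rk l[i']) = 0) 29 l.length ?_ ?_ ?_ ?_
  · rintro i hi s' k' ⟨e4, er, ea, em⟩
    have h' : Source s' n rk v R R' l := h.congr (fun x hx => er x (by omega))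
      (ea 0 (by omega)) fun i _ => by rw [ea 4 (by omega)]
    have hw := h.lt _ (List.getElem_mem hi)
    have hk := h.rk_lt _ hw
    refine ⟨by simp only [Test.Holds, e4, h'.len]; exact hi, ?_⟩
    refine wp_block_cons (wp_put (by omega) (by omega) (rk l[i]) 0 ?_ rfl ?_ ?_ (by omega)
      (by omega) (by omega) (by omega) ?_)
    · simp only [Ex.eval, h'.eval_node hi e4, h'.rank _ hw]
    · refine ⟨h'.ok_node hr hR hl hi e4 (by omega), ?_⟩
      simp only [h'.eval_node hi e4, h'.rank _ hw]
      omega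
    · simp only [Ex.Ok]; omega
    refine wp_block_cons (wp_incr (by omega) r3 (by omega) (by simp only [St.setArr_reg]; omega) ?_)
    refine wp_block_nil ⟨?_, ?_, ?_, ?_, ?_⟩
    · simp only [Ex.cost, exNode]; omega
    · simp [e4]
    · intro x hx; simp [hx, er x hx]
    · intro j hj; rw [St.setReg_arr, St.setArr_arr_of_ne _ hj, ea j hj]
    · intro i' hi' hl'
      simp only [St.setReg_arr, St.setArr_arr]
      split
      · rfl
      · rename_i hne
        rcases Nat.lt_succ_iff_lt_or_eq.1 hi' with h1 | h1
        · exact em i' h1 hl'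
        · subst h1; simp at hne
  · rintro s' ⟨e4, er, -⟩
    simp only [Test.Holds, e4, er 7 (by omega), h.len]; omega
  · exact ⟨h4, fun _ _ => rfl, fun _ _ => rfl, fun i' hi' => absurd hi' (by omega)⟩
  · rintro k' s' hk' ⟨-, er, ea, em⟩
    refine hQ k' s' hk' er ea fun w hw => ?_
    obtain ⟨i, hi, rfl⟩ := List.getElem_of_mem hw
    exact em i hi hi

open Classical in
theorem wp_markWindow (hr : Room n S W) (h : Source s n rk v R R' l) (hl : l.Nodup)
    (hR : R ≤ 32 * n) (hR' : R' ≤ n) (hv : v < n) (h4 : s.reg 4 = 0)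
    (h3 : ∀ w ∈ l, s.arr 3 (rk w) = 0)
    (hQ : ∀ k' s', k' ≤ k + l.length * 50 + 1 →
      (∀ x, x ≠ 4 → x ≠ 10 → x ≠ 13 → s'.reg x = s.reg x) →
      (∀ j, j ≠ 3 → s'.arr j = s.arr j) →
      (∀ w ∈ l, s'.arr 3 (rk w) = if ∃ u ∈ l, InW n R' v u ∧ rk u = rk w then 1 else 0) →
      Q k' s') :
    WP G S W markWindow Q k s := by
  have hr' := hr
  obtain ⟨r1, r2, r3⟩ := hr'
  have hln := h.length_le hl
  refine wp_loop_count (c := .lt 4 7) (by simp [Test.OnRegs])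
    (fun i s' => s'.reg 4 = i ∧ (∀ x, x ≠ 4 → x ≠ 10 → x ≠ 13 → s'.reg x = s.reg x) ∧
      (∀ j, j ≠ 3 → s'.arr j = s.arr j) ∧ ∀ w ∈ l, s'.arr 3 (rk w) =
        if ∃ u ∈ l.take i, InW n R' v u ∧ rk u = rk w then 1 else 0) 49 l.length ?_ ?_ ?_ ?_
  · rintro i hi s' k' ⟨e4, er, ea, em⟩
    have h' : Source s' n rk v R R' l := h.congr
      (fun x hx => er x (by omega) (by omega) (by omega))
      (ea 0 (by omega)) fun i _ => by rw [ea 4 (by omega)]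
    have hw := h.lt _ (List.getElem_mem hi)
    have hk := h.rk_lt _ hw
    refine ⟨by simp only [Test.Holds, e4, h'.len]; exact hi, ?_⟩
    refine wp_block_cons (wp_asg (by omega) (by omega) l[i] (h'.eval_node hi e4)
      (h'.ok_node hr hR hl hi e4 (by omega)) (by omega) ?_)
    set s1 := s'.setReg 10 l[i] with hs1
    have h1 : Source s1 n rk v R R' l := h'.congr
      (fun x hx => by rw [hs1, St.setReg_reg, if_neg (by omega)]) rfl fun _ _ => rfl
    refine wp_block_cons (wp_windowTest hr h1 hv hR' hw (by simp [hs1]) ?_)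
    set s2 := s1.setReg 13 ((l[i] + n - v + (2 * R' - 2)) % n) with hs2
    have take_succ : l.take (i + 1) = l.take i ++ [l[i]] := by simp
    have e24 : s2.reg 4 = i := by simp [hs2, hs1, e4]
    have er2 : ∀ x, x ≠ 4 → x ≠ 10 → x ≠ 13 → s2.reg x = s.reg x := fun x a b c => by
      simp [hs2, hs1, b, c, er x a b c]
    have htest : (Test.le 13 14).Holds G s2.reg ↔ InW n R' v l[i] := by
      simp only [Test.Holds]
      rw [er2 14 (by omega) (by omega) (by omega), h.bound, hs2, St.setReg_reg, if_pos rfl, InW]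
    have hrk : s2.arr 0 l[i] = rk l[i] := h'.rank _ hw
    have h210 : s2.reg 10 = l[i] := by simp [hs2, hs1]
    refine wp_block_cons (wp_ite (by simp [Test.OnRegs]) (fun hc => ?_) (fun hc => ?_))
    · rw [htest] at hc
      refine wp_put (by omega) (by omega) (rk l[i]) 1 ?_ rfl ?_ ?_ (by omega)
        (by omega) (by omega) (by omega) ?_
      · simp only [Ex.eval, h210, hrk]
      · simp only [Ex.Ok, Ex.eval, h210, hrk]; omega
      · simp only [Ex.Ok]; omega
      refine wp_block_cons (wp_incr (by omega) r3 (by omega)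
        (by simp only [St.setArr_reg, e24]; omega) ?_)
      refine wp_block_nil ⟨?_, ?_, ?_, ?_, ?_⟩
      · simp only [Ex.cost, exNode]; omega
      · simp [e24]
      · intro x a b c; simp [a, er2 x a b c]
      · intro j hj
        rw [St.setReg_arr, St.setArr_arr_of_ne _ hj, hs2, hs1, St.setReg_arr, St.setReg_arr, ea j hj]
      · intro w hwl
        simp only [St.setReg_arr, St.setArr_arr, true_and]
        split
        · rename_i heq
          rw [if_pos]
          exact ⟨l[i], by rw [take_succ]; exact List.mem_append_right _ (List.mem_singleton_self _), hc,
            heq.symm⟩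
        · rename_i hne
          rw [hs2, hs1, St.setReg_arr, St.setReg_arr, em w hwl]
          congr 1
          simp only [take_succ, List.mem_append, List.mem_singleton, eq_iff_iff]
          constructor
          · rintro ⟨u, a, b⟩; exact ⟨u, .inl a, b⟩
          · rintro ⟨u, a | rfl, b, c⟩
            · exact ⟨u, a, b, c⟩
            · exact absurd c.symm hne
    · rw [htest] at hc
      refine wp_skip (wp_block_cons (wp_incr (by omega) r3 (by omega)
        (by simp only [e24]; omega) ?_))
      refine wp_block_nil ⟨?_, ?_, ?_, ?_, ?_⟩
      · simp only [Ex.cost, exNode]; omega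
      · simp [e24]
      · intro x a b c; simp [a, er2 x a b c]
      · exact ea
      · intro w hwl
        rw [hs2, hs1, St.setReg_arr, St.setReg_arr, St.setReg_arr, em w hwl]
        congr 1
        simp only [take_succ, List.mem_append, List.mem_singleton, eq_iff_iff]
        constructor
        · rintro ⟨u, a, b⟩; exact ⟨u, .inl a, b⟩
        · rintro ⟨u, a | rfl, b, c⟩
          · exact ⟨u, a, b, c⟩
          · exact absurd b hc
  · rintro s' ⟨e4, er, -⟩
    simp only [Test.Holds, e4, er 7 (by omega) (by omega) (by omega), h.len]; omega
  · exact ⟨h4, fun _ _ _ _ => rfl, fun _ _ => rfl, fun w hw => by simp [h3 w hw]⟩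
  · rintro k' s' hk' ⟨-, er, ea, em⟩
    exact hQ k' s' hk' er ea (by simpa using em)

end

/-! ### Correctness of the scan -/

section
variable {n : ℕ} {G : EventCycle n} {S W : ℕ} {Q : ℕ → St → Prop} {k : ℕ} {s : St}
  {rk : ℕ → ℕ} {v R R' : ℕ} {l : List ℕ} {act M : ℕ → Prop}

/-- The ranks of the first `i` nodes in `l` that are active and not marked. -/
def Seen (rk : ℕ → ℕ) (act M : ℕ → Prop) (l : List ℕ) (i r : ℕ) : Prop :=
  (act r ∧ ¬ M r) ∧ ∃ u ∈ l.take i, rk u = r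

theorem mem_take_succ {i u : ℕ} (hi : i < l.length) :
    u ∈ l.take (i + 1) ↔ u ∈ l.take i ∨ u = l[i] := by
  rw [List.take_succ_eq_append_getElem hi, List.mem_append, List.mem_singleton]

theorem rk_le_of_mem_take (hl : l.Pairwise fun a b => rk b ≤ rk a) {i u : ℕ} (hi : i < l.length)
    (hu : u ∈ l.take (i + 1)) : rk l[i] ≤ rk u := by
  rw [mem_take_succ hi] at hu
  rcases hu with hu | rfl
  · obtain ⟨j, hj, rfl⟩ := List.getElem_of_mem hu
    simp only [List.length_take] at hj
    rw [List.getElem_take]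
    exact List.pairwise_iff_getElem.1 hl j i (by omega) hi (by omega)
  · rfl

/-- In a list with decreasing ranks the newest candidate is the smallest one, so it replaces the old
one without a comparison. -/
theorem nxt_seen_of_pos (hl : l.Pairwise fun a b => rk b ≤ rk a) {i : ℕ} (hi : i < l.length)
    (hn : rk l[i] ≤ n) (h : act (rk l[i]) ∧ ¬ M (rk l[i])) :
    nxt (Seen rk act M l (i + 1)) n 0 = rk l[i] := by
  refine nxt_eq (Nat.zero_le _) (.inl ⟨h, l[i], (mem_take_succ hi).2 (.inr rfl), rfl⟩) ?_
  rintro r' - (⟨-, u, hu, rfl⟩ | h')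
  · exact rk_le_of_mem_take hl hi hu
  · omega

theorem nxt_seen_of_neg {i : ℕ} (hi : i < l.length)
    (h : ¬ (act (rk l[i]) ∧ ¬ M (rk l[i]))) :
    nxt (Seen rk act M l (i + 1)) n 0 = nxt (Seen rk act M l i) n 0 := by
  refine nxt_congr fun r _ => ?_
  simp only [Seen, mem_take_succ hi]
  constructor
  · rintro ⟨h1, u, hu | rfl, rfl⟩
    · exact ⟨h1, u, hu, rfl⟩
    · exact absurd h1 h
  · rintro ⟨h1, u, hu, rfl⟩; exact ⟨h1, u, .inl hu, rfl⟩

/-- The successor to be stored for a node of the smaller window is the minimum of that stored for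
it in the larger window and the smallest number that the scan has seen so far. -/
theorem nxt_not_represented {c : ℕ} (hl : l.Pairwise fun a b => rk b ≤ rk a)
    (hmem : ∀ w, w ∈ l ↔ w < n ∧ InW n R c w)
    (hsub : ∀ w < n, InW n R' v w → InW n R c w) {i : ℕ} (hi : i < l.length)
    (hn : rk l[i] ≤ n) (hw : InW n R' v l[i]) :
    nxt (fun r => act r ∧ ¬ Represented n rk R' v r) n (rk l[i]) =
      min (nxt (fun r => act r ∧ ¬ Represented n rk R c r) n (rk l[i]))
        (nxt (Seen rk act (fun r => ∃ u ∈ l, InW n R' v u ∧ rk u = r) l (i + 1)) n 0) := by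
  refine nxt_eq_min hn (fun r hr => ?_) ?_
  · constructor
    · rintro ⟨h1, h2⟩
      -- An active rank missing in the small window is either missing in the large window too, and
      -- then accounted for by the old entry, or carried by some node `l[j]` of the large one.
      by_cases h3 : Represented n rk R c r
      · right
        obtain ⟨u, h4, h5, rfl⟩ := h3
        refine ⟨⟨h1, ?_⟩, u, ?_, rfl⟩
        · rintro ⟨u', h6, h7, h8⟩
          exact h2 ⟨u', ((hmem _).1 h6).1, h7, h8⟩
        · obtain ⟨j, hj, rfl⟩ := List.getElem_of_mem ((hmem u).2 ⟨h4, h5⟩)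
          by_cases hji : j < i
          · rw [mem_take_succ hi]
            left
            rw [List.mem_take_iff_getElem]
            exact ⟨j, by omega, rfl⟩
          -- For j ≥ i the order gives `rk l[j] ≤ rk l[i]`, hence equality by `hr`. But then `l[i]`,
          -- a node of the small window, represents this rank.
          · exfalso
            have h9 : rk l[j] ≤ rk l[i] := by
              rcases eq_or_lt_of_le (not_lt.1 hji) with h | h
              · subst h; rfl
              · exact List.pairwise_iff_getElem.1 hl i j hi hj h
            exact h2 ⟨l[i], ((hmem _).1 (List.getElem_mem hi)).1, hw, by omega⟩
      · exact .inl ⟨h1, h3⟩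
    · rintro (⟨h1, h2⟩ | ⟨⟨h1, h2⟩, -⟩)
      · refine ⟨h1, ?_⟩
        rintro ⟨u, h3, h4, h5⟩
        exact h2 ⟨u, h3, hsub u h3 h4, h5⟩
      · refine ⟨h1, ?_⟩
        rintro ⟨u, h3, h4, h5⟩
        exact h2 ⟨u, (hmem u).2 ⟨h3, hsub u h3 h4⟩, h4, h5⟩
  · rintro r ⟨-, u, hu, rfl⟩
    exact rk_le_of_mem_take hl hi hu

/-- What an execution of `emit` does. -/
theorem wp_emit (hr : Room n S W) (h : Source s n rk v R R' l) (hl : l.Nodup) (hR : R ≤ 32 * n)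
    (hR' : 1 ≤ R') (hRR : 8 * R' ≤ 4 * R) {i j f : ℕ} (hi : i < l.length) (h4 : s.reg 4 = i)
    (h5 : s.reg 5 = j) (hj : j < 4 * R') (h10 : s.reg 10 = l[i])
    (hf : s.arr 5 (4 * R + i) = f) (hfn : f ≤ n)
    (hQ : ∀ s', (∀ x, x ≠ 5 → x ≠ 15 → s'.reg x = s.reg x) → s'.reg 5 = j + 1 →
      (∀ x, x ≠ 4 → x ≠ 5 → s'.arr x = s.arr x) →
      (∀ x, x ≠ 4 * R' + j → s'.arr 4 x = s.arr 4 x ∧ s'.arr 5 x = s.arr 5 x) →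
      s'.arr 4 (4 * R' + j) = l[i] → s'.arr 5 (4 * R' + j) = min f (s.reg 6) →
      ∀ k', k' ≤ k + 60 → Q k' s') :
    WP G S W emit Q k s := by
  have hr' := hr
  obtain ⟨r1, r2, r3⟩ := hr'
  have hln := h.length_le hl
  have hw := h.lt _ (List.getElem_mem hi)
  refine wp_block_cons (wp_put (by omega) (by omega) (4 * R' + j) l[i] ?_ ?_ ?_ ?_ (by omega)
    (by omega) (by omega) (by omega) ?_)
  · simp only [exOut, Ex.eval, ArithOp.eval, h.radius', h5]
  · simp only [Ex.eval, h10]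
  · simp only [exOut, Ex.Ok, Ex.eval, ArithOp.eval, h.radius', h5]; omega
  · simp only [Ex.Ok, h10]; omega
  set s1 := s.setArr 4 (4 * R' + j) l[i] with hs1
  have r1' : s1.reg = s.reg := rfl
  have a5 : s1.arr 5 = s.arr 5 := St.setArr_arr_of_ne _ (by omega)
  refine wp_block_cons (wp_asg (by omega) (by omega) f ?_ ?_ (by omega) ?_)
  · simp only [Ex.eval, ArithOp.eval, a5, r1', h.radius, h4, hf]
  · simp only [Ex.Ok, Ex.eval, ArithOp.eval, a5, r1', h.radius, h4, hf]; omega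
  set s2 := s1.setReg 15 f with hs2
  -- Both branches of the comparison leave the minimum in register 15.
  suffices H : ∀ s3 k', s3 = s1.setReg 15 (min f (s.reg 6)) → k' ≤ k + 40 →
      WP G S W (block [put 5 exOut (.var 15), incr 5]) Q k' s3 by
    refine wp_block_cons (wp_ite (by simp [Test.OnRegs]) (fun hc => ?_) (fun hc => ?_))
    · simp only [Test.Holds, hs2, hs1] at hc
      simp at hc
      refine wp_asg (by omega) (by omega) (s.reg 6) ?_ ?_ (by omega) (H _ _ ?_ ?_)
      · simp [Ex.eval, hs2, hs1]
      · simp only [Ex.Ok, hs2, hs1, St.setReg_reg, St.setArr_reg]; simp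
        omega
      · rw [hs2, min_eq_right hc.le]
        simp [St.setReg]
      · simp only [Ex.cost, exOut]; omega
    · simp only [Test.Holds, hs2, hs1] at hc
      simp at hc
      refine wp_skip (H _ _ ?_ ?_)
      · rw [hs2, min_eq_left hc]
      · simp only [Ex.cost, exOut]; omega
  rintro s3 k' hs3 hk'
  have er3 : ∀ x, x ≠ 15 → s3.reg x = s.reg x := fun x hx => by simp [hs3, hs1, hx]
  have hmin : min f (s.reg 6) ≤ n := (min_le_left _ _).trans hfn
  refine wp_block_cons (wp_put (by omega) (by omega) (4 * R' + j) (min f (s.reg 6)) ?_ ?_ ?_ ?_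
    (by omega) (by omega) (by omega) (by omega) ?_)
  · simp only [exOut, Ex.eval, ArithOp.eval, er3 8 (by omega), er3 5 (by omega), h.radius', h5]
  · simp [Ex.eval, hs3]
  · simp only [exOut, Ex.Ok, Ex.eval, ArithOp.eval, er3 8 (by omega), er3 5 (by omega),
      h.radius', h5]
    omega
  · simp only [Ex.Ok, hs3, St.setReg_reg, if_pos]; omega
  refine wp_block_cons (wp_incr (by omega) r3 (by omega)
    (by simp only [St.setArr_reg, er3 5 (by omega), h5]; omega) ?_)
  refine wp_block_nil (hQ _ ?_ ?_ ?_ ?_ ?_ ?_ _ ?_)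
  · intro x hx hx'; simp [hx, er3 x hx']
  · simp [er3 5 (by omega), h5]
  · intro x hx hx'
    rw [St.setReg_arr, St.setArr_arr_of_ne _ hx', hs3, St.setReg_arr, hs1, St.setArr_arr_of_ne _ hx]
  · intro x hx; simp [hx, hs3, hs1]
  · simp [hs3, hs1]
  · simp
  · simp only [Ex.cost, exOut]; omega

theorem Stored.congr {F : ℕ → ℕ} {s' : St} (h : Stored s R l F)
    (h' : ∀ x, 4 * R ≤ x → x < 4 * R + l.length → s'.arr 4 x = s.arr 4 x ∧ s'.arr 5 x = s.arr 5 x) :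
    Stored s' R l F := by
  intro i hi
  rw [(h' _ (by omega) (by omega)).1, (h' _ (by omega) (by omega)).2]
  exact h i hi

theorem Stored.snoc {F : ℕ → ℕ} (h : Stored s R l F) {w : ℕ}
    (h4 : s.arr 4 (4 * R + l.length) = w) (h5 : s.arr 5 (4 * R + l.length) = F w) :
    Stored s R (l ++ [w]) F := by
  intro i hi
  rcases Nat.lt_or_ge i l.length with h1 | h1
  · rw [List.getElem_append_left h1]; exact h i h1
  · have h2 : i = l.length := by simp at hi; omega
    subst h2
    simp [h4, h5]

open Classical in
-- After i nodes, register 6 is the least rank in `Seen`, and the output is the filtered prefix of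
-- length i with its correct entries. Writing does not disturb reading: the output stays below
-- position 8R' ≤ 4R.
theorem wp_scan {c : ℕ} (hr : Room n S W) (h : Source s n rk v R R' l) (hl : l.Nodup)
    (hs : l.Pairwise fun a b => rk b ≤ rk a) (hmem : ∀ w, w ∈ l ↔ w < n ∧ InW n R c w)
    (hsub : ∀ w < n, InW n R' v w → InW n R c w)
    (hR : R ≤ 32 * n) (hR' : R' ≤ n) (hR1 : 1 ≤ R') (hRR : 8 * R' ≤ 4 * R) (hv : v < n)
    (h4 : s.reg 4 = 0) (h5 : s.reg 5 = 0) (h6 : s.reg 6 = n) (h9 : s.reg 9 = 1)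
    (h2 : ∀ w < n, s.arr 2 (rk w) = if act (rk w) then 1 else 0)
    (h3 : ∀ w ∈ l, s.arr 3 (rk w) = if ∃ u ∈ l, InW n R' v u ∧ rk u = rk w then 1 else 0)
    (hF : Stored s R l fun w => nxt (fun r => act r ∧ ¬ Represented n rk R c r) n (rk w))
    (hQ : ∀ k' s', k' ≤ k + l.length * 201 + 1 →
      (∀ x, x = 0 ∨ x = 1 ∨ x = 2 ∨ x = 3 ∨ x = 7 ∨ x = 8 ∨ x = 9 → s'.reg x = s.reg x) →
      s'.reg 5 = (l.filter fun w => InW n R' v w).length →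
      (∀ j, j ≠ 4 → j ≠ 5 → s'.arr j = s.arr j) →
      (∀ x, 8 * R' ≤ x → s'.arr 4 x = s.arr 4 x ∧ s'.arr 5 x = s.arr 5 x) →
      Stored s' R' (l.filter fun w => InW n R' v w)
        (fun w => nxt (fun r => act r ∧ ¬ Represented n rk R' v r) n (rk w)) →
      Q k' s') :
    WP G S W scan Q k s := by
  have hr' := hr
  obtain ⟨r1, r2, r3⟩ := hr'
  have hln := h.length_le hl
  set M : ℕ → Prop := fun r => ∃ u ∈ l, InW n R' v u ∧ rk u = r with hM
  set F' : ℕ → ℕ := fun w => nxt (fun r => act r ∧ ¬ Represented n rk R' v r) n (rk w) with hF'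
  refine wp_loop_count (c := .lt 4 7) (by simp [Test.OnRegs])
    (fun i s' => s'.reg 4 = i ∧
      (∀ x, x ≠ 4 → x ≠ 5 → x ≠ 6 → x ≠ 10 → x ≠ 11 → x ≠ 12 → x ≠ 13 → x ≠ 15 →
        s'.reg x = s.reg x) ∧
      s'.reg 5 = ((l.take i).filter fun w => InW n R' v w).length ∧
      s'.reg 6 = nxt (Seen rk act M l i) n 0 ∧
      (∀ j, j ≠ 4 → j ≠ 5 → s'.arr j = s.arr j) ∧
      (∀ x, 8 * R' ≤ x → s'.arr 4 x = s.arr 4 x ∧ s'.arr 5 x = s.arr 5 x) ∧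
      Stored s' R' ((l.take i).filter fun w => InW n R' v w) F') 200 l.length ?_ ?_ ?_ ?_
  · rintro i hi s' k' ⟨e4, er, e5, e6, ea, eb, eS⟩
    have h' : Source s' n rk v R R' l := h.congr
      (fun x hx => er x (by omega) (by omega) (by omega) (by omega) (by omega) (by omega) (by omega)
        (by omega))
      (ea 0 (by omega) (by omega)) fun i hi => (eb i (by omega)).1
    have hw := h.lt _ (List.getElem_mem hi)
    have hk := h.rk_lt _ hw
    refine ⟨by simp only [Test.Holds, e4, h'.len]; exact hi, ?_⟩
    refine wp_block_cons (wp_asg (by omega) (by omega) l[i] (h'.eval_node hi e4)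
      (h'.ok_node hr hR hl hi e4 (by omega)) (by omega) ?_)
    refine wp_block_cons (wp_asg (by omega) (by omega) (rk l[i]) ?_ ?_ (by omega) ?_)
    · simp [Ex.eval, h'.rank _ hw]
    · simp [Ex.Ok, Ex.eval, h'.rank _ hw]; omega
    set s2 := (s'.setReg 10 l[i]).setReg 11 (rk l[i]) with hs2
    have a2 : s2.arr 2 (rk l[i]) = if act (rk l[i]) then 1 else 0 := by
      rw [hs2, St.setReg_arr, St.setReg_arr, ea 2 (by omega) (by omega), h2 _ hw]
    have a3 : s2.arr 3 (rk l[i]) = if M (rk l[i]) then 1 else 0 := by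
      rw [hs2, St.setReg_arr, St.setReg_arr, ea 3 (by omega) (by omega),
        h3 _ (List.getElem_mem hi)]
    have a11 : s2.reg 11 = rk l[i] := by simp [hs2]
    refine wp_block_cons (wp_asg (by omega) (by omega)
      (if act (rk l[i]) ∧ ¬ M (rk l[i]) then 1 else 0) ?_ ?_ ?_ ?_)
    · simp only [Ex.eval, ArithOp.eval, a11, a2, a3]
      by_cases h1 : act (rk l[i]) <;> by_cases h2 : M (rk l[i]) <;> simp [h1, h2]
    · simp only [Ex.Ok, Ex.eval, ArithOp.eval, a11, a2, a3]
      by_cases h1 : act (rk l[i]) <;> by_cases h2 : M (rk l[i]) <;> simp [h1, h2] <;> omega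
    · split <;> omega
    set s3 := s2.setReg 12 (if act (rk l[i]) ∧ ¬ M (rk l[i]) then 1 else 0) with hs3
    have hcur : nxt (Seen rk act M l (i + 1)) n 0 ≤ n := nxt_le_self (Nat.zero_le _)
    have er3 : ∀ x, x ≠ 10 → x ≠ 11 → x ≠ 12 → s3.reg x = s'.reg x := fun x a b c => by
      simp [hs3, hs2, a, b, c]
    have h39 : s3.reg 9 = 1 := by
      rw [er3 9 (by omega) (by omega) (by omega), er 9 (by omega) (by omega) (by omega) (by omega)
        (by omega) (by omega) (by omega) (by omega), h9]
    have h312 : s3.reg 12 = if act (rk l[i]) ∧ ¬ M (rk l[i]) then 1 else 0 := by simp [hs3]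
    -- Register 6 is brought up to date for `l[i]` before `l[i]` is emitted; the rest of the round
    -- is the same for both branches.
    suffices H : ∀ s4 k'', k'' ≤ k' + 60 →
        (∀ x, x ≠ 6 → s4.reg x = s3.reg x) → s4.arr = s'.arr →
        s4.reg 6 = nxt (Seen rk act M l (i + 1)) n 0 →
        WP G S W (block [windowTest, .ite (.le 13 14) emit .skip, incr 4])
          (fun k'' s' => k'' ≤ k' + 200 ∧ s'.reg 4 = i + 1 ∧
      (∀ x, x ≠ 4 → x ≠ 5 → x ≠ 6 → x ≠ 10 → x ≠ 11 → x ≠ 12 → x ≠ 13 → x ≠ 15 →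
        s'.reg x = s.reg x) ∧
      s'.reg 5 = ((l.take (i + 1)).filter fun w => InW n R' v w).length ∧
      s'.reg 6 = nxt (Seen rk act M l (i + 1)) n 0 ∧
      (∀ j, j ≠ 4 → j ≠ 5 → s'.arr j = s.arr j) ∧
      (∀ x, 8 * R' ≤ x → s'.arr 4 x = s.arr 4 x ∧ s'.arr 5 x = s.arr 5 x) ∧
      Stored s' R' ((l.take (i + 1)).filter fun w => InW n R' v w) F') k'' s4 by
      refine wp_block_cons (wp_ite (by simp [Test.OnRegs]) (fun hc => ?_) (fun hc => ?_))
      · have hc' : act (rk l[i]) ∧ ¬ M (rk l[i]) := by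
          by_contra hcon
          simp [Test.Holds, h39, h312, if_neg hcon] at hc
        have a311 : s3.reg 11 = rk l[i] := by rw [hs3, St.setReg_reg, if_neg (by omega), a11]
        refine wp_asg (by omega) (by omega) (rk l[i]) a311 ?_ (by omega)
          (H _ _ ?_ (fun x hx => by simp [hx]) rfl ?_)
        · simp only [Ex.Ok, a311]; omega
        · simp only [Ex.cost, exNode]; omega
        · rw [nxt_seen_of_pos hs hi hk.le hc']; simp
      · have hc' : ¬ (act (rk l[i]) ∧ ¬ M (rk l[i])) := by
          intro hcon
          apply hc
          simp only [Test.Holds, h39, h312, if_pos hcon]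
        refine wp_skip (H _ _ ?_ (fun _ _ => rfl) rfl ?_)
        · simp only [Ex.cost, exNode]; omega
        · rw [nxt_seen_of_neg hi hc', er3 6 (by omega) (by omega) (by omega), e6]
    intro s4 k'' hk'' er4 ea4 e46
    have er4' : ∀ x, x ≠ 6 → x ≠ 10 → x ≠ 11 → x ≠ 12 → s4.reg x = s'.reg x :=
      fun x a b c d => by rw [er4 x a, er3 x b c d]
    have h4' : Source s4 n rk v R R' l := h'.congr
      (fun x hx => er4' x (by omega) (by omega) (by omega) (by omega)) (by rw [ea4])
      fun _ _ => by rw [ea4]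
    have e410 : s4.reg 10 = l[i] := by rw [er4 10 (by omega)]; simp [hs3, hs2]
    refine wp_block_cons (wp_windowTest hr h4' hv hR' hw e410 ?_)
    set s5 := s4.setReg 13 ((l[i] + n - v + (2 * R' - 2)) % n) with hs5
    have er5 : ∀ x, x ≠ 13 → s5.reg x = s4.reg x := fun x a => by simp [hs5, a]
    have h5' : Source s5 n rk v R R' l := h4'.congr
      (fun x hx => er5 x (by omega)) rfl fun _ _ => rfl
    have ea5 : s5.arr = s'.arr := ea4
    have htest : (Test.le 13 14).Holds G s5.reg ↔ InW n R' v l[i] := by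
      simp only [Test.Holds]
      rw [er5 14 (by omega), h4'.bound, hs5, St.setReg_reg, if_pos rfl, InW]
    have e54 : s5.reg 4 = i := by
      rw [er5 4 (by omega), er4' 4 (by omega) (by omega) (by omega) (by omega), e4]
    have e55 : s5.reg 5 = ((l.take i).filter fun w => InW n R' v w).length := by
      rw [er5 5 (by omega), er4' 5 (by omega) (by omega) (by omega) (by omega), e5]
    have take_succ : l.take (i + 1) = l.take i ++ [l[i]] := by simp
    have hlen : ∀ j, ((l.take j).filter fun w => InW n R' v w).length < 4 * R' := fun j =>
      length_le_of_inW hv hR1 ((hl.sublist (List.take_sublist _ _)).filter _) fun w hw => by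
        simp only [List.mem_filter, decide_eq_true_eq] at hw
        exact ⟨h.lt w (List.mem_of_mem_take hw.1), hw.2⟩
    refine wp_block_cons (wp_ite (by simp [Test.OnRegs]) (fun hc => ?_) (fun hc => ?_))
    · rw [htest] at hc
      have e56 : s5.reg 6 = nxt (Seen rk act M l (i + 1)) n 0 := by rw [er5 6 (by omega), e46]
      have hf : s5.arr 5 (4 * R + i) =
          nxt (fun r => act r ∧ ¬ Represented n rk R c r) n (rk l[i]) := by
        rw [ea5, (eb _ (by omega)).2, (hF i hi).2]
      refine wp_emit hr h5' hl hR hR1 hRR hi e54 e55 (hlen i)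
        (by rw [er5 10 (by omega), e410]) hf (nxt_le_self hk.le) ?_
      intro s6 er6 e65 ea6 eb6 e64 e65' k3 hk3
      refine wp_block_cons (wp_incr (by omega) r3 (by omega)
        (by rw [er6 4 (by omega) (by omega), e54]; omega) (wp_block_nil ⟨by omega, ?_⟩))
      have er6' : ∀ x, x ≠ 4 → x ≠ 5 → x ≠ 6 → x ≠ 10 → x ≠ 11 → x ≠ 12 → x ≠ 13 → x ≠ 15 →
          s6.reg x = s.reg x := fun x a b c d e f g y => by
        rw [er6 x b y, er5 x g, er4' x c d e f, er x a b c d e f g y]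
      have filter_succ : (l.take (i + 1)).filter (fun w => InW n R' v w) =
          (l.take i).filter (fun w => InW n R' v w) ++ [l[i]] := by
        rw [take_succ, List.filter_append]; simp [hc]
      refine ⟨?_, ?_, ?_, ?_, ?_, ?_, ?_⟩
      · simp [er6 4 (by omega) (by omega), e54]
      · intro x a b c d e f g y; simp [a, er6' x a b c d e f g y]
      · rw [filter_succ]; simp [e65]
      · simp [er6 6 (by omega) (by omega), e56]
      · intro j a b; rw [St.setReg_arr, ea6 j a b, ea5, ea j a b]
      · intro x hx
        have := hlen i
        rw [St.setReg_arr, (eb6 x (by omega)).1, (eb6 x (by omega)).2, ea5]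
        exact eb x hx
      · rw [filter_succ]
        refine Stored.snoc (Stored.congr eS fun x _ hx => ?_) e64 ?_
        · rw [St.setReg_arr, (eb6 x (by omega)).1, (eb6 x (by omega)).2, ea5]
          exact ⟨rfl, rfl⟩
        · rw [St.setReg_arr, e65', e56, hF']
          exact (nxt_not_represented hs hmem hsub hi hk.le hc).symm
    · rw [htest] at hc
      refine wp_skip (wp_block_cons (wp_incr (by omega) r3 (by omega)
        (by rw [e54]; omega) (wp_block_nil ⟨by omega, ?_⟩)))
      have filter_succ : (l.take (i + 1)).filter (fun w => InW n R' v w) =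
          (l.take i).filter (fun w => InW n R' v w) := by
        rw [take_succ, List.filter_append]; simp [hc]
      rw [filter_succ]
      refine ⟨?_, ?_, ?_, ?_, ?_, ?_, ?_⟩
      · simp [e54]
      · intro x a b c d e f g y
        rw [St.setReg_reg, if_neg a, er5 x g, er4' x c d e f, er x a b c d e f g y]
      · simp [e55]
      · rw [St.setReg_reg, if_neg (by omega), er5 6 (by omega), e46]
      · intro j a b; rw [St.setReg_arr, ea5, ea j a b]
      · intro x hx; rw [St.setReg_arr, ea5]; exact eb x hx
      · exact eS.congr fun x _ _ => by rw [St.setReg_arr, ea5]; exact ⟨rfl, rfl⟩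
  · rintro s' ⟨e4, er, -⟩
    simp only [Test.Holds, e4, er 7 (by omega) (by omega) (by omega) (by omega) (by omega)
      (by omega) (by omega) (by omega), h.len]
    omega
  · refine ⟨h4, fun x _ _ _ _ _ _ _ _ => rfl, by simp [h5], ?_, fun _ _ _ => rfl,
      fun _ _ => ⟨rfl, rfl⟩, fun i hi => by simp at hi⟩
    rw [h6, nxt_false _ (Nat.zero_le _)]
    rintro r ⟨-, u, hu, -⟩
    simp at hu
  · rintro k' s' hk' ⟨e4, er, e5, e6, ea, eb, eS⟩
    rw [List.take_length] at e5 eS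
    exact hQ k' s' (by omega) (fun x hx => er x (by omega) (by omega) (by omega) (by omega) (by omega)
      (by omega) (by omega) (by omega)) e5 ea eb eS

end

/-! ### Rebuilding all levels below a given one -/

/-- Only the levels with radius below `R` have changed. -/
structure Frame (s s' : St) (R : ℕ) : Prop where
  reg : ∀ x, x = 0 ∨ x = 1 ∨ x = 2 ∨ x = 9 → s'.reg x = s.reg x
  arr : ∀ j, j < 3 → s'.arr j = s.arr j
  lists : ∀ x, 4 * R ≤ x → s'.arr 4 x = s.arr 4 x ∧ s'.arr 5 x = s.arr 5 x
  dirs : ∀ x, R ≤ x → s'.arr 6 x = s.arr 6 x ∧ s'.arr 7 x = s.arr 7 x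

section
variable {n : ℕ} {G : EventCycle n} {S W : ℕ} {Q : ℕ → St → Prop} {k : ℕ} {s s' s'' : St}
  {rk : ℕ → ℕ} {v c R R' : ℕ} {l : List ℕ} {act act' : ℕ → Prop}

theorem Frame.refl (s : St) (R : ℕ) : Frame s s R :=
  ⟨fun _ _ => rfl, fun _ _ => rfl, fun _ _ => ⟨rfl, rfl⟩, fun _ _ => ⟨rfl, rfl⟩⟩

theorem Frame.trans (h : Frame s s' R) (h' : Frame s' s'' R') (hR : R' ≤ R) : Frame s s'' R where
  reg x hx := (h'.reg x hx).trans (h.reg x hx)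
  arr j hj := (h'.arr j hj).trans (h.arr j hj)
  lists x hx := ⟨(h'.lists x (by omega)).1.trans (h.lists x hx).1,
    (h'.lists x (by omega)).2.trans (h.lists x hx).2⟩
  dirs x hx := ⟨(h'.dirs x (by omega)).1.trans (h.dirs x hx).1,
    (h'.dirs x (by omega)).2.trans (h.dirs x hx).2⟩

theorem Frame.base (h : Frame s s' R) (hb : Base s n rk act) : Base s' n rk act where
  size := by rw [h.reg 2 (by omega), hb.size]
  one := by rw [h.reg 9 (by omega), hb.one]
  rk_lt := hb.rk_lt
  rank := by rw [h.arr 0 (by omega)]; exact hb.rank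
  node := by rw [h.arr 1 (by omega)]; exact hb.node
  node_last := by rw [h.arr 1 (by omega)]; exact hb.node_last
  active := by rw [h.arr 2 (by omega)]; exact hb.active

theorem Frame.level (h : Frame s s' R) (hR : R ≤ R') (hl : Level s n rk act R' c) :
    Level s' n rk act R' c := by
  obtain ⟨l, h1, h2, h3, h4, h5⟩ := hl
  exact ⟨l, h1, h2, h3, by rw [(h.dirs R' hR).1, h4],
    h5.congr fun x hx _ => h.lists x (by omega)⟩

/-- The point of the data structure: the stored successors ignore all ranks represented in the
window, so a request at a node of the window cannot invalidate them. -/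
theorem Level.congr_act (hl : Level s n rk act R c) (hv : v < n) (hw : InW n R c v)
    (h : ∀ r, r ≠ rk v → (act r ↔ act' r)) : Level s n rk act' R c := by
  obtain ⟨l, h1, h2, h3, h4, h5⟩ := hl
  refine ⟨l, h1, h2, h3, h4, fun i hi => ⟨(h5 i hi).1, (h5 i hi).2.trans (nxt_congr fun r _ => ?_)⟩⟩
  by_cases hr : r = rk v
  · have : Represented n rk R c r := ⟨v, hv, hw, hr.symm⟩
    simp [this]
  · rw [h r hr]

/-- Needed for the top level, whose window does not depend on its center. -/
theorem Level.congr_center {c' : ℕ} (hl : Level s n rk act R c)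
    (h : ∀ w, InW n R c w ↔ InW n R c' w) : Level s n rk act R c' := by
  obtain ⟨l, h1, h2, h3, h4, h5⟩ := hl
  refine ⟨l, h1, h2, fun w => by rw [h3, h], h4, ?_⟩
  simpa only [Represented, h] using h5

/-- The larger list has fewer than 4 * 64R' = 256R' nodes, and the three loops take 30 + 50 + 201
steps per node. Together with the straight-line code this stays below 73000R'. -/
theorem wp_build (hr : Room n S W) (hb : Base s n rk act) (h0 : s.reg 0 = v) (hv : v < n)
    (h3 : s.reg 3 = 64 * R') (hR1 : 1 ≤ R') (hR : 64 * R' ≤ 32 * n) (hc : c < n)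
    (hL : Level s n rk act (64 * R') c) (hsub : ∀ w < n, InW n R' v w → InW n (64 * R') c w)
    (hQ : ∀ k' s', k' ≤ k + 73000 * R' → Frame s s' (64 * R') → s'.reg 3 = R' →
      s'.arr 7 R' = v → Level s' n rk act R' v → Q k' s') :
    WP G S W build Q k s := by
  have hr' := hr
  obtain ⟨r1, r2, r3⟩ := hr'
  obtain ⟨l, hs, hl, hmem, hlen, hF⟩ := hL
  have hl4 : l.length < 4 * (64 * R') := length_le_of_inW hc (by omega) hl fun w => (hmem w).1
  have hln : l.length ≤ n := by
    rw [← List.toFinset_card_of_nodup hl]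
    refine (Finset.card_le_card (t := Finset.range n) fun w hw => ?_).trans_eq
      (Finset.card_range n)
    simpa using ((hmem w).1 (by simpa using hw)).1
  refine wp_block_cons (wp_asg (by omega) (by omega) R' ?_ ?_ (by omega) ?_)
  · simp only [Ex.eval, ArithOp.eval, h3]; omega
  · simp only [Ex.Ok, Ex.eval, ArithOp.eval, h3]; omega
  refine wp_block_cons (wp_asg (by omega) (by omega) l.length ?_ ?_ (by omega) ?_)
  · simp [Ex.eval, h3, hlen]
  · simp [Ex.Ok, Ex.eval, h3, hlen]; omega
  refine wp_block_cons (wp_asg (by omega) (by omega) (2 * (2 * R' - 2)) ?_ ?_ (by omega) ?_)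
  · simp [Ex.eval, ArithOp.eval]
  · simp [Ex.Ok, Ex.eval, ArithOp.eval]; omega
  refine wp_block_cons (wp_asg (by omega) (by omega) 0 rfl ?_ (by omega) ?_)
  · simp only [Ex.Ok]; omega
  set s1 := (((s.setReg 8 R').setReg 7 l.length).setReg 14 (2 * (2 * R' - 2))).setReg 4 0 with hs1
  have er1 : ∀ x, x = 0 ∨ x = 1 ∨ x = 2 ∨ x = 3 ∨ x = 9 → s1.reg x = s.reg x := by
    rintro x (rfl | rfl | rfl | rfl | rfl) <;> simp [hs1]
  have hS : Source s1 n rk v (64 * R') R' l :=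
    { center := by rw [er1 0 (by omega), h0]
      size := by rw [er1 2 (by omega), hb.size]
      radius := by rw [er1 3 (by omega), h3]
      len := by simp [hs1]
      radius' := by simp [hs1]
      bound := by simp [hs1]
      rk_lt := hb.rk_lt
      rank := hb.rank
      list := fun i hi => (hF i hi).1
      lt := fun w hw => ((hmem w).1 hw).1 }
  refine wp_block_cons (wp_unmarkAll hr hS hl hR (by simp [hs1]) ?_)
  intro k2 s2 hk2 er2 ea2 em2
  refine wp_block_cons (wp_asg (by omega) (by omega) 0 rfl ?_ (by omega) ?_)
  · simp only [Ex.Ok]; omega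
  have hS2 : Source (s2.setReg 4 0) n rk v (64 * R') R' l := hS.congr
    (fun x hx => by rw [St.setReg_reg, if_neg (by omega), er2 x (by omega)])
    (by rw [St.setReg_arr, ea2 0 (by omega)]) fun i _ => by rw [St.setReg_arr, ea2 4 (by omega)]
  refine wp_block_cons (wp_markWindow hr hS2 hl hR (by omega) hv (by simp) em2 ?_)
  intro k3 s3 hk3 er3 ea3 em3
  have er3' : ∀ x, x ≠ 4 → x ≠ 10 → x ≠ 13 → s3.reg x = s1.reg x := fun x a b c => by
    rw [er3 x a b c, St.setReg_reg, if_neg a, er2 x a]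
  have ea3' : ∀ j, j ≠ 3 → s3.arr j = s.arr j := fun j hj => by
    rw [ea3 j hj, St.setReg_arr, ea2 j hj]; rfl
  refine wp_block_cons (wp_asg (by omega) (by omega) 0 rfl ?_ (by omega) ?_)
  · simp only [Ex.Ok]; omega
  refine wp_block_cons (wp_asg (by omega) (by omega) 0 rfl ?_ (by omega) ?_)
  · simp only [Ex.Ok]; omega
  have h32 : s3.reg 2 = n := by
    rw [er3' 2 (by omega) (by omega) (by omega), er1 2 (by omega), hb.size]
  refine wp_block_cons (wp_asg (by omega) (by omega) n ?_ ?_ (by omega) ?_)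
  · simp [Ex.eval, h32]
  · simp [Ex.Ok, h32]; omega
  set s4 := ((s3.setReg 4 0).setReg 5 0).setReg 6 n with hs4
  have er4 : ∀ x, x ≠ 4 → x ≠ 5 → x ≠ 6 → x ≠ 10 → x ≠ 13 → s4.reg x = s1.reg x :=
    fun x a b c d e => by simp [hs4, a, b, c, er3' x a d e]
  have ea4 : ∀ j, j ≠ 3 → s4.arr j = s.arr j := ea3'
  have hS4 : Source s4 n rk v (64 * R') R' l := hS.congr
    (fun x hx => er4 x (by omega) (by omega) (by omega) (by omega) (by omega))
    (by rw [ea4 0 (by omega)]; rfl) fun i _ => by rw [ea4 4 (by omega)]; rfl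
  refine wp_block_cons (wp_scan (c := c) (act := act) hr hS4 hl hs hmem hsub hR (by omega) hR1
    (by omega) hv (by simp [hs4]) (by simp [hs4]) (by simp [hs4]) ?_ ?_ em3 ?_ ?_)
  · rw [er4 9 (by omega) (by omega) (by omega) (by omega) (by omega), er1 9 (by omega), hb.one]
  · rw [ea4 2 (by omega)]; exact hb.active
  · exact hF.congr fun x _ _ => by rw [ea4 4 (by omega), ea4 5 (by omega)]; exact ⟨rfl, rfl⟩
  intro k5 s5 hk5 er5 e55 ea5 eb5 eS5
  have hlen' : (l.filter fun w => InW n R' v w).length ≤ n :=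
    (List.length_filter_le _ _).trans hln
  have e58 : s5.reg 8 = R' := by rw [er5 8 (by omega)]; exact hS4.radius'
  have e50 : s5.reg 0 = v := by rw [er5 0 (by omega)]; exact hS4.center
  refine wp_block_cons (wp_put (by omega) (by omega) R' (l.filter fun w => InW n R' v w).length ?_ e55 ?_ ?_
    (by omega) (by omega) (by omega) (by omega) ?_)
  · simp only [Ex.eval, e58]
  · simp only [Ex.Ok, e58]; omega
  · simp only [Ex.Ok, e55]; omega
  refine wp_block_cons (wp_put (by omega) (by omega) R' v ?_ ?_ ?_ ?_
    (by omega) (by omega) (by omega) (by omega) ?_)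
  · simp [Ex.eval, e58]
  · simp [Ex.eval, e50]
  · simp [Ex.Ok, e58]; omega
  · simp [Ex.Ok, e50]; omega
  refine wp_block_cons (wp_asg (by omega) (by omega) R' ?_ ?_ (by omega) (wp_block_nil ?_))
  · simp [Ex.eval, e58]
  · simp [Ex.Ok, e58]; omega
  set s6 := ((s5.setArr 6 R' _).setArr 7 R' v).setReg 3 R' with hs6
  have ea6 : ∀ j, j ≠ 6 → j ≠ 7 → s6.arr j = s5.arr j := fun j a b => by
    rw [hs6, St.setReg_arr, St.setArr_arr_of_ne _ b, St.setArr_arr_of_ne _ a]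
  refine hQ _ s6 ?_ ⟨?_, ?_, ?_, ?_⟩ ?_ ?_ ?_
  · simp only [Ex.cost] at *; omega
  · intro x hx
    rw [hs6, St.setReg_reg, if_neg (by omega), St.setArr_reg, St.setArr_reg, er5 x (by omega),
      er4 x (by omega) (by omega) (by omega) (by omega) (by omega), er1 x (by omega)]
  · intro j hj
    rw [ea6 j (by omega) (by omega), ea5 j (by omega) (by omega), ea4 j (by omega)]
  · intro x hx
    rw [ea6 4 (by omega) (by omega), ea6 5 (by omega) (by omega), (eb5 x (by omega)).1,
      (eb5 x (by omega)).2, ea4 4 (by omega), ea4 5 (by omega)]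
    exact ⟨rfl, rfl⟩
  · intro x hx
    have hx' : x ≠ R' := by omega
    simp [hs6, hx', ea5, ea4]
  · simp [hs6]
  · simp [hs6]
  · refine ⟨_, hs.filter _, hl.filter _, fun w => ?_, ?_, eS5.congr fun x _ _ => ?_⟩
    · simp only [List.mem_filter, hmem, decide_eq_true_eq]
      exact ⟨fun h => ⟨h.1.1, h.2⟩, fun h => ⟨⟨h.1, hsub w h.1 h.2⟩, h.2⟩⟩
    · simp [hs6]
    · rw [ea6 4 (by omega) (by omega), ea6 5 (by omega) (by omega)]
      exact ⟨rfl, rfl⟩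

def descend : Prog := .loop (.lt 9 3) build

/-- The costs are geometric: 73000R' for the first rebuild and 2000R' for all further ones are less
than 2000 * 64R'. The inclusion of windows is assumed for the first rebuild only; after it, source
and target are both centered at v. -/
theorem wp_descend (hr : Room n S W) (hv : v < n) (K : ℕ) :
    ∀ (c k : ℕ) (s : St) (Q : ℕ → St → Prop), Base s n rk act → s.reg 0 = v →
    s.reg 3 = 64 ^ K → 64 ^ K ≤ 32 * n → c < n → Level s n rk act (64 ^ K) c →
    (∀ j, j + 1 = K → ∀ w < n, InW n (64 ^ j) v w → InW n (64 ^ K) c w) →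
    (∀ k' s', k' ≤ k + 2000 * 64 ^ K → Frame s s' (64 ^ K) →
      (∀ j < K, Level s' n rk act (64 ^ j) v ∧ s'.arr 7 (64 ^ j) = v) → Q k' s') →
    WP G S W descend Q k s := by
  induction K with
  | zero =>
    intro c k s Q hb h0 h3 hK hc hL hsub hQ
    refine wp_loop_done (by simp [Test.OnRegs]) (by simp [Test.Holds, h3, hb.one]) ?_
    exact hQ _ _ (by simp) (Frame.refl _ _) (by simp)
  | succ K ih =>
    intro c k s Q hb h0 h3 hK hc hL hsub hQ
    have hpos : 1 ≤ 64 ^ K := Nat.one_le_pow _ _ (by omega)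
    have hpow : 64 ^ (K + 1) = 64 * 64 ^ K := by ring
    rw [hpow] at h3 hK hL hsub
    refine wp_loop_step (by simp [Test.OnRegs]) (by simp only [Test.Holds, h3, hb.one]; omega)
      (wp_build hr hb h0 hv h3 hpos hK hc hL (hsub K rfl) ?_)
    intro k' s' hk' hF e3 e7 hL'
    refine ih v k' s' Q (hF.base hb) ((hF.reg 0 (by omega)).trans h0) e3 (by omega) hv hL' ?_ ?_
    · rintro j rfl w hw h
      rw [pow_succ, mul_comm]
      exact InW.mono (by omega) (Nat.one_le_pow _ _ (by omega)) hv hv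
        ⟨0, by positivity, by simp⟩ h
    · intro k'' s'' hk'' hF' hj
      refine hQ k'' s'' (by omega) ?_ fun j hjK => ?_
      · rw [hpow]; exact hF.trans hF' (by omega)
      · rcases Nat.lt_succ_iff_lt_or_eq.1 hjK with h | rfl
        · exact hj j h
        · exact ⟨hF'.level le_rfl hL', by rw [(hF'.dirs _ le_rfl).2, e7]⟩

/-! ### Finding the levels that have to be rebuilt -/

def enlarge : Prog := block [asg 3 (.op .mul (.lit 64) (.var 3)), asg 8 (.lit 1)]

/-- Register 8 is a flag, set again if the level under inspection has moved. Comparing 2R with n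
comes before the access to the center, since no center is stored for the top level. -/
def climb : Prog :=
  block [asg 3 (.lit 1), asg 8 (.lit 1),
    .loop (.eq 8 9) (block [asg 8 (.lit 0), asg 10 (.op .mul (.lit 2) (.var 3)),
      .ite (.le 10 2)
        (block [asg 12 (.op .mod (.op .sub (.op .add (.var 0) (.var 2)) (.get 7 (.var 3))) (.var 2)),
          asg 13 (.op .add (.var 12) (.var 3)),
          .ite (.eq 12 3) enlarge (.ite (.eq 13 2) enlarge .skip)])
        .skip])]

/-- Node `v` is at cyclic distance `R` from node `c`. -/
def AtDist (n R c v : ℕ) : Prop := (v + n - c) % n = R ∨ (v + n - c) % n + R = n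

theorem wp_climb (hr : Room n S W) (h0 : s.reg 0 = v) (h2 : s.reg 2 = n) (h9 : s.reg 9 = 1)
    (hv : v < n) {K : ℕ} (hK : ∀ j < K, 2 * 64 ^ j ≤ n ∧ AtDist n (64 ^ j) (s.arr 7 (64 ^ j)) v)
    (hK' : ¬ (2 * 64 ^ K ≤ n ∧ AtDist n (64 ^ K) (s.arr 7 (64 ^ K)) v))
    (h7 : ∀ j, 2 * 64 ^ j ≤ n → s.arr 7 (64 ^ j) < n)
    (hQ : ∀ k' s', k' ≤ k + 100 * (K + 1) → Frame s s' 0 → s'.reg 3 = 64 ^ K → Q k' s') :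
    WP G S W climb Q k s := by
  have hr' := hr
  obtain ⟨r1, r2, r3⟩ := hr'
  have hpow : ∀ j ≤ K, 1 ≤ 64 ^ j ∧ 64 ^ j ≤ 32 * n := by
    intro j hj
    refine ⟨Nat.one_le_pow _ _ (by omega), ?_⟩
    rcases j with _ | j
    · simp; omega
    · have := (hK j (by omega)).1
      rw [pow_succ]; omega
  refine wp_block_cons (wp_asg (by omega) (by omega) 1 rfl ?_ (by omega) ?_)
  · simp only [Ex.Ok]; omega
  refine wp_block_cons (wp_asg (by omega) (by omega) 1 rfl ?_ (by omega) ?_)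
  · simp only [Ex.Ok]; omega
  -- K rounds enlarge the radius and one more leaves the flag at 0, whence `K + 1` rounds and the
  -- exponent `min i K`.
  refine wp_block_cons (wp_loop_count (c := .eq 8 9) (by simp [Test.OnRegs])
    (fun i s' => s'.reg 3 = 64 ^ (min i K) ∧ s'.reg 8 = (if i ≤ K then 1 else 0) ∧
      (∀ x, x = 0 ∨ x = 1 ∨ x = 2 ∨ x = 9 → s'.reg x = s.reg x) ∧ s'.arr = s.arr) 60 (K + 1)
      ?_ ?_ ?_ ?_)
  · rintro i hi s' k' ⟨e3, e8, er, ea⟩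
    rw [min_eq_left (by omega)] at e3
    rw [if_pos (by omega)] at e8
    have e0 : s'.reg 0 = v := by rw [er 0 (by omega), h0]
    have e2 : s'.reg 2 = n := by rw [er 2 (by omega), h2]
    have e9 : s'.reg 9 = 1 := by rw [er 9 (by omega), h9]
    obtain ⟨p1, p2⟩ := hpow i (by omega)
    generalize hR : 64 ^ i = R at e3 p1 p2
    have hKi : i < K → 2 * R ≤ n ∧ AtDist n R (s.arr 7 R) v := by rw [← hR]; exact hK i
    have hKi' : ¬ i < K → ¬ (2 * R ≤ n ∧ AtDist n R (s.arr 7 R) v) := by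
      intro h; obtain rfl : i = K := by omega
      rwa [← hR]
    have h7i : 2 * R ≤ n → s.arr 7 R < n := by rw [← hR]; exact h7 i
    refine ⟨by simp only [Test.Holds, e8, e9], ?_⟩
    refine wp_block_cons (wp_asg (by omega) (by omega) 0 rfl ?_ (by omega) ?_)
    · simp only [Ex.Ok]; omega
    refine wp_block_cons (wp_asg (by omega) (by omega) (2 * R) ?_ ?_ (by omega) ?_)
    · simp [Ex.eval, ArithOp.eval, e3]
    · simp [Ex.Ok, Ex.eval, ArithOp.eval, e3]; omega
    set s1 := (s'.setReg 8 0).setReg 10 (2 * R) with hs1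
    have halt : ∀ s2 k2, k2 ≤ k' + 50 → ¬ i < K → s2.reg 3 = R → s2.reg 8 = 0 →
        (∀ x, x = 0 ∨ x = 1 ∨ x = 2 ∨ x = 9 → s2.reg x = s'.reg x) → s2.arr = s'.arr →
        WP G S W .skip (WP G S W (block []) fun k'' s'' => k'' ≤ k' + 60 ∧
        s''.reg 3 = 64 ^ (min (i + 1) K) ∧ s''.reg 8 = (if i + 1 ≤ K then 1 else 0) ∧
        (∀ x, x = 0 ∨ x = 1 ∨ x = 2 ∨ x = 9 → s''.reg x = s.reg x) ∧ s''.arr = s.arr) k2 s2 := by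
      intro s2 k2 hk2 hiK a3 a8 ar aa
      refine wp_skip (wp_block_nil ⟨by omega, ?_, ?_, ?_, by rw [aa, ea]⟩)
      · rw [min_eq_right (by omega), a3, ← hR]; congr 1; omega
      · rw [if_neg (by omega), a8]
      · intro x hx; rw [ar x hx, er x hx]
    have go : ∀ s2 k2, k2 ≤ k' + 50 → i < K → s2.reg 3 = R →
        (∀ x, x = 0 ∨ x = 1 ∨ x = 2 ∨ x = 9 → s2.reg x = s'.reg x) → s2.arr = s'.arr →
        WP G S W enlarge (WP G S W (block []) fun k'' s'' => k'' ≤ k' + 60 ∧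
        s''.reg 3 = 64 ^ (min (i + 1) K) ∧ s''.reg 8 = (if i + 1 ≤ K then 1 else 0) ∧
        (∀ x, x = 0 ∨ x = 1 ∨ x = 2 ∨ x = 9 → s''.reg x = s.reg x) ∧ s''.arr = s.arr) k2 s2 := by
      intro s2 k2 hk2 hiK a3 ar aa
      refine wp_block_cons (wp_asg (by omega) (by omega) (64 * R) ?_ ?_ (by omega) ?_)
      · simp [Ex.eval, ArithOp.eval, a3]
      · simp [Ex.Ok, Ex.eval, ArithOp.eval, a3]; omega
      refine wp_block_cons (wp_asg (by omega) (by omega) 1 rfl ?_ (by omega) ?_)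
      · simp only [Ex.Ok]; omega
      refine wp_block_nil (wp_block_nil ⟨?_, ?_, ?_, ?_, by simpa using aa.trans ea⟩)
      · simp only [Ex.cost]; omega
      · rw [min_eq_left (by omega), pow_succ, hR]; simp [mul_comm]
      · rw [if_pos (by omega)]; simp
      · intro x hx
        rw [St.setReg_reg, if_neg (by omega), St.setReg_reg, if_neg (by omega), ar x hx, er x hx]
    have er1 : ∀ x, x ≠ 8 → x ≠ 10 → s1.reg x = s'.reg x := fun x a b => by simp [hs1, a, b]
    refine wp_block_cons (wp_ite (by simp [Test.OnRegs]) (fun hc => ?_) (fun hc => ?_))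
    · have hRn : 2 * R ≤ n := by
        simpa [Test.Holds, hs1, e2] using hc
      have hcn := h7i hRn
      have hmod := Nat.mod_lt (v + n - s.arr 7 R) r1
      refine wp_block_cons (wp_asg (by omega) (by omega) ((v + n - s.arr 7 R) % n) ?_ ?_
        (by omega) ?_)
      · simp [Ex.eval, ArithOp.eval, hs1, e3, e0, e2, ea]
      · simp [Ex.Ok, Ex.eval, ArithOp.eval, hs1, e3, e0, e2, ea]; omega
      refine wp_block_cons (wp_asg (by omega) (by omega) ((v + n - s.arr 7 R) % n + R) ?_ ?_
        (by omega) ?_)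
      · simp [Ex.eval, ArithOp.eval, hs1, e3]
      · simp [Ex.Ok, Ex.eval, ArithOp.eval, hs1, e3]; omega
      set s2 := (s1.setReg 12 ((v + n - s.arr 7 R) % n)).setReg 13 ((v + n - s.arr 7 R) % n + R)
        with hs2
      have er2 : ∀ x, x ≠ 8 → x ≠ 10 → x ≠ 12 → x ≠ 13 → s2.reg x = s'.reg x :=
        fun x a b c d => by simp [hs2, c, d, er1 x a b]
      have a3 : s2.reg 3 = R := by rw [er2 3 (by omega) (by omega) (by omega) (by omega), e3]
      have a2 : s2.reg 2 = n := by rw [er2 2 (by omega) (by omega) (by omega) (by omega), e2]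
      have a12 : s2.reg 12 = (v + n - s.arr 7 R) % n := by simp [hs2]
      have a13 : s2.reg 13 = (v + n - s.arr 7 R) % n + R := by simp [hs2]
      have ar2 : ∀ x, x = 0 ∨ x = 1 ∨ x = 2 ∨ x = 9 → s2.reg x = s'.reg x := fun x hx =>
        er2 x (by omega) (by omega) (by omega) (by omega)
      have hiff : AtDist n R (s.arr 7 R) v → i < K := fun h => by
        by_contra hcon; exact hKi' hcon ⟨hRn, h⟩
      refine wp_block_cons (wp_ite (by simp [Test.OnRegs]) (fun hd => ?_) fun hd =>
        wp_ite (by simp [Test.OnRegs]) (fun hd' => ?_) fun hd' => ?_)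
      · simp only [Test.Holds, a12, a3] at hd
        exact (go s2 _ (by simp only [Ex.cost]; omega) (hiff (.inl hd)) a3 ar2 rfl).mono
          fun _ _ h => wp_block_nil h
      · simp only [Test.Holds, a13, a2] at hd'
        exact (go s2 _ (by simp only [Ex.cost]; omega) (hiff (.inr hd')) a3 ar2 rfl).mono
          fun _ _ h => wp_block_nil h
      · simp only [Test.Holds, a12, a3] at hd
        simp only [Test.Holds, a13, a2] at hd'
        refine (halt s2 _ (by simp only [Ex.cost]; omega) (fun h => ?_) a3 (by simp [hs2, hs1]) ar2
          rfl).mono fun _ _ h => wp_block_nil h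
        rcases (hKi h).2 with h | h
        · exact hd h
        · exact hd' h
    · have hRn : ¬ 2 * R ≤ n := by
        simpa [Test.Holds, hs1, e2] using hc
      exact halt s1 _ (by simp only [Ex.cost]; omega) (fun h => hRn (hKi h).1)
        (by rw [er1 3 (by omega) (by omega), e3]) (by simp [hs1])
        (fun x hx => er1 x (by omega) (by omega)) rfl
  · rintro s' ⟨-, e8, er, -⟩
    simp [Test.Holds, e8, er 9 (by omega), h9]
  · refine ⟨by simp, by simp, ?_, rfl⟩
    intro x hx
    rw [St.setReg_reg, if_neg (by omega), St.setReg_reg, if_neg (by omega)]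
  · rintro k' s' hk' ⟨e3, -, er, ea⟩
    rw [min_eq_right (by omega)] at e3
    refine wp_block_nil (hQ k' s' ?_ ⟨er, fun j _ => by rw [ea], fun x _ => by rw [ea]; simp,
      fun x _ => by rw [ea]; simp⟩ e3)
    simp only [Ex.cost] at hk'; omega

end

/-! ### Serving a request -/

/-- The active ranks after a request at a node of rank `r`. -/
def Request.update (q : Request) (act : ℕ → Prop) (r : ℕ) : ℕ → Prop :=
  match q with
  | .insert => fun x => act x ∨ x = r
  | .delete => fun x => act x ∧ x ≠ r
  | .query => act

/-- A deletion has code 1, the number kept in register 9; an insertion has code 0. -/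
def updateActive : Prog :=
  block [asg 11 (.get 0 (.var 0)), asg 10 (.req (.var 0)),
    .ite (.eq 10 9) (put 2 (.var 11) (.lit 0))
      (block [asg 12 (.lit 0), .ite (.eq 10 12) (put 2 (.var 11) (.lit 1)) .skip])]

/-- Position 4 of array 5 is the only entry of the level with radius 1, whose list starts at 4 * 1.
-/
def answer : Prog :=
  block [asg 11 (.get 0 (.var 0)), asg 10 (.get 2 (.var 11)),
    .ite (.eq 10 9) (asg 1 (.get 1 (.var 11))) (asg 1 (.get 1 (.get 5 (.lit 4))))]

def serve : Prog := block [updateActive, climb, descend, answer]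

/-- The data of all levels `0, …, T`, where level `j` is centered at `c j`. -/
structure Levels (s : St) (n : ℕ) (rk : ℕ → ℕ) (act : ℕ → Prop) (T : ℕ) (c : ℕ → ℕ) : Prop where
  level : ∀ j ≤ T, Level s n rk act (64 ^ j) (c j)
  center : ∀ j < T, s.arr 7 (64 ^ j) = c j
  lt : ∀ j ≤ T, c j < n

section
variable {n : ℕ} {G : EventCycle n} {S W : ℕ} {Q : ℕ → St → Prop} {k : ℕ} {s s' s'' : St}
  {rk : ℕ → ℕ} {v c R R' : ℕ} {l : List ℕ} {act act' : ℕ → Prop}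

theorem Request.update_of_ne (q : Request) {r x : ℕ} (h : x ≠ r) :
    q.update act r x ↔ act x := by
  cases q <;> simp [Request.update, h]

open Classical in
theorem wp_updateActive (hr : Room n S W) (hb : Base s n rk act) (h0 : s.reg 0 = v) (hv : v < n)
    (hQ : ∀ k' s', k' ≤ k + 40 → Base s' n rk ((G.req ⟨v, hv⟩).update act (rk v)) →
      s'.reg 0 = v → (∀ j, j ≠ 2 → s'.arr j = s.arr j) → Q k' s') :
    WP G S W updateActive Q k s := by
  have hr' := hr
  obtain ⟨r1, r2, r3⟩ := hr'
  have hk := hb.rk_lt v hv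
  refine wp_block_cons (wp_asg (by omega) (by omega) (rk v) ?_ ?_ (by omega) ?_)
  · simp [Ex.eval, h0, hb.rank v hv]
  · simp [Ex.Ok, Ex.eval, h0, hb.rank v hv]; omega
  have hcode := request_code_lt (G.req ⟨v, hv⟩)
  refine wp_block_cons (wp_asg (by omega) (by omega) (G.req ⟨v, hv⟩).code ?_ ?_ (by omega) ?_)
  · simp [Ex.eval, h0, hv]
  · simp [Ex.Ok, h0]; omega
  have key : ∀ s2 k2, k2 ≤ k + 40 → (∀ x, x = 0 ∨ x = 2 ∨ x = 9 → s2.reg x = s.reg x) →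
      (∀ j, j ≠ 2 → s2.arr j = s.arr j) →
      (∀ w < n, s2.arr 2 (rk w) =
        if (G.req ⟨v, hv⟩).update act (rk v) (rk w) then 1 else 0) → Q k2 s2 := by
    intro s2 k2 hk2 hreg harr h2
    exact hQ k2 s2 hk2
      { size := by rw [hreg 2 (by omega), hb.size]
        one := by rw [hreg 9 (by omega), hb.one]
        rk_lt := hb.rk_lt
        rank := by rw [harr 0 (by omega)]; exact hb.rank
        node := by rw [harr 1 (by omega)]; exact hb.node
        node_last := by rw [harr 1 (by omega)]; exact hb.node_last
        active := h2 } (by rw [hreg 0 (by omega), h0]) harr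
  refine wp_block_cons (wp_ite (by simp [Test.OnRegs]) (fun hc => ?_) (fun hc => ?_))
  · simp only [Test.Holds, St.setReg_reg, if_pos] at hc
    simp only [hb.one, Nat.reduceEqDiff, if_false] at hc
    have hq : G.req ⟨v, hv⟩ = .delete := by
      cases hq : G.req ⟨v, hv⟩ <;> simp [hq, Request.code] at hc ⊢
    refine wp_put (by omega) (by omega) (rk v) 0 ?_ rfl ?_ ?_ (by omega)
      (by omega) (by omega) (by omega) (wp_block_nil (key _ _ ?_ ?_ ?_ ?_))
    · simp [Ex.eval]
    · simp [Ex.Ok]; omega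
    · simp [Ex.Ok]; omega
    · simp only [Ex.cost]; omega
    · rintro x (rfl | rfl | rfl) <;> simp
    · intro j hj; rw [St.setArr_arr_of_ne _ hj]; rfl
    · intro w hw
      by_cases h : rk w = rk v
      · simp [h, hq, Request.update]
      · simp [h, hq, Request.update, hb.active w hw]
  · simp only [Test.Holds, St.setReg_reg, if_pos] at hc
    simp only [hb.one, Nat.reduceEqDiff, if_false] at hc
    refine wp_block_cons (wp_asg (by omega) (by omega) 0 rfl ?_ (by omega) ?_)
    · simp [Ex.Ok]; omega
    refine wp_block_cons (wp_ite (by simp [Test.OnRegs]) (fun hd => ?_) (fun hd => ?_))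
    · simp [Test.Holds] at hd
      have hq : G.req ⟨v, hv⟩ = .insert := by
        cases hq : G.req ⟨v, hv⟩ <;> simp [hq, Request.code] at hd ⊢
      refine wp_put (by omega) (by omega) (rk v) 1 ?_ rfl ?_ ?_ (by omega)
        (by omega) (by omega) (by omega) (wp_block_nil (wp_block_nil (key _ _ ?_ ?_ ?_ ?_)))
      · simp [Ex.eval]
      · simp [Ex.Ok]; omega
      · simp [Ex.Ok]; omega
      · simp only [Ex.cost]; omega
      · rintro x (rfl | rfl | rfl) <;> simp
      · intro j hj; rw [St.setArr_arr_of_ne _ hj]; rfl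
      · intro w hw
        by_cases h : rk w = rk v
        · simp [h, hq, Request.update]
        · simp [h, hq, Request.update, hb.active w hw]
    · simp [Test.Holds] at hd
      have hq : G.req ⟨v, hv⟩ = .query := by
        cases hq : G.req ⟨v, hv⟩ <;> simp [hq, Request.code] at hd hc ⊢
      refine wp_skip (wp_block_nil (wp_block_nil (key _ _ ?_ ?_ ?_ ?_)))
      · simp only [Ex.cost]; omega
      · rintro x (rfl | rfl | rfl) <;> simp
      · intro j hj; rfl
      · intro w hw
        simp [hq, Request.update, hb.active w hw]

theorem list_eq_singleton {a : ℕ} (h : l.Nodup) (h' : ∀ w, w ∈ l ↔ w = a) : l = [a] := by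
  rw [← List.perm_singleton]
  exact (List.perm_ext_iff_of_nodup h (by simp)).2 (by simpa using h')

/-- An active item is its own successor. If the item of v is not active, excluding its rank from the
active ranks changes nothing, so the single entry of the bottom level is the answer. -/
theorem wp_answer (hr : Room n S W) (hb : Base s n rk act) (h0 : s.reg 0 = v) (hv : v < n)
    (hact : ∀ r, act r → ∃ w < n, rk w = r) (hL : Level s n rk act 1 v)
    (hQ : ∀ k', k' ≤ k + 40 → Q k' (((s.setReg 11 (rk v)).setReg 10 (s.arr 2 (rk v))).setReg 1
        (s.arr 1 (nxt act n (rk v))))) :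
    WP G S W answer Q k s := by
  have hr' := hr
  obtain ⟨r1, r2, r3⟩ := hr'
  have hk := hb.rk_lt v hv
  have hX : nxt act n (rk v) ≤ n ∧ s.arr 1 (nxt act n (rk v)) ≤ n := by
    have h1 : nxt act n (rk v) ≤ n := nxt_le_self hk.le
    refine ⟨h1, ?_⟩
    rcases (nxt_mem act n (rk v)).2 with h | h
    · obtain ⟨w, hw, e⟩ := hact _ h
      rw [← e]; exact (hb.node w hw).1.le
    · rw [le_antisymm h1 h, hb.node_last]
  have h2 : s.arr 2 (rk v) ≤ 1 := by rw [hb.active v hv]; split <;> omega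
  refine wp_block_cons (wp_asg (by omega) (by omega) (rk v) ?_ ?_ (by omega) ?_)
  · simp [Ex.eval, h0, hb.rank v hv]
  · simp [Ex.Ok, Ex.eval, h0, hb.rank v hv]; omega
  refine wp_block_cons (wp_asg (by omega) (by omega) (s.arr 2 (rk v)) ?_ ?_ (by omega) ?_)
  · simp [Ex.eval]
  · simp [Ex.Ok, Ex.eval]; omega
  refine wp_block_cons (wp_ite (by simp [Test.OnRegs]) (fun hc => ?_) (fun hc => ?_))
  · simp [Test.Holds, hb.one, hb.active v hv] at hc
    have e : nxt act n (rk v) = rk v := nxt_eq le_rfl (.inl hc) fun _ h _ => h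
    rw [e] at hX hQ
    refine wp_asg (by omega) (by omega) (s.arr 1 (rk v)) ?_ ?_ (by omega) (wp_block_nil ?_)
    · simp [Ex.eval]
    · simp [Ex.Ok, Ex.eval]; omega
    · exact hQ _ (by simp only [Ex.cost]; omega)
  · simp [Test.Holds, hb.one, hb.active v hv] at hc
    obtain ⟨l, -, h2, h3, -, h5⟩ := hL
    have hl : l = [v] := list_eq_singleton h2 fun w => by
      rw [h3]
      exact ⟨fun h => (inW_one hv h.1).1 h.2, fun h => by subst h; exact ⟨hv, (inW_one hv hv).2 rfl⟩⟩
    subst hl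
    have h6 : s.arr 5 4 = nxt act n (rk v) := by
      refine ((h5 0 (by simp)).2).trans (nxt_congr fun r _ => ?_)
      constructor
      · exact fun h => h.1
      · intro h
        refine ⟨h, ?_⟩
        rintro ⟨u, hu, hw, rfl⟩
        rw [inW_one hv hu] at hw
        subst hw
        exact hc h
    refine wp_asg (by omega) (by omega) (s.arr 1 (nxt act n (rk v))) ?_ ?_ (by omega)
      (wp_block_nil ?_)
    · simp [Ex.eval, h6]
    · simp [Ex.Ok, Ex.eval, h6]; omega
    · exact hQ _ (by simp only [Ex.cost]; omega)

/-- K is the number of levels that move. Levels from K on survive the update because v lies in their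
windows (`hin`); the others are invalid for a while and are then rebuilt from level K. The climb
takes at most 100 (K + 1) ≤ 100 * 64^K steps and is dominated by the rebuilding. -/
theorem wp_serve (hr : Room n S W) (hb : Base s n rk act) (h0 : s.reg 0 = v) (hv : v < n)
    {T K : ℕ} {c : ℕ → ℕ} (hT : ∀ j, j < T ↔ 2 * 64 ^ j ≤ n) (hL : Levels s n rk act T c)
    (hact : ∀ r, (G.req ⟨v, hv⟩).update act (rk v) r → ∃ w < n, rk w = r)
    (hK1 : 1 ≤ K) (hKT : K ≤ T) (hK : ∀ j < K, AtDist n (64 ^ j) (c j) v)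
    (hK' : K < T → ¬ AtDist n (64 ^ K) (c K) v)
    (hin : ∀ j, K ≤ j → j ≤ T → InW n (64 ^ j) (c j) v)
    (hsub : ∀ j, j + 1 = K → ∀ w < n, InW n (64 ^ j) v w → InW n (64 ^ K) (c K) w)
    (hQ : ∀ k' s', k' ≤ k + 3000 * 64 ^ K →
      Base s' n rk ((G.req ⟨v, hv⟩).update act (rk v)) →
      Levels s' n rk ((G.req ⟨v, hv⟩).update act (rk v)) T (fun j => if j < K then v else c j) →
      s'.reg 1 = s'.arr 1 (nxt ((G.req ⟨v, hv⟩).update act (rk v)) n (rk v)) → Q k' s') :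
    WP G S W serve Q k s := by
  refine wp_block_cons (wp_updateActive hr hb h0 hv ?_)
  set act' := (G.req ⟨v, hv⟩).update act (rk v) with hact'
  intro k1 s1 hk1 hb1 h01 ha1
  have hcen : ∀ j < T, s1.arr 7 (64 ^ j) = c j := fun j hj => by
    rw [ha1 7 (by omega), hL.center j hj]
  refine wp_block_cons (wp_climb hr h01 hb1.size hb1.one hv (K := K) (fun j hj => ?_) ?_ ?_ ?_)
  · refine ⟨(hT j).1 (by omega), ?_⟩
    rw [hcen j (by omega)]; exact hK j hj
  · rintro ⟨h1, h2⟩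
    have h3 := (hT K).2 h1
    rw [hcen K h3] at h2
    exact hK' h3 h2
  · intro j hj
    have h3 := (hT j).2 hj
    rw [hcen j h3]; exact hL.lt j h3.le
  intro k2 s2 hk2 hF2 h32
  have hpow : ∀ j ≤ K, 64 ^ j ≤ 32 * n := by
    intro j hj
    rcases j with _ | j
    · have := hr.pos; simp; omega
    · have := (hT j).1 (by omega)
      rw [pow_succ]; omega
  have hL2 : ∀ j, K ≤ j → j ≤ T → Level s2 n rk act' (64 ^ j) (c j) := by
    intro j hj hjT
    refine hF2.level (Nat.zero_le _) ?_
    have h1 : Level s1 n rk act (64 ^ j) (c j) := by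
      obtain ⟨l, h1, h2, h3, h4, h5⟩ := hL.level j hjT
      exact ⟨l, h1, h2, h3, by rw [ha1 6 (by omega), h4],
        h5.congr fun x _ _ => by rw [ha1 4 (by omega), ha1 5 (by omega)]; exact ⟨rfl, rfl⟩⟩
    exact h1.congr_act hv (hin j hj hjT) fun r hr => (Request.update_of_ne _ hr).symm
  refine wp_block_cons (wp_descend hr hv K (c K) k2 s2 _ (hF2.base hb1)
    ((hF2.reg 0 (by omega)).trans h01) h32 (hpow K le_rfl) (hL.lt K hKT)
    (hL2 K le_rfl hKT) hsub ?_)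
  intro k3 s3 hk3 hF3 hL3
  have hb3 := hF3.base (hF2.base hb1)
  have h03 : s3.reg 0 = v := by rw [hF3.reg 0 (by omega), hF2.reg 0 (by omega), h01]
  have hKpow : K + 1 ≤ 64 ^ K := Nat.lt_pow_self (by omega)
  have hKpow' : 64 ≤ 64 ^ K := by
    calc 64 = 64 ^ 1 := by norm_num
      _ ≤ 64 ^ K := Nat.pow_le_pow_right (by omega) hK1
  set s4 := ((s3.setReg 11 (rk v)).setReg 10 (s3.arr 2 (rk v))).setReg 1
        (s3.arr 1 (nxt act' n (rk v))) with hs4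
  have hfin : ∀ k', k' ≤ k + 3000 * 64 ^ K → Q k' s4 := by
    intro k' hk'
    refine hQ k' s4 hk' ⟨?_, ?_, hb3.rk_lt, hb3.rank, hb3.node, hb3.node_last, hb3.active⟩
      ⟨fun j hj => ?_, fun j hj => ?_, fun j hj => ?_⟩ ?_
    · simp [hs4, hb3.size]
    · simp [hs4, hb3.one]
    · split
      · rename_i h; exact (hL3 j h).1
      · rename_i h
        exact hF3.level (Nat.pow_le_pow_right (by omega) (by omega)) (hL2 j (by omega) hj)
    · split
      · rename_i h; exact (hL3 j h).2
      · rename_i h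
        change s3.arr 7 (64 ^ j) = c j
        rw [(hF3.dirs _ (Nat.pow_le_pow_right (by omega) (by omega))).2,
          (hF2.dirs _ (Nat.zero_le _)).2, hcen j hj]
    · split
      · exact hv
      · exact hL.lt j hj
    · simp [hs4]
  exact wp_block_cons (wp_answer hr hb3 h03 hv hact (by simpa using (hL3 0 hK1).1)
    fun k' hk' => wp_block_nil (hfin _ (by omega)))

end

/-! ### Setup -/

namespace EventCycle

variable {n : ℕ}

/-- Nodes `u` and `w` exist, and the item of the former is the smaller one. -/
def Below (G : EventCycle n) (u w : ℕ) : Prop :=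
  ∃ (hu : u < n) (hw : w < n), G.item ⟨u, hu⟩ < G.item ⟨w, hw⟩

open Classical in
/-- The number of nodes with an item smaller than that of `w`. -/
noncomputable def rank (G : EventCycle n) (w : ℕ) : ℕ :=
  ((Finset.range n).filter fun u => G.Below u w).card

theorem rank_lt (G : EventCycle n) {w : ℕ} (hw : w < n) : G.rank w < n := by
  classical
  refine (Finset.card_lt_card (t := Finset.range n) ?_).trans_eq (Finset.card_range n)
  rw [Finset.ssubset_iff_of_subset (Finset.filter_subset _ _)]
  refine ⟨w, by simpa using hw, ?_⟩
  simp only [Finset.mem_filter, not_and]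
  rintro - ⟨_, _, h⟩
  exact lt_irrefl _ h

/-- Counting strictly smaller items gives equal items the same rank, so ranks reproduce the order of
the items exactly. Once they are known, the programs never compare items again. -/
theorem rank_le_iff (G : EventCycle n) {a b : ℕ} (ha : a < n) (hb : b < n) :
    G.rank a ≤ G.rank b ↔ G.item ⟨a, ha⟩ ≤ G.item ⟨b, hb⟩ := by
  classical
  constructor
  · intro h
    by_contra hlt
    rw [not_le] at hlt
    refine absurd h (not_le.2 (Finset.card_lt_card ?_))
    rw [Finset.ssubset_iff_of_subset]
    · refine ⟨b, ?_, ?_⟩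
      · simp only [Finset.mem_filter, Finset.mem_range]
        exact ⟨hb, hb, ha, hlt⟩
      · simp only [Finset.mem_filter, not_and]
        rintro - ⟨_, _, h⟩
        exact lt_irrefl _ h
    · refine Finset.monotone_filter_right _ fun u _ hu => ?_
      obtain ⟨hu, _, h⟩ := hu
      exact ⟨hu, ha, h.trans hlt⟩
  · intro h
    refine Finset.card_le_card (Finset.monotone_filter_right _ fun u _ hu => ?_)
    obtain ⟨hu, _, h'⟩ := hu
    exact ⟨hu, hb, h'.trans_le h⟩

end EventCycle

/-- A quadratic count. Nodes with equal items overwrite each other in array 1, which needs only some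
node of each rank. -/
def rankLoop : Prog :=
  block [asg 4 (.lit 0), .loop (.lt 4 2) (block [asg 5 (.lit 0), asg 6 (.lit 0),
    .loop (.lt 5 2) (block [.ite (.itemLE 4 5) .skip (incr 6), incr 5]),
    put 0 (.var 4) (.var 6), put 1 (.var 6) (.var 4), incr 4])]

def topRadius : Prog :=
  block [asg 3 (.lit 1), asg 10 (.lit 2),
    .loop (.le 10 2) (block [asg 3 (.op .mul (.lit 64) (.var 3)),
      asg 10 (.op .mul (.lit 2) (.var 3))])]

/-- Appends the nodes whose rank is in register 6. The top window leaves no rank out, so every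
stored successor is n, that is, infinity. -/
def sortInner : Prog :=
  .loop (.lt 4 2) (block [asg 10 (.get 0 (.var 4)),
    .ite (.eq 10 6) (block [put 4 (.op .add (.op .mul (.lit 4) (.var 3)) (.var 5)) (.var 4),
      put 5 (.op .add (.op .mul (.lit 4) (.var 3)) (.var 5)) (.var 2), incr 5]) .skip,
    incr 4])

def sortLoop : Prog :=
  block [asg 5 (.lit 0), asg 6 (.var 2),
    .loop (.le 9 6) (block [asg 6 (.op .sub (.var 6) (.lit 1)), asg 4 (.lit 0), sortInner])]

def setup : Prog :=
  block [asg 2 (.var 0), asg 9 (.lit 1), asg 0 (.lit 0), rankLoop, put 1 (.var 2) (.var 2),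
    topRadius, sortLoop, put 6 (.var 3) (.var 5), descend]

/-! ### Correctness of the setup -/

section
variable {n : ℕ} {G : EventCycle n} {S W : ℕ} {Q : ℕ → St → Prop} {k : ℕ} {s s' s'' : St}
  {v c R R' : ℕ} {l : List ℕ} {act act' : ℕ → Prop}

open Classical in
theorem wp_rankInner (hr : Room n S W) {i : ℕ} (hi : i < n) (h2 : s.reg 2 = n) (h4 : s.reg 4 = i)
    (h5 : s.reg 5 = 0) (h6 : s.reg 6 = 0)
    (hQ : ∀ k' s', k' ≤ k + n * 20 + 1 → (∀ x, x ≠ 5 → x ≠ 6 → s'.reg x = s.reg x) →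
      s'.arr = s.arr → s'.reg 6 = G.rank i → Q k' s') :
    WP G S W (.loop (.lt 5 2) (block [.ite (.itemLE 4 5) .skip (incr 6), incr 5])) Q k s := by
  obtain ⟨r1, r2, r3⟩ := hr
  set c : ℕ → ℕ := fun j => ((Finset.range j).filter fun u => G.Below u i).card with hc
  have hcj : ∀ j, c j ≤ j := fun j => (Finset.card_filter_le _ _).trans_eq (Finset.card_range j)
  have hc1 : ∀ j, c (j + 1) = c j + if G.Below j i then 1 else 0 := by
    intro j
    simp only [hc, Finset.range_add_one, Finset.filter_insert]
    split
    · rw [Finset.card_insert_of_notMem (by simp)]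
    · simp
  refine wp_loop_count (c := .lt 5 2) (by simp [Test.OnRegs])
    (fun j s' => s'.reg 5 = j ∧ s'.reg 6 = c j ∧ (∀ x, x ≠ 5 → x ≠ 6 → s'.reg x = s.reg x) ∧
      s'.arr = s.arr) 19 n ?_ ?_ ?_ ?_
  · rintro j hj s' k' ⟨e5, e6, er, ea⟩
    have := hcj j
    refine ⟨by simp only [Test.Holds, e5, er 2 (by omega) (by omega), h2]; exact hj, ?_⟩
    refine wp_block_cons (wp_ite (by simp [Test.OnRegs]) (fun hd => ?_) fun hd => ?_)
    · have hb : ¬ G.Below j i := by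
        rintro ⟨hu, hw, h⟩
        obtain ⟨_, _, h'⟩ := hd
        simp only [e5, er 4 (by omega) (by omega), h4] at h'
        exact absurd h (not_lt.2 h')
      refine wp_skip (wp_block_cons (wp_incr (by omega) r3 (by omega) (by rw [e5]; omega)
        (wp_block_nil ⟨by omega, ?_, ?_, ?_, ea⟩)))
      · simp [e5]
      · simp [e6, hc1, hb]
      · intro x a b; simp [a, er x a b]
    · have hb : G.Below j i := by
        refine ⟨hj, hi, not_le.1 fun h => hd ?_⟩
        simp only [Test.Holds, e5, er 4 (by omega) (by omega), h4]
        exact ⟨hi, hj, h⟩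
      refine wp_incr (by omega) r3 (by omega) (by rw [e6]; omega) ?_
      refine wp_block_cons (wp_incr (by omega) r3 (by omega) (by simp [e5]; omega)
        (wp_block_nil ⟨by omega, ?_, ?_, ?_, ea⟩))
      · simp [e5]
      · simp [e6, hc1, hb]
      · intro x a b; simp [a, b, er x a b]
  · rintro s' ⟨e5, -, er, -⟩
    simp [Test.Holds, e5, er 2, h2]
  · exact ⟨h5, by simp [h6, hc], fun _ _ _ => rfl, rfl⟩
  · rintro k' s' hk' ⟨-, e6, er, ea⟩
    exact hQ k' s' hk' er ea e6

theorem wp_rankLoop (hr : Room n S W) (h2 : s.reg 2 = n)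
    (hQ : ∀ k' s', k' ≤ k + n * (n * 20 + 100) + 10 →
      (∀ x, x ≠ 4 → x ≠ 5 → x ≠ 6 → s'.reg x = s.reg x) →
      (∀ j, j ≠ 0 → j ≠ 1 → s'.arr j = s.arr j) → (∀ w < n, s'.arr 0 w = G.rank w) →
      (∀ w < n, s'.arr 1 (G.rank w) < n ∧ G.rank (s'.arr 1 (G.rank w)) = G.rank w) → Q k' s') :
    WP G S W rankLoop Q k s := by
  have hr' := hr
  obtain ⟨r1, r2, r3⟩ := hr'
  refine wp_block_cons (wp_asg (by omega) (by omega) 0 rfl ?_ (by omega) ?_)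
  · simp only [Ex.Ok]; omega
  refine wp_block_cons (wp_loop_count (c := .lt 4 2) (by simp [Test.OnRegs])
    (fun i s' => s'.reg 4 = i ∧ (∀ x, x ≠ 4 → x ≠ 5 → x ≠ 6 → s'.reg x = s.reg x) ∧
      (∀ j, j ≠ 0 → j ≠ 1 → s'.arr j = s.arr j) ∧ (∀ w < i, s'.arr 0 w = G.rank w) ∧
      ∀ w < i, s'.arr 1 (G.rank w) < n ∧ G.rank (s'.arr 1 (G.rank w)) = G.rank w)
      (n * 20 + 50) n ?_ ?_ ?_ ?_)
  · rintro i hi s' k' ⟨e4, er, ea, e0, e1⟩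
    refine ⟨by simp [Test.Holds, e4, er 2, h2, hi], ?_⟩
    have hk := G.rank_lt hi
    refine wp_block_cons (wp_asg (by omega) (by omega) 0 rfl ?_ (by omega) ?_)
    · simp only [Ex.Ok]; omega
    refine wp_block_cons (wp_asg (by omega) (by omega) 0 rfl ?_ (by omega) ?_)
    · simp only [Ex.Ok]; omega
    refine wp_block_cons (wp_rankInner hr hi (by simp [er 2, h2]) (by simp [e4]) (by simp)
      (by simp) ?_)
    intro k2 s2 hk2 er2 ea2 e26
    have e24 : s2.reg 4 = i := by simp [er2 4, e4]
    refine wp_block_cons (wp_put (by omega) (by omega) i (G.rank i) ?_ ?_ ?_ ?_ (by omega) (by omega)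
      (by omega) (by omega) ?_)
    · simp [Ex.eval, e24]
    · simp [Ex.eval, e26]
    · simp [Ex.Ok, e24]; omega
    · simp [Ex.Ok, e26]; omega
    refine wp_block_cons (wp_put (by omega) (by omega) (G.rank i) i ?_ ?_ ?_ ?_ (by omega) (by omega)
      (by omega) (by omega) ?_)
    · simp [Ex.eval, e26]
    · simp [Ex.eval, e24]
    · simp [Ex.Ok, e26]; omega
    · simp [Ex.Ok, e24]; omega
    refine wp_block_cons (wp_incr (by omega) r3 (by omega) (by simp [e24]; omega)
      (wp_block_nil ⟨?_, ?_, ?_, ?_, ?_, ?_⟩))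
    · simp only [Ex.cost] at *; omega
    · simp [e24]
    · intro x a b c; simp [a, er2 x b c, b, c, er x a b c]
    · intro j a b
      rw [St.setReg_arr, St.setArr_arr_of_ne _ b, St.setArr_arr_of_ne _ a, ea2, St.setReg_arr,
        St.setReg_arr, ea j a b]
    · intro w hw
      rw [St.setReg_arr, St.setArr_arr_of_ne _ (by omega), St.setArr_arr]
      split
      · rename_i h; rw [h.2]
      · rw [ea2]; exact e0 w (by omega)
    · intro w hw
      simp only [St.setReg_arr, St.setArr_arr, true_and]
      split
      · rename_i h; exact ⟨hi, h.symm⟩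
      · rename_i h
        have : w ≠ i := fun h' => h (by rw [h'])
        simp only [one_ne_zero, false_and, if_false]
        rw [ea2]; exact e1 w (by omega)
  · rintro s' ⟨e4, er, -⟩
    simp [Test.Holds, e4, er 2, h2]
  · exact ⟨by simp, fun x a b c => by simp [a], fun _ _ _ => rfl, fun w hw => absurd hw (by omega),
      fun w hw => absurd hw (by omega)⟩
  · rintro k' s' hk' ⟨-, er, ea, e0, e1⟩
    refine wp_block_nil (hQ k' s' ?_ er ea e0 e1)
    simp only [Ex.cost] at hk'
    nlinarith

theorem wp_topRadius (hr : Room n S W) (h2 : s.reg 2 = n) {T : ℕ}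
    (hT : ∀ j, j < T ↔ 2 * 64 ^ j ≤ n)
    (hQ : ∀ k' s', k' ≤ k + n * 30 + 10 → (∀ x, x ≠ 3 → x ≠ 10 → s'.reg x = s.reg x) →
      s'.arr = s.arr → s'.reg 3 = 64 ^ T → Q k' s') :
    WP G S W topRadius Q k s := by
  obtain ⟨r1, r2, r3⟩ := hr
  refine wp_block_cons (wp_asg (by omega) (by omega) 1 rfl ?_ (by omega) ?_)
  · simp only [Ex.Ok]; omega
  refine wp_block_cons (wp_asg (by omega) (by omega) 2 rfl ?_ (by omega) ?_)
  · simp only [Ex.Ok]; omega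
  refine wp_block_cons (wp_loop_count (c := .le 10 2) (by simp [Test.OnRegs])
    (fun i s' => s'.reg 3 = 64 ^ i ∧ s'.reg 10 = 2 * 64 ^ i ∧
      (∀ x, x ≠ 3 → x ≠ 10 → s'.reg x = s.reg x) ∧ s'.arr = s.arr) 15 T ?_ ?_ ?_ ?_)
  · rintro i hi s' k' ⟨e3, e10, er, ea⟩
    have h1 := (hT i).1 hi
    refine ⟨by simpa [Test.Holds, e10, er 2, h2] using h1, ?_⟩
    refine wp_block_cons (wp_asg (by omega) (by omega) (64 * 64 ^ i) ?_ ?_ (by omega) ?_)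
    · simp [Ex.eval, ArithOp.eval, e3]
    · simp [Ex.Ok, Ex.eval, ArithOp.eval, e3]; omega
    refine wp_block_cons (wp_asg (by omega) (by omega) (2 * (64 * 64 ^ i)) ?_ ?_ (by omega) ?_)
    · simp [Ex.eval, ArithOp.eval]
    · simp [Ex.Ok, Ex.eval, ArithOp.eval]; omega
    refine wp_block_nil ⟨?_, ?_, ?_, ?_, ea⟩
    · simp only [Ex.cost]; omega
    · simp [pow_succ, mul_comm]
    · simp [pow_succ, mul_comm]
    · intro x a b; simp [a, b, er x a b]
  · rintro s' ⟨-, e10, er, -⟩ h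
    simp only [Test.Holds, e10, er 2 (by omega) (by omega), h2] at h
    exact absurd ((hT T).2 h) (lt_irrefl _)
  · exact ⟨by simp, by simp, fun x a b => by simp [a, b], rfl⟩
  · rintro k' s' hk' ⟨e3, -, er, ea⟩
    have hTn : T ≤ n := by
      rcases T with _ | T
      · omega
      · have h1 := (hT T).1 (by omega)
        have h2 : T < 64 ^ T := Nat.lt_pow_self (by omega)
        omega
    refine wp_block_nil (hQ k' s' ?_ er ea e3)
    simp only [Ex.cost] at hk'; omega

theorem nodup_length_le (hl : l.Nodup) (h : ∀ w ∈ l, w < n) : l.length ≤ n := by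
  rw [← List.toFinset_card_of_nodup hl]
  refine (Finset.card_le_card (t := Finset.range n) fun w hw => ?_).trans_eq (Finset.card_range n)
  simpa using h w (by simpa using hw)

/-- The list `l` is sorted by decreasing rank and consists of the nodes in the set `M`. -/
structure SortedBy (rk : ℕ → ℕ) (n : ℕ) (M : ℕ → Prop) (l : List ℕ) : Prop where
  sorted : l.Pairwise fun a b => rk b ≤ rk a
  nodup : l.Nodup
  mem : ∀ w, w ∈ l ↔ w < n ∧ M w

theorem SortedBy.congr {rk : ℕ → ℕ} {M M' : ℕ → Prop} (h : SortedBy rk n M l)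
    (h' : ∀ w < n, M w ↔ M' w) : SortedBy rk n M' l :=
  ⟨h.sorted, h.nodup, fun w => (h.mem w).trans (and_congr_right (h' w))⟩

theorem wp_sortInner (hr : Room n S W) (h2 : s.reg 2 = n) (h3 : s.reg 3 = R) (hR : R ≤ 32 * n)
    (h4 : s.reg 4 = 0) (h6 : s.reg 6 = c) (h0 : ∀ w < n, s.arr 0 w = G.rank w)
    (h5 : s.reg 5 = l.length) (hs : SortedBy G.rank n (fun w => c < G.rank w) l)
    (hF : Stored s R l fun _ => n)
    (hQ : ∀ k' s' (l' : List ℕ), k' ≤ k + n * 60 + 1 →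
      (∀ x, x ≠ 4 → x ≠ 5 → x ≠ 10 → s'.reg x = s.reg x) →
      (∀ j, j ≠ 4 → j ≠ 5 → s'.arr j = s.arr j) → s'.reg 5 = l'.length →
      SortedBy G.rank n (fun w => c ≤ G.rank w) l' → Stored s' R l' (fun _ => n) → Q k' s') :
    WP G S W sortInner Q k s := by
  obtain ⟨r1, r2, r3⟩ := hr
  refine wp_loop_count (c := .lt 4 2) (by simp [Test.OnRegs])
    (fun i s' => s'.reg 4 = i ∧ (∀ x, x ≠ 4 → x ≠ 5 → x ≠ 10 → s'.reg x = s.reg x) ∧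
      (∀ j, j ≠ 4 → j ≠ 5 → s'.arr j = s.arr j) ∧ ∃ l' : List ℕ, s'.reg 5 = l'.length ∧
      SortedBy G.rank n (fun w => c < G.rank w ∨ (G.rank w = c ∧ w < i)) l' ∧
      Stored s' R l' (fun _ => n)) 59 n ?_ ?_ ?_ ?_
  · rintro i hi s' k' ⟨e4, er, ea, l', e5, hs', hF'⟩
    have e2 : s'.reg 2 = n := by simp [er 2, h2]
    have e3 : s'.reg 3 = R := by simp [er 3, h3]
    have e6 : s'.reg 6 = c := by simp [er 6, h6]
    have e0 : s'.arr 0 i = G.rank i := by rw [ea 0 (by omega) (by omega), h0 i hi]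
    have hk := G.rank_lt hi
    have hln : l'.length ≤ n := nodup_length_le hs'.nodup fun w hw => ((hs'.mem w).1 hw).1
    refine ⟨by simp [Test.Holds, e4, e2, hi], ?_⟩
    refine wp_block_cons (wp_asg (by omega) (by omega) (G.rank i) ?_ ?_ (by omega) ?_)
    · simp [Ex.eval, e4, e0]
    · simp [Ex.Ok, Ex.eval, e4, e0]; omega
    refine wp_block_cons (wp_ite (by simp [Test.OnRegs]) (fun hd => ?_) fun hd => ?_)
    · simp [Test.Holds, e6] at hd
      refine wp_block_cons (wp_put (by omega) (by omega) (4 * R + l'.length) i ?_ ?_ ?_ ?_ (by omega)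
        (by omega) (by omega) (by omega) ?_)
      · simp [Ex.eval, ArithOp.eval, e3, e5]
      · simp [Ex.eval, e4]
      · simp [Ex.Ok, Ex.eval, ArithOp.eval, e3, e5]; omega
      · simp [Ex.Ok, e4]; omega
      refine wp_block_cons (wp_put (by omega) (by omega) (4 * R + l'.length) n ?_ ?_ ?_ ?_ (by omega)
        (by omega) (by omega) (by omega) ?_)
      · simp [Ex.eval, ArithOp.eval, e3, e5]
      · simp [Ex.eval, e2]
      · simp [Ex.Ok, Ex.eval, ArithOp.eval, e3, e5]; omega
      · simp [Ex.Ok, e2]; omega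
      refine wp_block_cons (wp_incr (by omega) r3 (by omega) (by simp [e5]; omega) (wp_block_nil ?_))
      refine wp_block_cons (wp_incr (by omega) r3 (by omega) (by simp [e4]; omega)
        (wp_block_nil ⟨?_, ?_, ?_, ?_, l' ++ [i], ?_, ⟨?_, ?_, ?_⟩, ?_⟩))
      · simp only [Ex.cost]; omega
      · simp [e4]
      · intro x a b c; simp [a, b, c, er x a b c]
      · intro j a b
        rw [St.setReg_arr, St.setReg_arr, St.setArr_arr_of_ne _ b, St.setArr_arr_of_ne _ a]
        exact ea j a b
      · simp [e5]
      · rw [List.pairwise_append]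
        refine ⟨hs'.sorted, List.pairwise_singleton _ _, fun a ha b hb => ?_⟩
        rw [List.mem_singleton.1 hb]
        have := ((hs'.mem a).1 ha).2
        omega
      · rw [List.nodup_append]
        refine ⟨hs'.nodup, List.nodup_singleton _, fun a ha b hb => ?_⟩
        rw [List.mem_singleton.1 hb]
        rintro rfl
        have := ((hs'.mem a).1 ha).2
        omega
      · intro w
        rw [List.mem_append, hs'.mem, List.mem_singleton]
        constructor
        · rintro (⟨h1, h2 | h2⟩ | rfl)
          · exact ⟨h1, .inl h2⟩
          · exact ⟨h1, .inr ⟨h2.1, by omega⟩⟩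
          · exact ⟨hi, .inr ⟨hd, by omega⟩⟩
        · rintro ⟨h1, h2 | h2⟩
          · exact .inl ⟨h1, .inl h2⟩
          · by_cases hwi : w = i
            · exact .inr hwi
            · exact .inl ⟨h1, .inr ⟨h2.1, by omega⟩⟩
      · refine Stored.snoc (hF'.congr fun x _ hx => ?_) ?_ ?_
        · simp [hx.ne]
        · simp
        · simp
    · simp [Test.Holds, e6] at hd
      refine wp_skip (wp_block_cons (wp_incr (by omega) r3 (by omega) (by simp [e4]; omega)
        (wp_block_nil ⟨?_, ?_, ?_, ?_, l', ?_, hs'.congr ?_, hF'⟩)))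
      · simp only [Ex.cost]; omega
      · simp [e4]
      · intro x a b c; simp [a, c, er x a b c]
      · exact ea
      · simp [e5]
      · intro w hw
        constructor
        · rintro (h | h)
          · exact .inl h
          · exact .inr ⟨h.1, by omega⟩
        · rintro (h | h)
          · exact .inl h
          · have : w ≠ i := by rintro rfl; exact hd h.1
            exact .inr ⟨h.1, by omega⟩
  · rintro s' ⟨e4, er, -⟩
    simp [Test.Holds, e4, er 2, h2]
  · exact ⟨h4, fun _ _ _ _ => rfl, fun _ _ _ => rfl, l, h5, hs.congr fun w _ => by simp, hF⟩
  · rintro k' s' hk' ⟨-, er, ea, l', e5, hs', hF'⟩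
    refine hQ k' s' l' hk' er ea e5 (hs'.congr fun w hw => ?_) hF'
    omega

theorem wp_sortLoop (hr : Room n S W) (h2 : s.reg 2 = n) (h3 : s.reg 3 = R) (hR : R ≤ 32 * n)
    (h9 : s.reg 9 = 1) (h0 : ∀ w < n, s.arr 0 w = G.rank w)
    (hQ : ∀ k' s' (l' : List ℕ), k' ≤ k + n * (n * 60 + 30) + 10 →
      (∀ x, x ≠ 4 → x ≠ 5 → x ≠ 6 → x ≠ 10 → s'.reg x = s.reg x) →
      (∀ j, j ≠ 4 → j ≠ 5 → s'.arr j = s.arr j) → s'.reg 5 = l'.length →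
      SortedBy G.rank n (fun _ => True) l' → Stored s' R l' (fun _ => n) → Q k' s') :
    WP G S W sortLoop Q k s := by
  have hr' := hr
  obtain ⟨r1, r2, r3⟩ := hr'
  refine wp_block_cons (wp_asg (by omega) (by omega) 0 rfl ?_ (by omega) ?_)
  · simp only [Ex.Ok]; omega
  refine wp_block_cons (wp_asg (by omega) (by omega) n ?_ ?_ (by omega) ?_)
  · simp [Ex.eval, h2]
  · simp [Ex.Ok, h2]; omega
  refine wp_block_cons (wp_loop_count (c := .le 9 6) (by simp [Test.OnRegs])
    (fun i s' => s'.reg 6 = n - i ∧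
      (∀ x, x ≠ 4 → x ≠ 5 → x ≠ 6 → x ≠ 10 → s'.reg x = s.reg x) ∧
      (∀ j, j ≠ 4 → j ≠ 5 → s'.arr j = s.arr j) ∧ ∃ l' : List ℕ, s'.reg 5 = l'.length ∧
      SortedBy G.rank n (fun w => n - i ≤ G.rank w) l' ∧
      Stored s' R l' (fun _ => n)) (n * 60 + 20) n ?_ ?_ ?_ ?_)
  · rintro i hi s' k' ⟨e6, er, ea, l', e5, hs', hF'⟩
    refine ⟨by simp only [Test.Holds, e6, er 9 (by omega) (by omega) (by omega) (by omega), h9]; omega, ?_⟩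
    refine wp_block_cons (wp_asg (by omega) (by omega) (n - (i + 1)) ?_ ?_ (by omega) ?_)
    · simp [Ex.eval, ArithOp.eval, e6]; omega
    · simp [Ex.Ok, Ex.eval, ArithOp.eval, e6]; omega
    refine wp_block_cons (wp_asg (by omega) (by omega) 0 rfl ?_ (by omega) ?_)
    · simp only [Ex.Ok]; omega
    refine wp_block_cons (wp_sortInner hr (l := l') (c := n - (i + 1)) (R := R)
      (by simp [er 2, h2]) (by simp [er 3, h3]) hR (by simp) (by simp) ?_ (by simp [e5])
      (hs'.congr fun w hw => by omega) hF' ?_)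
    · intro w hw
      rw [St.setReg_arr, St.setReg_arr, ea 0 (by omega) (by omega), h0 w hw]
    intro k2 s2 l2 hk2 er2 ea2 e25 hs2 hF2
    refine wp_block_nil ⟨?_, ?_, ?_, ?_, l2, e25, hs2, hF2⟩
    · simp only [Ex.cost] at hk2; omega
    · simp [er2 6]
    · intro x a b c d; simp [er2 x a b d, a, c, er x a b c d]
    · intro j a b; rw [ea2 j a b]; exact ea j a b
  · rintro s' ⟨e6, er, -⟩
    simp [Test.Holds, e6, er 9, h9]
  · refine ⟨by simp, fun x a b c d => by simp [b, c], fun _ _ _ => rfl, [], by simp, ⟨by simp,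
      by simp, fun w => ?_⟩, fun i hi => absurd hi (by simp)⟩
    simp only [List.not_mem_nil, false_iff, not_and]
    intro hw
    have := G.rank_lt hw
    omega
  · rintro k' s' hk' ⟨-, er, ea, l', e5, hs', hF'⟩
    refine wp_block_nil (hQ k' s' l' ?_ er ea e5 (hs'.congr fun w hw => by simp) hF')
    simp only [Ex.cost] at hk'
    nlinarith

theorem wp_setup (hr : Room n S W) {T : ℕ} (hT : ∀ j, j < T ↔ 2 * 64 ^ j ≤ n)
    (h0 : s.reg 0 = n) (ha : ∀ j i, s.arr j i = 0)
    (hQ : ∀ k' s', k' ≤ k + 100000 * n ^ 2 → Base s' n G.rank (fun _ => False) →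
      Levels s' n G.rank (fun _ => False) T (fun _ => 0) → Q k' s') :
    WP G S W setup Q k s := by
  have hr' := hr
  obtain ⟨r1, r2, r3⟩ := hr'
  -- T is the first exponent with n < 2 * 64^T. Thus the top window is everything, while the top
  -- radius is at most 64 times n / 2.
  have hTop : 64 ^ T ≤ 32 * n := by
    rcases T with _ | T
    · simp; omega
    · have := (hT T).1 (by omega)
      rw [pow_succ]; omega
  have hTop' : n < 2 * 64 ^ T := by
    by_contra h
    exact lt_irrefl _ ((hT T).2 (not_lt.1 h))
  refine wp_block_cons (wp_asg (by omega) (by omega) n ?_ ?_ (by omega) ?_)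
  · simp [Ex.eval, h0]
  · simp [Ex.Ok, h0]; omega
  refine wp_block_cons (wp_asg (by omega) (by omega) 1 rfl ?_ (by omega) ?_)
  · simp only [Ex.Ok]; omega
  refine wp_block_cons (wp_asg (by omega) (by omega) 0 rfl ?_ (by omega) ?_)
  · simp only [Ex.Ok]; omega
  refine wp_block_cons (wp_rankLoop hr (by simp) ?_)
  intro k1 s1 hk1 er1 ea1 e10 e11
  have e12 : s1.reg 2 = n := by simp [er1 2]
  refine wp_block_cons (wp_put (by omega) (by omega) n n ?_ ?_ ?_ ?_ (by omega) (by omega)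
    (by omega) (by omega) ?_)
  · simp [Ex.eval, e12]
  · simp [Ex.eval, e12]
  · simp [Ex.Ok, e12]; omega
  · simp [Ex.Ok, e12]; omega
  refine wp_block_cons (wp_topRadius hr (by simp [e12]) hT ?_)
  intro k2 s2 hk2 er2 ea2 e23
  have e20 : ∀ w < n, s2.arr 0 w = G.rank w := fun w hw => by
    rw [ea2, St.setArr_arr_of_ne _ (by omega), e10 w hw]
  refine wp_block_cons (wp_sortLoop hr (by simp [er2 2, e12]) e23 hTop (by simp [er2 9, er1 9])
    e20 ?_)
  intro k3 s3 l hk3 er3 ea3 e35 hs3 hF3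
  have hln : l.length ≤ n := nodup_length_le hs3.nodup fun w hw => ((hs3.mem w).1 hw).1
  have e33 : s3.reg 3 = 64 ^ T := by simp [er3 3, e23]
  refine wp_block_cons (wp_put (by omega) (by omega) (64 ^ T) l.length ?_ ?_ ?_ ?_ (by omega)
    (by omega) (by omega) (by omega) ?_)
  · simp [Ex.eval, e33]
  · simp [Ex.eval, e35]
  · simp [Ex.Ok, e33]; omega
  · simp [Ex.Ok, e35]; omega
  set s4 := s3.setArr 6 (64 ^ T) l.length with hs4
  have er4 : ∀ x, x = 0 ∨ x = 2 ∨ x = 9 →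
      s4.reg x = if x = 0 then 0 else if x = 2 then n else 1 := by
    rintro x (rfl | rfl | rfl) <;> simp [hs4, er3, er2, er1]
  have ea4 : ∀ j, j ≠ 4 → j ≠ 5 → j ≠ 6 → s4.arr j = (s1.setArr 1 n n).arr j := by
    intro j a b c
    rw [hs4, St.setArr_arr_of_ne _ c, ea3 j a b, ea2]
  have hb : Base s4 n G.rank (fun _ => False) :=
    { size := by simp [er4 2]
      one := by simp [er4 9]
      rk_lt := fun w hw => G.rank_lt hw
      rank := fun w hw => by
        rw [ea4 0 (by omega) (by omega) (by omega), St.setArr_arr_of_ne _ (by omega), e10 w hw]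
      node := fun w hw => by
        have := G.rank_lt hw
        rw [ea4 1 (by omega) (by omega) (by omega), St.setArr_arr, if_neg (by omega)]
        exact e11 w hw
      node_last := by rw [ea4 1 (by omega) (by omega) (by omega), St.setArr_arr, if_pos (by simp)]
      active := fun w _ => by
        rw [ea4 2 (by omega) (by omega) (by omega), St.setArr_arr_of_ne _ (by omega),
          ea1 2 (by omega) (by omega)]
        simp [ha] }
  have hL : Level s4 n G.rank (fun _ => False) (64 ^ T) 0 := by
    refine ⟨l, hs3.sorted, hs3.nodup, fun w => ?_, by simp [hs4], fun i hi => ?_⟩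
    · rw [hs3.mem]
      exact and_congr_right fun _ => by simp [inW_of_lt r1 hTop']
    · have hw := ((hs3.mem _).1 (List.getElem_mem hi)).1
      have := G.rank_lt hw
      beta_reduce
      rw [nxt_false (fun r h => h.1) this.le, hs4, St.setArr_arr_of_ne _ (by omega),
        St.setArr_arr_of_ne _ (by omega)]
      exact hF3 i hi
  refine wp_block_cons (wp_descend hr r1 T 0 _ s4 _ hb (by simp [er4 0]) (by rw [hs4]; exact e33)
    hTop r1 hL ?_ ?_)
  · rintro j rfl w hw h
    rw [pow_succ, mul_comm]
    exact InW.mono (by omega) (Nat.one_le_pow _ _ (by omega)) r1 r1 ⟨0, by positivity, by simp⟩ h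
  · intro k5 s5 hk5 hF5 hL5
    refine wp_block_nil (hQ k5 s5 ?_ (hF5.base hb) ⟨fun j hj => ?_, fun j hj => (hL5 j hj).2,
      fun _ _ => r1⟩)
    · simp only [Ex.cost] at *
      nlinarith
    · rcases hj.lt_or_eq with h | rfl
      · exact (hL5 j h).1
      · exact hF5.level le_rfl hL

end

/-! ### The lifted walk

The hops of the walk are recorded as a list of bits, the most recent one first. -/

/-- The position of the walk on the universal cover `ℤ` of the cycle. -/
def pos : List Bool → ℤ
  | [] => 0
  | b :: bs => pos bs + if b then 1 else -1

/-- The last multiple of `R` that the lifted walk has visited. -/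
def cen (R : ℕ) : List Bool → ℤ
  | [] => 0
  | b :: bs => if (R : ℤ) ∣ pos (b :: bs) then pos (b :: bs) else cen R bs

/-- The last hop has led to a new multiple of `R`. -/
def Moved (R : ℕ) : List Bool → Prop
  | [] => False
  | b :: bs => (R : ℤ) ∣ pos (b :: bs) ∧ cen R bs ≠ pos (b :: bs)

section lifted
variable {R : ℕ} {b : Bool} {bs : List Bool}

theorem abs_pos_sub_pos (b : Bool) (bs : List Bool) : |pos (b :: bs) - pos bs| = 1 := by
  cases b <;> simp [pos]

theorem dvd_cen (R : ℕ) (bs : List Bool) : (R : ℤ) ∣ cen R bs := by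
  induction bs with
  | nil => simp [cen]
  | cons b bs ih =>
    rw [cen]
    split
    · assumption
    · exact ih

theorem abs_le_of_step (h : |pos bs - cen R bs| < R) : |pos (b :: bs) - cen R bs| ≤ R := by
  have := abs_pos_sub_pos b bs
  have h2 := abs_add_le (pos (b :: bs) - pos bs) (pos bs - cen R bs)
  rw [sub_add_sub_cancel] at h2
  omega

/-- A hop changes the distance by 1 and cannot skip R. At distance exactly R from a multiple of R
the walk is at a multiple of R, and the center moves there. -/
theorem abs_pos_sub_cen_lt (hR : 1 ≤ R) (bs : List Bool) : |pos bs - cen R bs| < R := by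
  induction bs with
  | nil => simp [pos, cen]; omega
  | cons b bs ih =>
    rw [cen]
    split
    · simp; omega
    · rename_i h
      refine lt_of_le_of_ne (abs_le_of_step ih) fun h' => h ?_
      have h1 : (R : ℤ) ∣ pos (b :: bs) - cen R bs := by
        rw [← dvd_abs, h']
      simpa using dvd_add h1 (dvd_cen R bs)

/-- Links divisibility, which is convenient for the nesting of levels and for probabilities, with
the test of distances that `climb` performs. -/
theorem moved_iff (hR : 1 ≤ R) : Moved R (b :: bs) ↔ |pos (b :: bs) - cen R bs| = R := by
  rw [Moved]
  constructor
  · rintro ⟨h1, h2⟩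
    refine le_antisymm (abs_le_of_step (abs_pos_sub_cen_lt hR bs)) ?_
    refine Int.le_of_dvd (abs_pos.2 (sub_ne_zero.2 h2.symm)) ?_
    rw [dvd_abs]
    exact dvd_sub h1 (dvd_cen R bs)
  · intro h
    have h1 : (R : ℤ) ∣ pos (b :: bs) - cen R bs := by rw [← dvd_abs, h]
    refine ⟨by simpa using dvd_add h1 (dvd_cen R bs), fun h' => ?_⟩
    rw [h'] at h
    simp at h
    omega

theorem cen_of_moved (h : Moved R (b :: bs)) : cen R (b :: bs) = pos (b :: bs) := by
  rw [cen, if_pos h.1]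

theorem cen_of_not_moved (h : ¬ Moved R (b :: bs)) : cen R (b :: bs) = cen R bs := by
  rw [cen]
  split
  · rename_i h'
    by_contra hne
    exact h ⟨h', fun h => hne h.symm⟩
  · rfl

/-- Multiples of R' are multiples of R, so none was visited after the last multiple of R. -/
theorem cen_eq_cen_of_dvd {R' : ℕ} (hRR : R ∣ R') (h : (R' : ℤ) ∣ cen R bs) :
    cen R' bs = cen R bs := by
  induction bs with
  | nil => rfl
  | cons b bs ih =>
    rw [cen] at h
    rw [cen, cen]
    split at h
    · rename_i h'
      rw [if_pos h, if_pos h']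
    · rename_i h'
      rw [if_neg h', if_neg fun h => h' ((Int.natCast_dvd_natCast.2 hRR).trans h), ih h]

/-- If level R did not move, its center was already the present position. This is a multiple of R',
so it was the center of level R' as well. -/
theorem Moved.of_dvd {R' : ℕ} (hRR : R ∣ R') {bs : List Bool} (h : Moved R' bs) : Moved R bs := by
  cases bs with
  | nil => exact h
  | cons b bs =>
    refine ⟨(Int.natCast_dvd_natCast.2 hRR).trans h.1, fun h' => h.2 ?_⟩
    rw [cen_eq_cen_of_dvd hRR (h' ▸ h.1), h']

theorem moved_one : Moved 1 (b :: bs) := by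
  have h := abs_pos_sub_cen_lt le_rfl bs
  have h0 : pos bs = cen 1 bs := by
    have := abs_lt.1 h
    push_cast at this
    omega
  rw [moved_iff le_rfl, ← h0, abs_pos_sub_pos]
  rfl

end lifted

/-! ### From the universal cover to nodes and histories -/

/-- The node of the cycle below a point of the universal cover. -/
def below (n : ℕ) (p : ℤ) : ℕ := (p % n).toNat

section below
variable {n : ℕ} {p q : ℤ}

theorem below_lt (hn : 0 < n) (p : ℤ) : below n p < n := by
  have h1 := Int.emod_nonneg p (b := n) (by omega)
  have h2 := Int.emod_lt_of_pos p (b := n) (by omega)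
  unfold below
  omega

theorem cast_below (hn : 0 < n) (p : ℤ) : (below n p : ℤ) = p % n :=
  Int.toNat_of_nonneg (Int.emod_nonneg p (by omega))

theorem dvd_below_sub (hn : 0 < n) (p q : ℤ) :
    (n : ℤ) ∣ below n p - (below n q + (p - q)) := by
  rw [cast_below hn, cast_below hn]
  have h1 := Int.emod_add_mul_ediv p n
  have h2 := Int.emod_add_mul_ediv q n
  exact ⟨q / n - p / n, by rw [mul_sub]; linarith⟩

theorem eq_below {v : ℕ} (hv : v < n) (h : (n : ℤ) ∣ v - p) : v = below n p := by
  have hn : 0 < n := by omega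
  zify
  rw [cast_below hn, ← Int.emod_eq_of_lt (a := v) (b := n) (by omega) (by omega)]
  exact (Int.modEq_iff_dvd.2 h).symm

/-- As 2R ≤ n, the residue e differs from d by 0 or by n (`g` is 0 or 1), and going around the cycle
cannot feign the distance R. -/
theorem atDist_iff {R c v : ℕ} {d : ℤ} (hR : 1 ≤ R) (hRn : 2 * R ≤ n) (hc : c < n)
    (h : (n : ℤ) ∣ v - (c + d)) (hd : |d| ≤ R) : AtDist n R c v ↔ |d| = R := by
  obtain ⟨q, hq⟩ := h
  rw [abs_le] at hd
  unfold AtDist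
  have h1 := Nat.div_add_mod (v + n - c) n
  have h2 := Nat.mod_lt (v + n - c) (y := n) (by omega)
  generalize (v + n - c) % n = e at *
  generalize (v + n - c) / n = f at *
  have h3 : (n : ℤ) * f + e = v + n - c := by
    have : ((v + n - c : ℕ) : ℤ) = v + n - c := by omega
    rw [← this, ← h1]; push_cast; ring
  have h4 : (e : ℤ) = d + n * (q + 1 - f) := by linarith
  generalize q + 1 - (f : ℤ) = g at h4
  have g1 : -1 < g := by
    by_contra hg
    have : (n : ℤ) * g ≤ n * (-1) := mul_le_mul_of_nonneg_left (by omega) (by omega)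
    omega
  have g2 : g < 2 := by
    by_contra hg
    have : (n : ℤ) * 2 ≤ n * g := mul_le_mul_of_nonneg_left (by omega) (by omega)
    omega
  obtain rfl | rfl : g = 0 ∨ g = 1 := by omega
  · rw [abs_eq (by omega)]; omega
  · rw [abs_eq (by omega)]; omega

end below

/-- The history of the walk with the given hops. -/
def hist (n : ℕ) [NeZero n] : List Bool → List (Fin n)
  | [] => [0]
  | b :: bs => (if b then (hist n bs).headD 0 + 1 else (hist n bs).headD 0 - 1) :: hist n bs

section hist
variable {n : ℕ} [NeZero n]

theorem hist_eq_cons (bs : List Bool) : ∃ h, hist n bs = (hist n bs).headD 0 :: h := by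
  cases bs <;> simp [hist]

theorem headD_hist (hn : 2 ≤ n) (bs : List Bool) :
    (((hist n bs).headD 0 : Fin n) : ℕ) = below n (pos bs) := by
  induction bs with
  | nil => simp [hist, pos, below]
  | cons b bs ih =>
    set u := (hist n bs).headD 0 with hu
    have h1 : ((1 : Fin n) : ℕ) = 1 := by rw [Fin.val_one']; exact Nat.mod_eq_of_lt hn
    have h2 : (n : ℤ) ∣ (u : ℕ) - pos bs := by
      rw [ih, cast_below (by omega)]
      exact ⟨-(pos bs / n), by have := Int.emod_add_mul_ediv (pos bs) n; rw [mul_neg]; linarith⟩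
    refine eq_below (Fin.is_lt _) ?_
    have hult := u.is_lt
    cases b with
    | true =>
      have h3 : (((u + 1 : Fin n) : ℕ) : ℤ) = ((u : ℕ) + 1) % n := by
        rw [Fin.val_add, h1]; push_cast; rfl
      have h4 := Int.emod_add_mul_ediv ((u : ℕ) + 1 : ℤ) n
      have h5 := dvd_sub h2 (dvd_mul_right (n : ℤ) (((u : ℕ) + 1 : ℤ) / n))
      simp only [hist, List.headD_cons, if_true, pos]
      rw [← hu, h3]
      rwa [show ((u : ℕ) + 1 : ℤ) % n - (pos bs + 1) =
        (u : ℕ) - pos bs - n * (((u : ℕ) + 1 : ℤ) / n) by linarith]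
    | false =>
      have h3 : (((u - 1 : Fin n) : ℕ) : ℤ) = ((n - 1 : ℤ) + (u : ℕ)) % n := by
        rw [Fin.sub_def, h1]; push_cast [Nat.cast_sub (show 1 ≤ n by omega)]; rfl
      have h4 := Int.emod_add_mul_ediv ((n - 1 : ℤ) + (u : ℕ)) n
      have h5 := dvd_sub h2 (dvd_mul_right (n : ℤ) (((n - 1 : ℤ) + (u : ℕ)) / n - 1))
      simp only [hist, List.headD_cons, pos]
      simp only [Bool.false_eq_true, if_false]
      rw [← hu, h3]
      rwa [show ((n - 1 : ℤ) + (u : ℕ)) % n - (pos bs + -1) =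
        (u : ℕ) - pos bs - n * (((n - 1 : ℤ) + (u : ℕ)) / n - 1) by rw [mul_sub]; linarith]

end hist

/-! ### The data structure along the walk -/

namespace EventCycle

variable {n : ℕ}

/-- The ranks of the items that are active after the history `h`. -/
def ActiveRank (G : EventCycle n) (h : List (Fin n)) (r : ℕ) : Prop :=
  ∃ w : Fin n, G.rank w = r ∧ G.item w ∈ G.active h

theorem rank_eq_iff (G : EventCycle n) (a b : Fin n) :
    G.rank a = G.rank b ↔ G.item a = G.item b := by
  rw [le_antisymm_iff, le_antisymm_iff, G.rank_le_iff a.2 b.2, G.rank_le_iff b.2 a.2]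

theorem activeRank_rank (G : EventCycle n) (h : List (Fin n)) (w : Fin n) :
    G.ActiveRank h (G.rank w) ↔ G.item w ∈ G.active h :=
  ⟨fun ⟨u, hu, h'⟩ => by rwa [← (G.rank_eq_iff u w).1 hu], fun h' => ⟨w, rfl, h'⟩⟩

/-- Guarantees that the active ranks lose no information about the active set. -/
theorem mem_range_of_mem_active (G : EventCycle n) (h : List (Fin n)) :
    ∀ x ∈ G.active h, ∃ w, G.item w = x := by
  induction h with
  | nil => simp [active]
  | cons v h ih =>
    cases h with
    | nil => simp [active]
    | cons u h =>
      intro x hx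
      rw [active] at hx
      cases hq : G.req v <;> rw [hq] at hx
      · rcases hx with hx | hx
        · exact ih x hx
        · exact ⟨v, hx.symm⟩
      · exact ih x hx.1
      · exact ih x hx

theorem activeRank_cons (G : EventCycle n) (v u : Fin n) (h : List (Fin n)) :
    G.ActiveRank (v :: u :: h) = (G.req v).update (G.ActiveRank (u :: h)) (G.rank v) := by
  funext r
  apply propext
  constructor
  · rintro ⟨w, rfl, hw⟩
    rw [active] at hw
    cases hq : G.req v <;> rw [hq] at hw <;>
      simp only [Request.update, activeRank_rank, G.rank_eq_iff w v, ne_eq]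
    · exact hw
    · exact hw
    · exact hw
  · intro hr
    have hr' : ∃ w : Fin n, G.rank w = r := by
      cases hq : G.req v <;> rw [hq] at hr
      · rcases hr with ⟨w, hw, -⟩ | hr
        · exact ⟨w, hw⟩
        · exact ⟨v, hr.symm⟩
      · exact ⟨hr.1.choose, hr.1.choose_spec.1⟩
      · exact ⟨hr.choose, hr.choose_spec.1⟩
    obtain ⟨w, rfl⟩ := hr'
    rw [activeRank_rank, active]
    cases hq : G.req v <;> rw [hq] at hr <;>
      simp only [Request.update, activeRank_rank, G.rank_eq_iff w v, ne_eq] at hr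
    · exact hr
    · exact hr
    · exact hr

/-- Ranks embed the order of the items, all ranks are below n, and `nd n = n` turns the default
value of `nxt` into the code for infinity. -/
theorem isSucc_of_rank (G : EventCycle n) {h : List (Fin n)} {v : Fin n} {nd : ℕ → ℕ}
    (hnd : ∀ w < n, nd (G.rank w) < n ∧ G.rank (nd (G.rank w)) = G.rank w) (hn : nd n = n) :
    G.IsSucc (G.active h) (G.item v) (nd (nxt (G.ActiveRank h) n (G.rank v))) := by
  set X := nxt (G.ActiveRank h) n (G.rank v) with hX
  obtain ⟨h1, h2⟩ := nxt_mem (G.ActiveRank h) n (G.rank v)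
  rw [← hX] at h1 h2
  have key : ∀ u : Fin n, G.item u ∈ G.active h → G.item v ≤ G.item u → X ≤ G.rank u :=
    fun u hu hvu => nxt_le ((G.rank_le_iff v.2 u.2).2 hvu) (.inl ((G.activeRank_rank h u).2 hu))
  rcases h2 with ⟨w, hw, h2⟩ | h2
  · left
    obtain ⟨h3, h4⟩ := hnd w w.2
    rw [hw] at h3 h4
    have h5 : G.item ⟨nd X, h3⟩ = G.item w := (G.rank_eq_iff ⟨nd X, h3⟩ w).1 (h4.trans hw.symm)
    refine ⟨h3, ?_⟩
    rw [h5]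
    rw [← hw] at h1
    refine ⟨⟨h2, (G.rank_le_iff v.2 w.2).1 h1⟩, ?_⟩
    rintro y ⟨hy, hvy⟩
    obtain ⟨u, rfl⟩ := G.mem_range_of_mem_active h y hy
    exact (G.rank_le_iff w.2 u.2).1 (hw ▸ key u hy hvy)
  · right
    have h3 : X = n := le_antisymm (nxt_le_self (G.rank_lt v.2).le) h2
    refine ⟨by rw [h3, hn], Set.eq_empty_of_forall_notMem ?_⟩
    rintro y ⟨hy, hvy⟩
    obtain ⟨u, rfl⟩ := G.mem_range_of_mem_active h y hy
    have := key u hy hvy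
    have := G.rank_lt u.2
    omega

end EventCycle

def windowAlgorithm : Algorithm := ⟨setup, serve⟩

section
variable {n : ℕ} [NeZero n] {G : EventCycle n} {S W : ℕ}

/-- The state `s` is that of the data structure after the hops `bs`. -/
structure WalkInv (G : EventCycle n) (T : ℕ) (bs : List Bool) (s : St) : Prop where
  base : Base s n G.rank (G.ActiveRank (hist n bs))
  levels : Levels s n G.rank (G.ActiveRank (hist n bs)) T fun j => below n (cen (64 ^ j) bs)

open Classical in
/-- A bound on the time for serving a request, up to a constant: the sum of the radii of the
levels that have to be rebuilt. -/
noncomputable def work (T : ℕ) (bs : List Bool) : ℕ :=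
  ∑ j ∈ Finset.range T, if Moved (64 ^ j) bs then 64 ^ j else 0

theorem wp_setup_inv (hr : Room n S W) {T : ℕ} (hT : ∀ j, j < T ↔ 2 * 64 ^ j ≤ n) {s : St}
    (h0 : s.reg 0 = n) (ha : ∀ j i, s.arr j i = 0) :
    WP G S W setup (fun k s' => k ≤ 100000 * n ^ 2 ∧ WalkInv G T [] s') 0 s := by
  refine wp_setup hr hT h0 ha fun k' s' hk' hb hL => ⟨by omega, ?_, ?_⟩
  · convert hb using 2
    simp [EventCycle.ActiveRank, hist, EventCycle.active]
  · convert hL using 2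
    · simp [EventCycle.ActiveRank, hist, EventCycle.active]
    · simp [cen, below]

/-- K is the first level that does not move, or T. It is positive because every hop moves level 0.
The cost 3000 * 64^K = 192000 * 64^(K - 1) is charged to the summand K - 1 of `work`. -/
theorem wp_serve_inv (hr : Room n S W) (hn : 2 ≤ n) {T : ℕ} (hT : ∀ j, j < T ↔ 2 * 64 ^ j ≤ n)
    {s : St} {b : Bool} {bs : List Bool} (h : WalkInv G T bs s) {v : Fin n} {h' : List (Fin n)}
    (hv : hist n (b :: bs) = v :: h') :
    WP G S W serve (fun k s' => k ≤ 192000 * work T (b :: bs) ∧ WalkInv G T (b :: bs) s' ∧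
      G.IsSucc (G.active (hist n (b :: bs))) (G.item v) (s'.reg 1)) 0 (s.setReg 0 v) := by
  classical
  have hn0 : 0 < n := by omega
  have hvp : (v : ℕ) = below n (pos (b :: bs)) := by
    rw [← headD_hist hn, hv]; rfl
  obtain ⟨u, h'', hu⟩ : ∃ u h'', hist n bs = u :: h'' := ⟨_, _, (hist_eq_cons bs).choose_spec⟩
  have hact : G.ActiveRank (hist n (b :: bs)) =
      (G.req v).update (G.ActiveRank (hist n bs)) (G.rank v) := by
    rw [hv, hu, ← G.activeRank_cons v u h'']
    congr 1
    have : hist n (b :: bs) = _ :: hist n bs := rfl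
    rw [this, hu] at hv
    simp only [List.cons.injEq] at hv
    rw [← hv.2]
  have hex : ∃ j, j = T ∨ ¬ Moved (64 ^ j) (b :: bs) := ⟨T, .inl rfl⟩
  set K := Nat.find hex with hKdef
  have hKT : K ≤ T := Nat.find_min' hex (.inl rfl)
  have hKm : ∀ j < K, Moved (64 ^ j) (b :: bs) := fun j hj => by
    have := Nat.find_min hex hj
    tauto
  have hKn : ∀ j, K ≤ j → j < T → ¬ Moved (64 ^ j) (b :: bs) := by
    intro j hj hjT hm
    rcases Nat.find_spec hex with h | h
    · omega
    · exact h (hm.of_dvd (pow_dvd_pow _ hj))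
  have hT1 : 1 ≤ T := (hT 0).2 (by omega)
  have hK1 : 1 ≤ K := by
    by_contra h0
    exact hKn 0 (by omega) (by omega) (by simpa using moved_one)
  have hpow : ∀ j : ℕ, 1 ≤ 64 ^ j := fun j => Nat.one_le_pow _ _ (by omega)
  have htop : n < 2 * 64 ^ T := by
    by_contra h
    exact lt_irrefl _ ((hT T).2 (not_lt.1 h))
  have hdv : ∀ j, (n : ℤ) ∣ (v : ℕ) -
      (below n (cen (64 ^ j) bs) + (pos (b :: bs) - cen (64 ^ j) bs)) := fun j => by
    rw [hvp]; exact dvd_below_sub hn0 _ _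
  have hle : ∀ j, |pos (b :: bs) - cen (64 ^ j) bs| ≤ (64 ^ j : ℕ) := fun j =>
    abs_le_of_step (abs_pos_sub_cen_lt (hpow j) bs)
  have hlt : ∀ j, K ≤ j → j < T → |pos (b :: bs) - cen (64 ^ j) bs| < (64 ^ j : ℕ) :=
    fun j hj hjT => lt_of_le_of_ne (hle j) fun h => hKn j hj hjT ((moved_iff (hpow j)).2 h)
  refine wp_serve (rk := G.rank) (act := G.ActiveRank (hist n bs)) (v := v) (T := T) (K := K)
    (c := fun j => below n (cen (64 ^ j) bs)) hr ?_ (by simp) v.2 hT ?_ ?_ hK1 hKT ?_ ?_ ?_ ?_ ?_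
  · have hb := h.base
    exact ⟨by simp [hb.size], by simp [hb.one], hb.rk_lt, hb.rank, hb.node, hb.node_last, hb.active⟩
  · exact ⟨h.levels.level, h.levels.center, h.levels.lt⟩
  · intro r hr
    rw [Fin.eta, ← hact] at hr
    obtain ⟨w, hw, -⟩ := hr
    exact ⟨w, w.2, hw⟩
  · intro j hj
    exact (atDist_iff (hpow j) ((hT j).1 (by omega)) (below_lt hn0 _) (hdv j) (hle j)).2
      ((moved_iff (hpow j)).1 (hKm j hj))
  · intro hK
    rw [atDist_iff (hpow K) ((hT K).1 hK) (below_lt hn0 _) (hdv K) (hle K)]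
    exact (hlt K le_rfl hK).ne
  · intro j hj hjT
    rcases hjT.lt_or_eq with hjT | rfl
    · exact inW_of_dist (hpow j) (below_lt hn0 _) ⟨_, hlt j hj hjT, hdv j⟩
    · exact inW_of_lt hn0 htop
  · intro j hj w hw hin
    -- If K < T, level K has not moved, so v is at distance less than 64^K from its center; if K =
    -- T, the source window is the whole cycle.
    rcases hKT.lt_or_eq with hK | hK
    · have hK64 : 64 ^ K = 64 * 64 ^ j := by rw [← hj, pow_succ, mul_comm]
      have h1 := hlt K le_rfl hK
      have h2 := hdv K
      rw [hK64] at h1 h2 ⊢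
      exact InW.mono (by omega) (hpow j) (below_lt hn0 _) v.2
        ⟨_, by push_cast at h1 ⊢; exact h1, h2⟩ hin
    · rw [hK]; exact inW_of_lt hn0 htop
  · intro k' s' hk' hb' hL' hans
    rw [Fin.eta, ← hact] at hb' hL' hans
    refine ⟨?_, ⟨hb', ?_, ?_, ?_⟩, ?_⟩
    · have h1 : 64 ^ (K - 1) ≤ work T (b :: bs) := by
        unfold work
        refine le_trans ?_ (Finset.single_le_sum (fun _ _ => Nat.zero_le _)
          (Finset.mem_range.2 (show K - 1 < T by omega)))
        rw [if_pos (hKm _ (by omega))]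
      have h2 : 64 ^ K = 64 * 64 ^ (K - 1) := by
        rw [← pow_succ']; congr 1; omega
      omega
    · intro j hj
      have := hL'.level j hj
      by_cases hjK : j < K
      · rw [if_pos hjK] at this
        rwa [cen_of_moved (hKm j hjK), ← hvp]
      · rw [if_neg hjK] at this
        rcases hj.lt_or_eq with hjT | rfl
        · rwa [cen_of_not_moved (hKn j (by omega) hjT)]
        -- `cen` may change at the top level although nothing is rebuilt there, which is harmless as
        -- the window is everything.
        · exact this.congr_center fun w =>
            ⟨fun _ => inW_of_lt hn0 htop, fun _ => inW_of_lt hn0 htop⟩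
    · intro j hj
      rw [hL'.center j hj]
      split
      · rename_i hjK
        rw [cen_of_moved (hKm j hjK), ← hvp]
      · rw [cen_of_not_moved (hKn j (by omega) hj)]
    · exact fun j _ => below_lt hn0 _
    · rw [hans]
      exact G.isSucc_of_rank hb'.node hb'.node_last

theorem Represents.update_zero {m : Mem} {s : St} (h : Represents m s) (v : ℕ) :
    Represents (Function.update m 0 v) (s.setReg 0 v) where
  reg x hx := by
    rw [Function.update_apply, St.setReg_reg, h.reg x hx]
  arr j i hj := by
    rw [Function.update_of_ne (by omega), h.arr j i hj]; rfl

theorem exists_run (hr : Room n S W) (hn : 2 ≤ n) {T : ℕ} (hT : ∀ j, j < T ↔ 2 * 64 ^ j ≤ n)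
    (bs : List Bool) : ∃ τ m s, Run windowAlgorithm G S W (hist n bs) τ m ∧ Represents m s ∧
      WalkInv G T bs s ∧ (bs = [] → τ ≤ 100000 * n ^ 2) ∧ (bs ≠ [] → τ ≤ 192000 * work T bs ∧
        ∀ v h, hist n bs = v :: h → G.IsSucc (G.active (hist n bs)) (G.item v) (m 1)) := by
  induction bs with
  | nil =>
    obtain ⟨τ, m, s, h1, h2, h3, h4⟩ := wp_setup_inv (G := G) hr hT
      (s := ⟨Function.update (fun _ => 0) 0 n, fun _ _ => 0⟩) (by simp) (by simp)
      (Function.update (fun _ => 0) 0 n)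
      ⟨fun _ _ => rfl, fun j i _ => Function.update_of_ne (by omega) _ _⟩
    exact ⟨τ, m, s, .setup h1, h2, h4, fun _ => by omega, fun h => absurd rfl h⟩
  | cons b bs ih =>
    obtain ⟨τ, m, s, h1, h2, h3, -⟩ := ih
    obtain ⟨u, h'', hu⟩ : ∃ u h'', hist n bs = u :: h'' := ⟨_, _, (hist_eq_cons bs).choose_spec⟩
    obtain ⟨v, hv⟩ : ∃ v, hist n (b :: bs) = v :: hist n bs := ⟨_, rfl⟩
    obtain ⟨τ', m', s', e1, e2, e3, e4, e5⟩ :=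
      wp_serve_inv hr hn hT h3 hv _ (h2.update_zero v)
    refine ⟨τ', m', s', ?_, e2, e4, by simp, fun _ => ⟨by omega, ?_⟩⟩
    · rw [hv]
      rw [hu] at h1 ⊢
      exact .serve h1 e1
    · intro v' h' hv'
      rw [hv] at hv'
      simp only [List.cons.injEq] at hv'
      rw [← hv'.1, e2.reg 1 (by omega)]
      exact e5

end

/-- Makes time and memory functions of the history, although they are constructed from the list of
hops. -/
theorem Run.unique {n : ℕ} {G : EventCycle n} {S W : ℕ} {A : Algorithm} {h : List (Fin n)} {τ₁ τ₂ : ℕ} {m₁ m₂ : Mem}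
    (h₁ : Run A G S W h τ₁ m₁) (h₂ : Run A G S W h τ₂ m₂) : τ₁ = τ₂ ∧ m₁ = m₂ := by
  induction h₁ generalizing τ₂ m₂ with
  | setup e => cases h₂ with | setup e' => exact e.unique e'
  | serve _ e ih =>
    cases h₂ with
    | serve r' e' =>
      obtain ⟨-, rfl⟩ := ih r'
      exact e.unique e'

/-! ### Averages over the hops of the walk -/

/-- The average of `f` over all lists of `t` bits. -/
noncomputable def avg : ℕ → (List Bool → ℝ) → ℝ
  | 0, f => f []
  | t + 1, f => (avg t (fun l => f (true :: l)) + avg t (fun l => f (false :: l))) / 2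

open Classical in
/-- The probability that a list of `t` random bits satisfies `p`. -/
noncomputable def prob (t : ℕ) (p : List Bool → Prop) : ℝ := avg t fun l => if p l then 1 else 0

section avg
variable {t : ℕ} {f g : List Bool → ℝ} {p q : List Bool → Prop}

theorem avg_mono (h : ∀ l, l.length = t → f l ≤ g l) : avg t f ≤ avg t g := by
  induction t generalizing f g with
  | zero => exact h [] rfl
  | succ t ih =>
    have h1 := ih (f := fun l => f (true :: l)) (g := fun l => g (true :: l))
      fun l hl => h _ (by simp [hl])
    have h2 := ih (f := fun l => f (false :: l)) (g := fun l => g (false :: l))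
      fun l hl => h _ (by simp [hl])
    simp only [avg]
    linarith

theorem avg_congr (h : ∀ l, l.length = t → f l = g l) : avg t f = avg t g :=
  le_antisymm (avg_mono fun l hl => (h l hl).le) (avg_mono fun l hl => (h l hl).ge)

theorem avg_const (t : ℕ) (c : ℝ) : avg t (fun _ => c) = c := by
  induction t with
  | zero => rfl
  | succ t ih => simp [avg, ih]

theorem avg_add (t : ℕ) (f g : List Bool → ℝ) :
    avg t (fun l => f l + g l) = avg t f + avg t g := by
  induction t generalizing f g with
  | zero => rfl
  | succ t ih => simp only [avg, ih]; ring

theorem avg_mul (t : ℕ) (c : ℝ) (f : List Bool → ℝ) :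
    avg t (fun l => c * f l) = c * avg t f := by
  induction t generalizing f with
  | zero => rfl
  | succ t ih => simp only [avg, ih]; ring

theorem avg_sum {ι : Type*} (t : ℕ) (s : Finset ι) (F : ι → List Bool → ℝ) :
    avg t (fun l => ∑ i ∈ s, F i l) = ∑ i ∈ s, avg t (F i) := by
  classical
  induction s using Finset.induction_on with
  | empty => simpa using avg_const t 0
  | insert i s hi ih => simp only [Finset.sum_insert hi, avg_add, ih]

/-- For hops, `a` consists of the s most recent ones and `b` of those before them: the two parts are
independent. -/
theorem avg_append (s t : ℕ) (f : List Bool → ℝ) :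
    avg (s + t) f = avg s fun a => avg t fun b => f (a ++ b) := by
  induction s generalizing f with
  | zero => simp [avg]
  | succ s ih =>
    rw [show s + 1 + t = (s + t) + 1 by omega]
    simp only [avg, ih, List.cons_append]

theorem avg_nonneg (h : ∀ l, 0 ≤ f l) : 0 ≤ avg t f := by
  rw [← avg_const t 0]; exact avg_mono fun l _ => h l

theorem prob_mono (h : ∀ l, l.length = t → p l → q l) : prob t p ≤ prob t q := by
  classical
  refine avg_mono fun l hl => ?_
  by_cases hp : p l
  · simp [hp, h l hl hp]
  · simp only [hp, if_false]; split <;> norm_num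

theorem prob_nonneg (t : ℕ) (p : List Bool → Prop) : 0 ≤ prob t p :=
  avg_nonneg fun l => by split <;> norm_num

theorem prob_le_one (t : ℕ) (p : List Bool → Prop) : prob t p ≤ 1 := by
  rw [← avg_const t 1]
  exact avg_mono fun l _ => by split <;> norm_num

theorem prob_exists_le (s : Finset ℕ) (P : ℕ → List Bool → Prop) :
    prob t (fun l => ∃ j ∈ s, P j l) ≤ ∑ j ∈ s, prob t (P j) := by
  classical
  unfold prob
  rw [← avg_sum]
  refine avg_mono fun l _ => ?_
  split
  · rename_i h
    obtain ⟨j, hj, hP⟩ := h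
    refine le_trans ?_ (Finset.single_le_sum (fun i _ => ?_) hj)
    · simp [hP]
    · split <;> norm_num
  · exact Finset.sum_nonneg fun i _ => by split <;> norm_num

theorem prob_or_le (t : ℕ) (p q : List Bool → Prop) :
    prob t (fun l => p l ∨ q l) ≤ prob t p + prob t q := by
  classical
  unfold prob
  rw [← avg_add]
  refine avg_mono fun l _ => ?_
  by_cases hp : p l <;> by_cases hq : q l <;> simp [hp, hq]

/-- If `p` depends on the first `s` bits only, and `q` has, whatever these bits are, probability
at most `c`, then both together have probability at most `c` times that of `p`. -/
theorem prob_append_le {s : ℕ} {c : ℝ} {q : List Bool → List Bool → Prop}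
    (hc : ∀ a, prob t (q a) ≤ c) {r : List Bool → Prop}
    (h : ∀ a b, a.length = s → b.length = t → r (a ++ b) → p a ∧ q a b) :
    prob (s + t) r ≤ prob s p * c := by
  classical
  unfold prob at *
  rw [avg_append, mul_comm, ← avg_mul]
  refine avg_mono fun a ha => ?_
  by_cases hp : p a
  · simp only [hp, if_true, mul_one]
    refine le_trans (avg_mono fun b hb => ?_) (hc a)
    by_cases hr : r (a ++ b)
    · simp [hr, (h a b ha hb hr).2]
    · simp only [hr, if_false]; split <;> norm_num
  · simp only [hp, if_false, mul_zero]
    refine (avg_mono (g := fun _ => 0) fun b hb => ?_).trans_eq (avg_const t 0)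
    rw [if_neg fun hr => hp (h a b ha hb hr).1]

end avg

theorem pos_append (a b : List Bool) : pos (a ++ b) = pos a + pos b := by
  induction a with
  | nil => simp [pos]
  | cons x a ih => rw [List.cons_append, pos, pos, ih]; ring

theorem abs_pos_le (l : List Bool) : |pos l| ≤ l.length := by
  induction l with
  | nil => simp [pos]
  | cons b l ih =>
    have h1 := abs_pos_sub_pos b l
    have h2 := abs_add_le (pos (b :: l) - pos l) (pos l)
    rw [sub_add_cancel] at h2
    push_cast [List.length_cons]
    omega

theorem pos_eq_count (l : List Bool) : pos l = 2 * (l.count true : ℤ) - l.length := by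
  induction l with
  | nil => simp [pos]
  | cons b l ih => cases b <;> simp [pos, ih] <;> ring

/-! ### Point probabilities -/

theorem prob_succ (t : ℕ) (p : List Bool → Prop) : prob (t + 1) p =
    (prob t (fun l => p (true :: l)) + prob t (fun l => p (false :: l))) / 2 := rfl

theorem prob_count (t k : ℕ) :
    prob t (fun l => l.count true = k) = (t.choose k : ℝ) / 2 ^ t := by
  induction t generalizing k with
  | zero => cases k <;> simp [prob, avg]
  | succ t ih =>
    have h1 : ∀ l : List Bool, (true :: l).count true = l.count true + 1 := by simp
    have h2 : ∀ l : List Bool, (false :: l).count true = l.count true := by simp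
    rw [prob_succ]
    simp only [h1, h2, ih k]
    cases k with
    | zero =>
      have : prob t (fun l : List Bool => l.count true + 1 = 0) = 0 := by
        simpa [prob] using avg_const t 0
      rw [this]
      simp [pow_succ]
      field_simp
    | succ k =>
      simp only [Nat.add_right_cancel_iff, ih k, Nat.choose_succ_succ, pow_succ]
      push_cast
      field_simp

/-- Consecutive central binomial coefficients have the quotient 2(2m + 1)/(m + 1); the step amounts
to (2m + 1)(2m + 3) ≤ 4(m + 1)^2. -/
theorem centralBinom_sq_le (m : ℕ) : (m.centralBinom : ℝ) ^ 2 * (2 * m + 1) ≤ (4 ^ m) ^ 2 := by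
  induction m with
  | zero => simp
  | succ m ih =>
    have h : ((m : ℝ) + 1) * (m + 1).centralBinom = 2 * (2 * m + 1) * m.centralBinom := by
      exact_mod_cast Nat.succ_mul_centralBinom_succ m
    have h1 : (0 : ℝ) < (m : ℝ) + 1 := by positivity
    have h2 : ((m + 1).centralBinom : ℝ) = 2 * (2 * m + 1) * m.centralBinom / (m + 1) := by
      field_simp; linarith
    rw [h2, pow_succ (4 : ℝ)]
    push_cast
    rw [div_pow, div_mul_eq_mul_div, div_le_iff₀ (by positivity)]
    have h3 : (2 * (m : ℝ) + 1) * (2 * (m + 1) + 1) ≤ 4 * (m + 1) ^ 2 := by nlinarith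
    have h4 : (0 : ℝ) ≤ (m.centralBinom : ℝ) ^ 2 * (2 * m + 1) := by positivity
    nlinarith [mul_le_mul ih h3 (by positivity) (by positivity)]

/-- The matching lower bound; here the step amounts to 4m(m + 1) ≤ (2m + 1)^2. -/
theorem le_centralBinom_sq {m : ℕ} (hm : 1 ≤ m) :
    (4 ^ m) ^ 2 ≤ (m.centralBinom : ℝ) ^ 2 * (4 * m) := by
  induction m, hm using Nat.le_induction with
  | base => simp [Nat.centralBinom, Nat.choose]; norm_num
  | succ m hm ih =>
    have h : ((m : ℝ) + 1) * (m + 1).centralBinom = 2 * (2 * m + 1) * m.centralBinom := by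
      exact_mod_cast Nat.succ_mul_centralBinom_succ m
    have h1 : (0 : ℝ) < (m : ℝ) + 1 := by positivity
    have h2 : ((m + 1).centralBinom : ℝ) = 2 * (2 * m + 1) * m.centralBinom / (m + 1) := by
      field_simp; linarith
    rw [h2, pow_succ (4 : ℝ)]
    push_cast
    rw [div_pow, div_mul_eq_mul_div, le_div_iff₀ (by positivity)]
    have h4 : (0 : ℝ) ≤ (m.centralBinom : ℝ) ^ 2 := by positivity
    have h5 : ((4 : ℝ) ^ m * 4) ^ 2 * (m + 1) ^ 2 ≤
        (m.centralBinom : ℝ) ^ 2 * (4 * m) * 16 * (m + 1) ^ 2 := by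
      have : ((4 : ℝ) ^ m * 4) ^ 2 = (4 ^ m) ^ 2 * 16 := by ring
      rw [this]
      gcongr
    refine h5.trans ?_
    have h6 : 4 * (m : ℝ) * 16 * (m + 1) ^ 2 ≤ (2 * (2 * m + 1)) ^ 2 * (4 * (m + 1)) := by
      nlinarith
    nlinarith [mul_le_mul_of_nonneg_left h6 h4]

/-- A position determines the number of upward hops, and no binomial coefficient exceeds the central
one. The number y replaces a square root. -/
theorem prob_pos_eq_le {m : ℕ} {y : ℝ} (hy : 0 < y) (hym : y ^ 2 ≤ 2 * m + 1) (x : ℤ) :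
    prob (2 * m) (fun l => pos l = x) ≤ 1 / y := by
  calc prob (2 * m) (fun l => pos l = x)
      ≤ prob (2 * m) (fun l => l.count true = ((x + 2 * m) / 2).toNat) := by
        refine prob_mono fun l hl h => ?_
        rw [pos_eq_count, hl] at h
        push_cast at h
        omega
    _ = ((2 * m).choose (((x + 2 * m) / 2).toNat) : ℝ) / 2 ^ (2 * m) := prob_count _ _
    _ ≤ (m.centralBinom : ℝ) / 4 ^ m := by
        rw [pow_mul]
        norm_num only
        gcongr
        exact_mod_cast Nat.choose_le_centralBinom _ _
    _ ≤ 1 / y := by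
        rw [div_le_div_iff₀ (by positivity) hy, one_mul]
        refine le_of_sq_le_sq ?_ (by positivity)
        refine le_trans ?_ (centralBinom_sq_le m)
        rw [mul_pow]
        gcongr

theorem le_prob_pos_eq_zero {m : ℕ} (hm : 1 ≤ m) {y : ℝ} (hy : 0 < y) (hym : m ≤ y ^ 2) :
    1 / (2 * y) ≤ prob (2 * m) (fun l => pos l = 0) := by
  calc 1 / (2 * y) ≤ (m.centralBinom : ℝ) / 4 ^ m := by
        rw [div_le_div_iff₀ (by positivity) (by positivity), one_mul]
        refine le_of_sq_le_sq ?_ (by positivity)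
        refine (le_centralBinom_sq hm).trans ?_
        rw [mul_pow, mul_pow]
        norm_num only
        gcongr
    _ = prob (2 * m) (fun l => l.count true = m) := by
        rw [prob_count, pow_mul, Nat.centralBinom]; norm_num
    _ ≤ prob (2 * m) (fun l => pos l = 0) := by
        refine prob_mono fun l hl h => ?_
        rw [pos_eq_count, hl, h]; push_cast; ring

/-! ### Tails -/

theorem avg_exp (t : ℕ) (x : ℝ) : avg t (fun l => Real.exp (x * pos l)) = Real.cosh x ^ t := by
  induction t with
  | zero => simp [avg, pos]
  | succ t ih =>
    have h : ∀ l : List Bool, Real.exp (x * pos (true :: l)) = Real.exp x * Real.exp (x * pos l) := by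
      intro l; rw [← Real.exp_add]; congr 1; simp [pos]; ring
    have h' : ∀ l : List Bool,
        Real.exp (x * pos (false :: l)) = Real.exp (-x) * Real.exp (x * pos l) := by
      intro l; rw [← Real.exp_add]; congr 1; simp [pos]; ring
    simp only [avg, h, h', avg_mul, ih, pow_succ]
    rw [Real.cosh_eq]; ring

/-- Chernoff bound for both signs, from cosh x ≤ exp(x^2 / 2). The upper bound t for s lets one
estimate serve all earlier times. -/
theorem prob_le_abs_pos {s t : ℕ} (hst : s ≤ t) (a : ℝ) {x : ℝ} (hx : 0 ≤ x) :
    prob s (fun l => a ≤ |(pos l : ℝ)|) ≤ 2 * Real.exp (x ^ 2 / 2 * t - x * a) := by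
  have h1 : Real.cosh x ^ s ≤ Real.exp (x ^ 2 / 2 * t) := by
    calc Real.cosh x ^ s ≤ Real.exp (x ^ 2 / 2) ^ s :=
          pow_le_pow_left₀ (Real.cosh_pos x).le (Real.cosh_le_exp_half_sq x) s
      _ = Real.exp (x ^ 2 / 2 * s) := by rw [← Real.exp_nat_mul, mul_comm]
      _ ≤ _ := by gcongr
  calc prob s (fun l => a ≤ |(pos l : ℝ)|)
      ≤ avg s (fun l => Real.exp (-(x * a)) * (Real.exp (x * pos l) + Real.exp (-x * pos l))) := by
        refine avg_mono fun l _ => ?_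
        split
        · rename_i h
          have h2 : 1 ≤ Real.exp (-(x * a)) * Real.exp (x * |(pos l : ℝ)|) := by
            rw [← Real.exp_add, Real.one_le_exp_iff]
            nlinarith
          refine h2.trans ?_
          gcongr
          rcases abs_choice (pos l : ℝ) with e | e <;> rw [e]
          · linarith [Real.exp_pos (-x * (pos l : ℝ))]
          · rw [mul_neg, ← neg_mul]; linarith [Real.exp_pos (x * (pos l : ℝ))]
        · positivity
    _ = Real.exp (-(x * a)) * (2 * Real.cosh x ^ s) := by
        rw [avg_mul, avg_add, avg_exp, avg_exp, Real.cosh_neg]; ring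
    _ ≤ Real.exp (-(x * a)) * (2 * Real.exp (x ^ 2 / 2 * t)) := by gcongr
    _ = _ := by rw [sub_eq_add_neg, Real.exp_add]; ring

/-! ### Excursions -/

/-- No nonempty initial segment of `l` has sum zero. -/
def NoReturn (l : List Bool) : Prop := ∀ j, 0 < j → j ≤ l.length → pos (l.take j) ≠ 0

theorem NoReturn.of_append {a b : List Bool} (h : NoReturn (a ++ b)) : NoReturn a := by
  intro j hj hja
  have := h j hj (by simp; omega)
  rwa [List.take_append_of_le_length hja] at this

theorem prob_noReturn_antitone {s t : ℕ} (h : s ≤ t) : prob t NoReturn ≤ prob s NoReturn := by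
  obtain ⟨d, rfl⟩ := Nat.exists_eq_add_of_le h
  rw [← mul_one (prob s NoReturn)]
  exact prob_append_le (q := fun _ _ => True) (fun _ => prob_le_one _ _)
    fun a b _ _ h => ⟨h.of_append, trivial⟩

/-- Last-return decomposition: j is the length of the longest initial segment with sum zero, so the
events for different j are disjoint; the two parts of the list are independent. -/
theorem sum_return_noReturn_le (m : ℕ) :
    ∑ j ∈ Finset.range (m + 1), prob j (fun l => pos l = 0) * prob (m - j) NoReturn ≤ 1 := by
  classical
  have h1 : ∀ j ∈ Finset.range (m + 1), prob j (fun l => pos l = 0) * prob (m - j) NoReturn =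
      avg m fun l => if pos (l.take j) = 0 ∧ NoReturn (l.drop j) then (1 : ℝ) else 0 := by
    intro j hj
    rw [Finset.mem_range] at hj
    conv_rhs => rw [show m = j + (m - j) by omega, avg_append]
    unfold prob
    rw [mul_comm, ← avg_mul]
    refine avg_congr fun a ha => ?_
    rw [mul_comm, ← avg_mul]
    refine avg_congr fun b _ => ?_
    rw [← ha, List.take_left, List.drop_left]
    split <;> rename_i h1 <;> split <;> rename_i h2 <;> simp [h1, h2]
  rw [Finset.sum_congr rfl h1, ← avg_sum]
  refine (avg_mono (g := fun _ => 1) fun l hl => ?_).trans_eq (avg_const m 1)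
  rw [Finset.sum_boole]
  norm_cast
  rw [Finset.card_le_one]
  have key : ∀ i j, i < j → j ≤ m → pos (l.take i) = 0 → NoReturn (l.drop i) →
      pos (l.take j) ≠ 0 := by
    intro i j hij hj hi hn h0
    refine hn (j - i) (by omega) (by simp; omega) ?_
    have h2 : l.take j = l.take i ++ (l.drop i).take (j - i) := by
      rw [← List.take_add]; congr 1; omega
    rw [h2, pos_append, hi, zero_add] at h0
    exact h0
  intro i hi j hj
  simp only [Finset.mem_filter, Finset.mem_range] at hi hj
  rcases lt_trichotomy i j with h | h | h
  · exact absurd hj.2.1 (key i j h (by omega) hi.2.1 hi.2.2)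
  · exact h
  · exact absurd hi.2.1 (key j i h (by omega) hj.2.1 hj.2.2)

/-- Only the terms j = 2i with 1 ≤ i ≤ q of the decomposition are kept. Each is at least 1/(2y)
times the probability in question, since shorter lists avoid zero more easily. -/
theorem prob_noReturn_le {q : ℕ} (hq : 1 ≤ q) {y : ℝ} (hy : 0 < y) (hqy : q ≤ y ^ 2) :
    prob (2 * q) NoReturn ≤ 2 * y / q := by
  have h1 : (q : ℝ) * (1 / (2 * y) * prob (2 * q) NoReturn) ≤ 1 := by
    refine le_trans ?_ (sum_return_noReturn_le (2 * q))
    have h2 : (q : ℝ) * (1 / (2 * y) * prob (2 * q) NoReturn) =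
        ∑ _i ∈ Finset.Icc 1 q, 1 / (2 * y) * prob (2 * q) NoReturn := by simp
    have h3 : ∑ j ∈ (Finset.Icc 1 q).image (fun i => 2 * i),
        prob j (fun l => pos l = 0) * prob (2 * q - j) NoReturn =
        ∑ i ∈ Finset.Icc 1 q, prob (2 * i) (fun l => pos l = 0) * prob (2 * q - 2 * i) NoReturn :=
      Finset.sum_image fun a _ b _ h => by simpa using h
    rw [h2]
    refine le_trans ?_ (Finset.sum_le_sum_of_subset_of_nonneg
      (s := (Finset.Icc 1 q).image (fun i => 2 * i)) ?_ ?_)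
    · rw [h3]
      refine Finset.sum_le_sum fun i hi => ?_
      rw [Finset.mem_Icc] at hi
      refine mul_le_mul (le_prob_pos_eq_zero hi.1 hy (le_trans ?_ hqy))
        (prob_noReturn_antitone (Nat.sub_le _ _)) (prob_nonneg _ _) (prob_nonneg _ _)
      exact_mod_cast hi.2
    · intro j hj
      simp only [Finset.mem_image, Finset.mem_Icc] at hj
      obtain ⟨i, hi, rfl⟩ := hj
      rw [Finset.mem_range]; omega
    · exact fun _ _ _ => mul_nonneg (prob_nonneg _ _) (prob_nonneg _ _)
  have hq' : (0 : ℝ) < q := by exact_mod_cast hq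
  rw [le_div_iff₀ hq']
  have : (q : ℝ) * (1 / (2 * y) * prob (2 * q) NoReturn) =
      prob (2 * q) NoReturn * q / (2 * y) := by ring
  rw [this, div_le_one (by positivity)] at h1
  exact h1

/-! ### The probability of moving a center -/

theorem exists_cen_eq (R : ℕ) (l : List Bool) : ∃ j ≤ l.length, cen R l = pos (l.drop j) := by
  induction l with
  | nil => exact ⟨0, le_rfl, rfl⟩
  | cons b l ih =>
    rw [cen]
    split
    · exact ⟨0, Nat.zero_le _, rfl⟩
    · obtain ⟨j, hj, h⟩ := ih
      exact ⟨j + 1, by simpa using hj, by simpa using h⟩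

/-- Starting at a multiple of R, fewer than R hops reach no other multiple of R. -/
theorem cen_append {R : ℕ} {a b : List Bool} (hb : (R : ℤ) ∣ pos b) (ha : a.length < R) :
    cen R (a ++ b) = pos b := by
  induction a with
  | nil =>
    rw [List.nil_append]
    cases b with
    | nil => rfl
    | cons x b => rw [cen, if_pos hb]
  | cons x a ih =>
    rw [List.cons_append, cen]
    split
    · rename_i h
      rw [← List.cons_append, pos_append] at h ⊢
      have h1 := abs_pos_le (x :: a)
      have h2 := Int.eq_zero_of_abs_lt_dvd ((dvd_add_left hb).1 h) (by omega)
      rw [h2, zero_add]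
    · exact ih (by simp at ha; omega)

/-- If the last j hops cancelled, the walk would have been at its present position, a multiple of R,
j ≤ R hops ago. This would still be the center, and the last hop would not move it. -/
theorem Moved.noReturn {R : ℕ} {a b : List Bool} (h : Moved R (a ++ b)) (ha : a.length ≤ R) :
    NoReturn a := by
  intro j hj hja h0
  -- The relevant center is the one before the last hop x. Only j - 1 < R hops precede x in the
  -- segment, so `a.length ≤ R` is enough.
  obtain ⟨x, c, hc⟩ : ∃ x c, a.take j = x :: c :=
    List.exists_cons_of_length_pos (by simp; omega)
  have hlen : c.length + 1 = j := by
    have := congrArg List.length hc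
    simp at this; omega
  have hab : a ++ b = x :: (c ++ (a.drop j ++ b)) := by
    rw [← List.cons_append, ← hc, ← List.append_assoc, List.take_append_drop]
  have hp : pos (a ++ b) = pos (a.drop j ++ b) := by
    rw [hab, ← List.cons_append, pos_append, ← hc, h0, zero_add]
  have h1 := h
  rw [hab] at h1
  obtain ⟨h2, h3⟩ := h1
  rw [← hab, hp] at h2 h3
  exact h3 (cen_append h2 (by omega))

theorem Moved.dvd {R : ℕ} {l : List Bool} (h : Moved R l) : (R : ℤ) ∣ pos l := by
  cases l with
  | nil => exact h.elim
  | cons b l => exact h.1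

/-- Either the present position is a nonzero multiple of R, or it is 0 and the previous center, also
visited, is a nonzero multiple. -/
theorem Moved.exists_far {R : ℕ} {l : List Bool} (h : Moved R l) :
    ∃ j ≤ l.length, (R : ℝ) ≤ |(pos (l.drop j) : ℝ)| := by
  have key : ∀ p : ℤ, (R : ℤ) ∣ p → p ≠ 0 → (R : ℝ) ≤ |(p : ℝ)| := by
    intro p h1 h2
    have := Int.le_of_dvd (abs_pos.2 h2) ((dvd_abs _ _).2 h1)
    exact_mod_cast this
  cases l with
  | nil => exact h.elim
  | cons b l =>
    by_cases h0 : pos (b :: l) = 0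
    · obtain ⟨j, hj, hc⟩ := exists_cen_eq R l
      refine ⟨j + 1, by simpa using hj, ?_⟩
      rw [List.drop_succ_cons, ← hc]
      exact key _ (dvd_cen R l) fun h' => h.2 (h'.trans h0.symm)
    · exact ⟨0, Nat.zero_le _, key _ h.1 h0⟩

/-- The additional hops only shift the starting point x, in which the bound is uniform. -/
theorem prob_dvd_antitone {R s t : ℕ} {c : ℝ} (h : s ≤ t)
    (hc : ∀ x : ℤ, prob s (fun l => (R : ℤ) ∣ x + pos l) ≤ c) (x : ℤ) :
    prob t (fun l => (R : ℤ) ∣ x + pos l) ≤ c := by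
  obtain ⟨d, rfl⟩ := Nat.exists_eq_add_of_le' h
  have h1 := prob_append_le (s := d) (t := s) (p := fun _ => True)
    (q := fun a b => (R : ℤ) ∣ (x + pos a) + pos b) (fun a => hc (x + pos a))
    (r := fun l => (R : ℤ) ∣ x + pos l) fun a b _ _ h => ⟨trivial, by rwa [pos_append, ← add_assoc] at h⟩
  have h2 : 0 ≤ c := (prob_nonneg _ _).trans (hc 0)
  nlinarith [prob_le_one d fun _ => True]

theorem prob_drop (s t : ℕ) (p : List Bool → Prop) :
    prob (s + t) (fun l => p (l.drop s)) ≤ prob t p := by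
  have := prob_append_le (s := s) (t := t) (p := fun _ => True) (q := fun _ b => p b)
    (fun _ => le_rfl) (r := fun l => p (l.drop s)) fun a b ha _ h =>
      ⟨trivial, by rwa [← ha, List.drop_left] at h⟩
  nlinarith [prob_le_one s fun _ => True, prob_nonneg t p]

theorem exp_neg_le {x : ℝ} (hx : 0 < x) : Real.exp (-x) ≤ 24 / x ^ 4 := by
  have h := Real.pow_div_factorial_le_exp x hx.le 4
  rw [Real.exp_neg, ← one_div, div_le_div_iff₀ (Real.exp_pos x) (by positivity)]
  norm_num [Nat.factorial] at h
  linarith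

theorem exp_neg_le_one_div {x : ℝ} (hx : 0 < x) : Real.exp (-x) ≤ 1 / x := by
  rw [Real.exp_neg, ← one_div]
  exact one_div_le_one_div_of_le hx (by linarith [Real.add_one_le_exp x])

section
variable {r : ℕ}

/-- The walk of r^8 hops has standard deviation r^4, far below R = r^6. At distance less than R/2
from 0 at most one position lies in the required residue class, and it has probability at most r^-4;
larger distances are rare. -/
theorem prob_dvd_le (hr : 2 ≤ r) (hr2 : 2 ∣ r) (x : ℤ) :
    prob (r ^ 8) (fun l => ((r ^ 6 : ℕ) : ℤ) ∣ x + pos l) ≤ 17 / (r : ℝ) ^ 4 := by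
  have hr0 : (0 : ℝ) < r := by positivity
  obtain ⟨m, hm⟩ : 2 ∣ r ^ 8 := dvd_pow hr2 (by norm_num)
  have hm' : (r : ℝ) ^ 8 = 2 * m := by exact_mod_cast hm
  obtain ⟨y, hy⟩ : ∃ y : ℤ, ∀ p : ℤ, 2 * |p| < (r ^ 6 : ℕ) → ((r ^ 6 : ℕ) : ℤ) ∣ x + p → p = y := by
    by_cases h : ∃ y : ℤ, 2 * |y| < (r ^ 6 : ℕ) ∧ ((r ^ 6 : ℕ) : ℤ) ∣ x + y
    · obtain ⟨y, hy1, hy2⟩ := h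
      refine ⟨y, fun p hp1 hp2 => ?_⟩
      have h1 := dvd_sub hp2 hy2
      rw [add_sub_add_left_eq_sub] at h1
      have h2 := abs_sub p y
      exact sub_eq_zero.1 (Int.eq_zero_of_abs_lt_dvd h1 (by omega))
    · exact ⟨0, fun p hp1 hp2 => absurd ⟨p, hp1, hp2⟩ h⟩
  have h1 : prob (r ^ 8) (fun l => (r : ℝ) ^ 6 / 2 ≤ |(pos l : ℝ)|) ≤ 16 / (r : ℝ) ^ 4 := by
    -- This x gives the exponent r^4/8 - r^4/4 = -r^4/8.
    refine (prob_le_abs_pos le_rfl _ (x := 1 / (2 * (r : ℝ) ^ 2)) (by positivity)).trans ?_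
    have h2 := exp_neg_le_one_div (x := (r : ℝ) ^ 4 / 8) (by positivity)
    have h3 : (1 / (2 * (r : ℝ) ^ 2)) ^ 2 / 2 * ((r ^ 8 : ℕ) : ℝ) -
        1 / (2 * (r : ℝ) ^ 2) * ((r : ℝ) ^ 6 / 2) = -((r : ℝ) ^ 4 / 8) := by
      push_cast; field_simp; ring
    rw [h3]
    calc 2 * Real.exp (-((r : ℝ) ^ 4 / 8)) ≤ 2 * (1 / ((r : ℝ) ^ 4 / 8)) := by gcongr
      _ = _ := by field_simp; norm_num
  have h2 : prob (r ^ 8) (fun l => pos l = y) ≤ 1 / (r : ℝ) ^ 4 := by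
    rw [hm]
    exact prob_pos_eq_le (by positivity) (by rw [← pow_mul, hm']; linarith) y
  calc _ ≤ prob (r ^ 8) (fun l => (r : ℝ) ^ 6 / 2 ≤ |(pos l : ℝ)| ∨ pos l = y) := by
        refine prob_mono fun l _ h => or_iff_not_imp_left.2 fun hl => hy _ ?_ h
        rw [not_le, lt_div_iff₀ two_pos, mul_comm] at hl
        exact_mod_cast hl
    _ ≤ 16 / (r : ℝ) ^ 4 + 1 / (r : ℝ) ^ 4 := (prob_or_le _ _ _).trans (add_le_add h1 h2)
    _ = _ := by ring

/-- The r^6 most recent hops must not return, which costs 4 r^-3. Whatever they are, the at least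
r^8 hops before them must hit one residue class modulo R, which costs 17 r^-4. -/
theorem prob_moved_le_of_le (hr : 2 ≤ r) (hr2 : 2 ∣ r) {t : ℕ} (ht : r ^ 6 + r ^ 8 ≤ t) :
    prob t (Moved (r ^ 6)) ≤ 68 / (r : ℝ) ^ 7 := by
  have hr0 : (0 : ℝ) < r := by positivity
  obtain ⟨q, hq⟩ : 2 ∣ r ^ 6 := dvd_pow hr2 (by norm_num)
  have hq' : (r : ℝ) ^ 6 = 2 * q := by exact_mod_cast hq
  have hq1 : 1 ≤ q := by
    have : 0 < r ^ 6 := by positivity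
    omega
  have h1 : prob (r ^ 6) NoReturn ≤ 4 / (r : ℝ) ^ 3 := by
    rw [hq]
    have hq0 : (0 : ℝ) < q := by exact_mod_cast hq1
    refine (prob_noReturn_le hq1 (y := (r : ℝ) ^ 3) (by positivity)
      (by rw [← pow_mul]; norm_num only; linarith)).trans_eq ?_
    rw [div_eq_div_iff (by positivity) (by positivity)]
    linear_combination 2 * hq'
  obtain ⟨d, rfl⟩ := Nat.exists_eq_add_of_le (le_trans (Nat.le_add_right _ _) ht)
  have h2 : ∀ x, prob d (fun l => ((r ^ 6 : ℕ) : ℤ) ∣ x + pos l) ≤ 17 / (r : ℝ) ^ 4 :=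
    prob_dvd_antitone (by omega) (prob_dvd_le hr hr2)
  refine (prob_append_le (fun a => h2 (pos a)) (p := NoReturn) fun a b ha _ h =>
    ⟨h.noReturn ha.le, pos_append a b ▸ h.dvd⟩).trans ?_
  calc _ ≤ 4 / (r : ℝ) ^ 3 * (17 / (r : ℝ) ^ 4) := by gcongr
    _ = _ := by field_simp; norm_num

/-- Union bound over at most 2 r^8 times, each contributing at most 2 exp(-r^4/4) ≤ 2 * 24 * 256 /
r^16; and 24576 = 2 * 2 * 24 * 256. -/
theorem prob_moved_le_of_lt (hr : 2 ≤ r) {t : ℕ} (ht : t < r ^ 6 + r ^ 8) :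
    prob t (Moved (r ^ 6)) ≤ 24576 / (r : ℝ) ^ 7 := by
  have hr0 : (0 : ℝ) < r := by positivity
  have hr1 : (1 : ℝ) ≤ r := by exact_mod_cast (by omega : 1 ≤ r)
  have h68 : r ^ 6 ≤ r ^ 8 := Nat.pow_le_pow_right (by omega) (by norm_num)
  have h1 : ∀ j ∈ Finset.range (t + 1),
      prob t (fun l => (r : ℝ) ^ 6 ≤ |(pos (l.drop j) : ℝ)|) ≤ 2 * (24 / ((r : ℝ) ^ 4 / 4) ^ 4) := by
    intro j hj
    rw [Finset.mem_range] at hj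
    obtain ⟨s, rfl⟩ := Nat.exists_eq_add_of_le (Nat.lt_succ_iff.1 hj)
    refine (prob_drop j s fun l => (r : ℝ) ^ 6 ≤ |(pos l : ℝ)|).trans ?_
    refine (prob_le_abs_pos (t := 2 * r ^ 8) (by omega) _ (x := 1 / (2 * (r : ℝ) ^ 2))
      (by positivity)).trans ?_
    have h3 : (1 / (2 * (r : ℝ) ^ 2)) ^ 2 / 2 * ((2 * r ^ 8 : ℕ) : ℝ) -
        1 / (2 * (r : ℝ) ^ 2) * (r : ℝ) ^ 6 = -((r : ℝ) ^ 4 / 4) := by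
      push_cast; field_simp; ring
    rw [h3]
    gcongr
    exact exp_neg_le (by positivity)
  calc prob t (Moved (r ^ 6))
      ≤ prob t (fun l => ∃ j ∈ Finset.range (t + 1), (r : ℝ) ^ 6 ≤ |(pos (l.drop j) : ℝ)|) := by
        refine prob_mono fun l hl h => ?_
        obtain ⟨j, hj, hp⟩ := h.exists_far
        exact ⟨j, by rw [Finset.mem_range]; omega, by exact_mod_cast hp⟩
    _ ≤ ∑ j ∈ Finset.range (t + 1), 2 * (24 / ((r : ℝ) ^ 4 / 4) ^ 4) :=
        (prob_exists_le _ _).trans (Finset.sum_le_sum h1)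
    _ = ((t + 1 : ℕ) : ℝ) * (2 * (24 / ((r : ℝ) ^ 4 / 4) ^ 4)) := by simp
    _ ≤ ((2 * r ^ 8 : ℕ) : ℝ) * (2 * (24 / ((r : ℝ) ^ 4 / 4) ^ 4)) := by
        gcongr; omega
    _ = 24576 / (r : ℝ) ^ 8 := by push_cast; field_simp; norm_num
    _ ≤ 24576 / (r : ℝ) ^ 7 := by gcongr; norm_num

end

/-- With r = 2^k the radius 64^k is r^6 and 128^k is r^7. The ratio 64 of the radii makes the sixth
root of R an integer, and an even one for k > 0. -/
theorem prob_moved_le (k t : ℕ) : prob t (Moved (64 ^ k)) ≤ 24576 / 128 ^ k := by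
  cases k with
  | zero => exact (prob_le_one _ _).trans (by norm_num)
  | succ k =>
    have h2 : 2 ∣ 2 ^ (k + 1) := dvd_pow_self 2 (by omega)
    have hr : 2 ≤ 2 ^ (k + 1) := Nat.le_of_dvd (by positivity) h2
    have h64 : 64 ^ (k + 1) = (2 ^ (k + 1)) ^ 6 := by rw [← pow_mul, mul_comm, pow_mul]; norm_num
    have h128 : (128 : ℝ) ^ (k + 1) = ((2 ^ (k + 1) : ℕ) : ℝ) ^ 7 := by
      push_cast; rw [← pow_mul, mul_comm (k + 1), pow_mul]; norm_num
    rw [h64, h128]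
    rcases le_or_gt ((2 ^ (k + 1)) ^ 6 + (2 ^ (k + 1)) ^ 8) t with ht | ht
    · refine (prob_moved_le_of_le hr h2 ht).trans ?_
      gcongr; norm_num
    · exact prob_moved_le_of_lt hr ht

/-- The rebuilding cost 64^j against the probability 24576 / 128^j leaves a geometric series with
ratio 1/2. -/
theorem avg_work_le (T t : ℕ) : avg t (fun l => (work T l : ℝ)) ≤ 49152 := by
  classical
  have h1 : ∀ l, (work T l : ℝ) =
      ∑ j ∈ Finset.range T, 64 ^ j * if Moved (64 ^ j) l then (1 : ℝ) else 0 := by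
    intro l
    simp [work]
  simp only [h1]
  rw [avg_sum]
  calc _ ≤ ∑ j ∈ Finset.range T, 24576 * (1 / 2 : ℝ) ^ j := by
        refine Finset.sum_le_sum fun j _ => ?_
        rw [avg_mul]
        have h2 := prob_moved_le j t
        unfold prob at h2
        calc _ ≤ (64 : ℝ) ^ j * (24576 / 128 ^ j) := by gcongr
          _ = _ := by
            rw [show (128 : ℝ) = 64 * 2 by norm_num, mul_pow, one_div, inv_pow]; field_simp
    _ ≤ 24576 * 2 := by
        rw [← Finset.mul_sum]
        gcongr
        have := Summable.sum_le_tsum (f := fun j : ℕ => (1 / 2 : ℝ) ^ j) (Finset.range T)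
          (fun _ _ => by positivity) summable_geometric_two
        rwa [tsum_geometric_two] at this
    _ = _ := by norm_num

/-! ### The random walk -/

theorem exists_hist_of_mem_support {n : ℕ} [NeZero n] {t : ℕ} {h : List (Fin n)}
    (hh : h ∈ (walkLaw n t).support) : ∃ bs : List Bool, bs.length = t ∧ h = hist n bs := by
  induction t generalizing h with
  | zero =>
    rw [walkLaw, PMF.mem_support_pure_iff] at hh
    exact ⟨[], rfl, hh⟩
  | succ t ih =>
    rw [walkLaw, PMF.mem_support_bind_iff] at hh
    obtain ⟨h', h1, h2⟩ := hh
    obtain ⟨bs, rfl, rfl⟩ := ih h1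
    rw [PMF.mem_support_map_iff] at h2
    obtain ⟨v, h3, rfl⟩ := h2
    rw [hopLaw, PMF.mem_support_map_iff] at h3
    obtain ⟨b, -, rfl⟩ := h3
    exact ⟨b :: bs, rfl, rfl⟩

theorem tsum_pmf_map_mul {α β : Type*} (p : PMF α) (f : α → β) (g : β → ℝ≥0∞) :
    ∑' b, p.map f b * g b = ∑' a, p a * g (f a) := by
  classical
  simp only [PMF.map_apply, ← ENNReal.tsum_mul_right]
  rw [ENNReal.tsum_comm]
  refine tsum_congr fun a => ?_
  rw [tsum_eq_single (f a)]
  · simp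
  · intro b hb; simp [hb]

theorem tsum_pmf_bind_mul {α β : Type*} (p : PMF α) (f : α → PMF β) (g : β → ℝ≥0∞) :
    ∑' b, p.bind f b * g b = ∑' a, p a * ∑' b, f a b * g b := by
  simp only [PMF.bind_apply, ← ENNReal.tsum_mul_right]
  rw [ENNReal.tsum_comm]
  refine tsum_congr fun a => ?_
  rw [← ENNReal.tsum_mul_left]
  exact tsum_congr fun b => mul_assoc _ _ _

theorem avg_succ' (t : ℕ) (f : List Bool → ℝ) :
    avg (t + 1) f = avg t fun l => 1 / 2 * f (true :: l) + 1 / 2 * f (false :: l) := by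
  rw [avg_add, avg_mul, avg_mul, avg]; ring

/-- The head of the list is the latest hop. Averaging over it first, by `avg_succ'`, matches the
`bind` in `walkLaw`; the induction hypothesis is then applied to the averaged function. -/
theorem tsum_walkLaw {n : ℕ} [NeZero n] (t : ℕ) {g : List (Fin n) → ℝ} (hg : ∀ h, 0 ≤ g h) :
    ∑' h, walkLaw n t h * ENNReal.ofReal (g h) = ENNReal.ofReal (avg t fun l => g (hist n l)) := by
  induction t generalizing g with
  | zero =>
    rw [walkLaw, tsum_eq_single [0]]
    · simp [avg, hist]
    · intro h hh; simp [hh]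
  | succ t ih =>
    rw [walkLaw, tsum_pmf_bind_mul, avg_succ']
    have h1 : ∀ h : List (Fin n), ∑' h', ((hopLaw (h.headD 0)).map fun v => v :: h) h' *
        ENNReal.ofReal (g h') = ENNReal.ofReal
          (1 / 2 * g ((h.headD 0 + 1) :: h) + 1 / 2 * g ((h.headD 0 - 1) :: h)) := by
      intro h
      rw [tsum_pmf_map_mul, hopLaw, tsum_pmf_map_mul, tsum_bool,
        ENNReal.ofReal_add (mul_nonneg (by norm_num) (hg _)) (mul_nonneg (by norm_num) (hg _)),
        ENNReal.ofReal_mul (by norm_num), ENNReal.ofReal_mul (by norm_num), add_comm]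
      simp
    simp only [h1]
    exact ih fun h => add_nonneg (mul_nonneg (by norm_num) (hg _)) (mul_nonneg (by norm_num) (hg _))

theorem mul_pow_le_pow {C n k : ℕ} (hC : 2 * k ≤ C) (hn : 2 ≤ n) (hk : k + 100 ≤ C) {c : ℕ} (hc : c < 2 ^ 100) :
    c * n ^ k ≤ n ^ C := by
  obtain ⟨d, rfl⟩ := Nat.exists_eq_add_of_le hk
  calc c * n ^ k ≤ n ^ 100 * n ^ k := by
        have : 2 ^ 100 ≤ n ^ 100 := Nat.pow_le_pow_left hn _
        gcongr; omega
    _ = n ^ (k + 100) := by rw [← pow_add, add_comm]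
    _ ≤ _ := Nat.pow_le_pow_right (by omega) (by omega)

theorem exists_levels (n : ℕ) : ∃ T, ∀ j, j < T ↔ 2 * 64 ^ j ≤ n := by
  have hex : ∃ j, n < 2 * 64 ^ j := ⟨n, by have := Nat.lt_pow_self (n := n) (show 1 < 64 by omega); omega⟩
  classical
  refine ⟨Nat.find hex, fun j => ?_⟩
  constructor
  · intro h
    simpa using Nat.find_min hex h
  · intro h
    by_contra h'
    have h1 := Nat.find_spec hex
    have : 64 ^ Nat.find hex ≤ 64 ^ j := Nat.pow_le_pow_right (by omega) (not_lt.1 h')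
    omega

theorem mainTheorem3 :
    ∃ (A : Algorithm) (C : ℕ), ∀ (n : ℕ) [NeZero n], 3 ≤ n → ∀ G : EventCycle n,
      ∃ (time : List (Fin n) → ℕ) (mem : List (Fin n) → Mem),
        (∀ (t : ℕ), ∀ h ∈ (walkLaw n t).support,
          Run A G (C * n) (n ^ C) h (time h) (mem h)) ∧
        (∀ (t : ℕ) (v : Fin n) (h : List (Fin n)), 1 ≤ t → v :: h ∈ (walkLaw n t).support →
          G.req v = Request.query →
            G.IsSucc (G.active (v :: h)) (G.item v) (mem (v :: h) 1)) ∧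
        time [0] ≤ n ^ C ∧
        ∀ t : ℕ, 1 ≤ t → ∑' h : List (Fin n), walkLaw n t h * (time h : ℝ≥0∞) ≤ (C : ℝ≥0∞) := by
  -- The factors come from `wp_serve_inv` and `avg_work_le`. The product is also large enough for
  -- the 10000n cells and as the exponent of n.
  obtain ⟨C, hC⟩ : ∃ C, C = 192000 * 49152 := ⟨_, rfl⟩
  refine ⟨windowAlgorithm, C, fun n _ hn G => ?_⟩
  obtain ⟨T, hT⟩ := exists_levels n
  have hSW : C * n ^ 1 ≤ n ^ C := mul_pow_le_pow (by omega) (by omega) (by omega) (by rw [hC]; norm_num)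
  have hsetup : 100000 * n ^ 2 ≤ n ^ C :=
    mul_pow_le_pow (by omega) (by omega) (by omega) (by norm_num)
  rw [pow_one] at hSW
  have hr : Room n (C * n) (n ^ C) :=
    ⟨by omega, Nat.mul_le_mul_right _ (by omega), hSW⟩
  have hrun := fun bs => exists_run (G := G) hr (by omega) hT bs
  classical
  choose τ m s h1 h2 h3 h4 h5 using hrun
  -- No injectivity of `hist` is needed: runs are unique, so lists of hops with the same history
  -- have the same time and memory.
  have hex : ∃ (time : List (Fin n) → ℕ) (mem : List (Fin n) → Mem), ∀ bs,
      time (hist n bs) = τ bs ∧ mem (hist n bs) = m bs := by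
    let P : List (Fin n) → ℕ × Mem → Prop := fun h x =>
      Run windowAlgorithm G (C * n) (n ^ C) h x.1 x.2
    have hP : ∀ h, ∃ x, (∃ y, P h y) → P h x := fun h => by
      by_cases hh : ∃ y, P h y
      · exact ⟨hh.choose, fun _ => hh.choose_spec⟩
      · exact ⟨(0, fun _ => 0), fun h' => absurd h' hh⟩
    choose x hx using hP
    exact ⟨fun h => (x h).1, fun h => (x h).2, fun bs =>
      (hx (hist n bs) ⟨(τ bs, m bs), h1 bs⟩).unique (h1 bs)⟩
  obtain ⟨time, mem, htm⟩ := hex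
  refine ⟨time, mem, ?_, ?_, ?_, ?_⟩
  · intro t h hh
    obtain ⟨bs, -, rfl⟩ := exists_hist_of_mem_support hh
    rw [(htm bs).1, (htm bs).2]
    exact h1 bs
  · intro t v h ht hh _
    obtain ⟨bs, hbs, he⟩ := exists_hist_of_mem_support hh
    rw [he, (htm bs).2]
    exact (h5 bs (by rintro rfl; simp at hbs; omega)).2 v h he.symm
  · have := (htm []).1
    rw [show hist n [] = [0] from rfl] at this
    rw [this]
    exact (h4 [] rfl).trans hsetup
  · intro t ht
    have e : ∀ h, (time h : ℝ≥0∞) = ENNReal.ofReal (time h : ℝ) := fun h => by simp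
    simp only [e]
    rw [tsum_walkLaw t fun h => Nat.cast_nonneg _]
    rw [← ENNReal.ofReal_natCast C]
    refine ENNReal.ofReal_le_ofReal ?_
    calc avg t (fun l => (time (hist n l) : ℝ)) ≤ avg t (fun l => 192000 * (work T l : ℝ)) := by
          refine avg_mono fun l hl => ?_
          rw [(htm l).1]
          exact_mod_cast (h5 l (by rintro rfl; simp at hl; omega)).1
      _ ≤ 192000 * 49152 := by
          rw [avg_mul]
          have := avg_work_le T t
          linarith
      _ = C := by rw [hC]; norm_num
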